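/- **Setting.** Let $S(T^*\mathbb R^3,0)$ be the set of symplectic diffeomorphism germs of $(T^*\mathbb R^3,0)$, with coordinates $(q,p)$ and $\pi(q,p)=q$. Let $S^l(3)$ be the smooth manifold of their $l$-jets at $0$. For $\sigma\subset I_2=\{1,2\}$ put $$L^0_\sigma=\{(q,p)\in (T^*\mathbb R^3,0)\mid q_\sigma=p_{I_2-\sigma}=q_3=0,\ q_{I_2-\sigma}\ge 0\},$$ and let $\mathbb L$ be the union of the $L^0_\sigma$. A *reticular Lagrangian map* is a germ $\pi\circ i$, where $i=S|_{\mathbb L}$ for some $S\in S(T^*\mathbb R^3,0)$; such an $S$ is called an *extension* of $i$. A smooth function germ $F(x,y,q)$ on $(\mathbb R_{\ge0}^2\times\mathbb R^k\times\mathbb R^3,0)$ with $F(0)=0$, $dF(0)=0$ is a *generating family* of $\pi\circ i$ if the differentials at $0$ of $x_1,x_2,\partial F/\partial x_1,\partial F/\partial x_2,\partial F/\partial y_1,\dots,\partial F/\partial y_k$ are linearly independent and, for every $\sigma\subset I_2$, as set germs at $0$, $$i(L^0_\sigma)=\Big\{\big(q,\tfrac{\partial F}{\partial q}(x,y,q)\big)\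 \Big|\ x_\sigma=\tfrac{\partial F}{\partial x_{I_2-\sigma}}=\tfrac{\partial F}{\partial y}=0,\ x_{I_2-\sigma}\ge0\Big\}.$$ Two such germs $F,G$ (with the same $k$) are *reticular $\mathcal P$-$\mathcal C$-equivalent* if $G(x,y,q)=a(q)\,F(\Phi(x,y,q))+b(q)$ for smooth germs $a,b$ with $a(0)\neq0$ and a diffeomorphism germ $\Phi$ of $(\mathbb R_{\ge0}^2\times\mathbb R^k\times\mathbb R^3,0)$ of the form $\Phi(x,y,q)=(x_1\phi_1(x,y,q),x_2\phi_2(x,y,q),\phi_3(x,y,q),\phi_4(q))$. For $S\in S(T^*\mathbb R^3,0)$, the *Lagrangian equivalence class* $[S]_L$ is the set of all germs $\Theta\circ S\circ\varphi^{-1}$, where $\varphi,\Theta\in S(T^*\mathbb R^3,0)$, $\varphi(L_\sigma^0)=L_\sigma^0$ for all $\sigma\subset I_2$, and $\Theta$ maps fibres of $\pi$ to fibres of $\pi$. The *caustic-equivalence class* $[S]_c$ is the union of the classes $[R]_L$ over all $R\in S(T^*\mathbb R^3,0)$ such that, for some $k$, the reticular Lagrangian maps $\pi\circ S|_{\mathbb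 L}$ and $\pi\circ R|_{\mathbb L}$ have generating families that are reticular $\mathcal P$-$\mathcal C$-equivalent. Let $[j^lS(0)]_c\subset S^l(3)$ be the set of $l$-jets at $0$ of the elements of $[S]_c$. **Corollary 4.2.** For each $a>\frac14$ let $S'_a\in S(T^*\mathbb R^3,0)$ be an extension of a reticular Lagrangian embedding $i_a$ such that $\pi\circ i_a:(\mathbb L,0)\to(T^*\mathbb R^3,0)\to(\mathbb R^3,0)$ has the generating family $$F'_a(x_1,x_2,q_1,q_2,q_3)=x_1^2+x_1x_2+a x_2^2+q_1x_1+q_2x_2+q_3x_2^2 .$$ Then, for every $l\ge1$, the weak caustic-equivalence class $$[j^lS'_1(0)]_w:=\bigcup_{a>\frac14}[j^lS'_a(0)]_c$$ is an immersed manifold in $S^l(3)$, that is, a subset of $S^l(3)$ that is the image of an injective immersion of a (Hausdorff, second countable, finite-dimensional) smooth manifold. -/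

import Mathlib

open scoped ContDiff Manifold Topology

noncomputable section

namespace RetLag

/-! Symplectic diffeomorphism germs on `(T*ℝ³, 0)`. A germ is represented by a function that is
defined everywhere; only its behaviour near `0` is ever used. -/

/-- The cotangent bundle `T*ℝ³`, with points `(q, p)`. -/
abbrev Cot : Type := (Fin 3 → ℝ) × (Fin 3 → ℝ)

/-- `F` is a smooth germ at `0`: it is `C^∞` on a neighbourhood of `0`. -/
def SmoothGerm {E E' : Type*} [NormedAddCommGroup E] [NormedSpace ℝ E]
    [NormedAddCommGroup E'] [NormedSpace ℝ E'] (F : E → E') : Prop :=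
  ∀ᶠ z in 𝓝 (0 : E), ContDiffAt ℝ ∞ F z

/-- The canonical symplectic form `∑ dpᵢ ∧ dqᵢ` on `T*ℝ³`. -/
def omega (u v : Cot) : ℝ := ∑ i, (u.2 i * v.1 i - v.2 i * u.1 i)

/-- `S ∈ S(T*ℝ³, 0)`: `S` is a symplectic diffeomorphism germ on `(T*ℝ³, 0)`. (A smooth germ that
preserves `omega` has invertible differentials, so it is a local diffeomorphism.) -/
def IsSymplecticGerm (S : Cot → Cot) : Prop :=
  S 0 = 0 ∧ SmoothGerm S ∧
    ∀ᶠ z in 𝓝 (0 : Cot), ∀ u v, omega (fderiv ℝ S z u) (fderiv ℝ S z v) = omega u v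

/-- For `σ ⊆ I₂`, the set `L_σ⁰ = {q_σ = 0, p_{I₂ - σ} = 0, q_{I₂ - σ} ≥ 0, q₃ = 0}`.
The coordinates with indices in `I₂ = {1, 2}` are the first two, `i.castSucc` for `i : Fin 2`. -/
def L0 (σ : Finset (Fin 2)) : Set Cot :=
  {z | (∀ i ∈ σ, z.1 i.castSucc = 0) ∧
       (∀ i ∉ σ, z.2 i.castSucc = 0 ∧ 0 ≤ z.1 i.castSucc) ∧ z.1 2 = 0}

/-! Generating families on the corner `ℍ² × ℝᵏ × ℝ³`. A smooth germ on the corner is the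
restriction of a smooth germ on `ℝ² × ℝᵏ × ℝ³`. -/

/-- The space of `(x, y, q)`, `x ∈ ℝ²`, `y ∈ ℝᵏ`, `q ∈ ℝ³`. -/
abbrev Par (k : ℕ) : Type := (Fin 2 → ℝ) × (Fin k → ℝ) × (Fin 3 → ℝ)

/-- `∂F/∂xᵢ`. -/
def dx {k : ℕ} (F : Par k → ℝ) (i : Fin 2) (z : Par k) : ℝ := fderiv ℝ F z (Pi.single i 1, 0, 0)

/-- `∂F/∂yⱼ`. -/
def dy {k : ℕ} (F : Par k → ℝ) (j : Fin k) (z : Par k) : ℝ := fderiv ℝ F z (0, Pi.single j 1, 0)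

/-- `∂F/∂qₘ`. -/
def dq {k : ℕ} (F : Par k → ℝ) (m : Fin 3) (z : Par k) : ℝ := fderiv ℝ F z (0, 0, Pi.single m 1)

/-- The part over `U` of the Lagrangian set generated by `F` restricted to `x_σ = 0`:
`{(q, ∂F/∂q(x,y,q)) | (x,y,q) ∈ U, x_σ = 0, ∂F/∂x_{I₂ - σ} = 0, x_{I₂ - σ} ≥ 0, ∂F/∂y = 0}`. -/
def lagSet {k : ℕ} (F : Par k → ℝ) (σ : Finset (Fin 2)) (U : Set (Par k)) : Set Cot :=
  (fun z : Par k => ((z.2.2, fun m => dq F m z) : Cot)) ''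
    {z | z ∈ U ∧ (∀ i ∈ σ, z.1 i = 0) ∧ (∀ i ∉ σ, dx F i z = 0 ∧ 0 ≤ z.1 i) ∧
      ∀ j, dy F j z = 0}

/-- `F ∈ 𝔐(2; k+3)²` is non-degenerate: `x₁, x₂, ∂F/∂x₁, ∂F/∂x₂, ∂F/∂y₁, …, ∂F/∂yₖ` have
linearly independent differentials at `0`. -/
def Nondegenerate {k : ℕ} (F : Par k → ℝ) : Prop :=
  Function.Surjective (fderiv ℝ (fun z : Par k =>
    (((z.1, fun i => dx F i z, fun j => dy F j z)) :
      (Fin 2 → ℝ) × (Fin 2 → ℝ) × (Fin k → ℝ))) 0)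

/-- `F` is a generating family of the reticular Lagrangian map `π ∘ S|_𝕃`, that is, `S` is an
extension of a reticular Lagrangian embedding `i` such that `F` generates `π ∘ i`: `F` is a
non-degenerate germ in `𝔐(2; k+3)²` and, for every `σ ⊆ I₂`, the set germ `S(L_σ⁰)` at `0` is the
germ of the Lagrangian set generated by `F` restricted to `x_σ = 0`. -/
def IsGeneratingFamily {k : ℕ} (F : Par k → ℝ) (S : Cot → Cot) : Prop :=
  SmoothGerm F ∧ F 0 = 0 ∧ fderiv ℝ F 0 = 0 ∧ Nondegenerate F ∧
    ∀ σ : Finset (Fin 2), ∃ U₀ ∈ 𝓝 (0 : Par k), ∀ U ∈ 𝓝 (0 : Par k), U ⊆ U₀ →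
      ∀ᶠ z in 𝓝 (0 : Cot), (S z ∈ lagSet F σ U ↔ z ∈ L0 σ)

/-- Reticular 𝒫-𝒞-equivalence: `G = a · F ∘ Φ + b` on the corner, where
`Φ(x,y,q) = (x₁φ₁¹(x,y,q), x₂φ₁²(x,y,q), φ₂(x,y,q), φ₃(q))` is a diffeomorphism germ of the
corner, `a` is a unit of `ℰ(3)` and `b ∈ ℰ(3)`. -/
def PCEquiv {k : ℕ} (F G : Par k → ℝ) : Prop :=
  ∃ (φ₁ : Par k → Fin 2 → ℝ) (φ₂ : Par k → Fin k → ℝ) (φ₃ : (Fin 3 → ℝ) → Fin 3 → ℝ)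
    (a b : (Fin 3 → ℝ) → ℝ) (Φ : Par k → Par k),
    SmoothGerm φ₁ ∧ SmoothGerm φ₂ ∧ SmoothGerm φ₃ ∧ SmoothGerm a ∧ SmoothGerm b ∧
    (∀ i, 0 < φ₁ 0 i) ∧ φ₂ 0 = 0 ∧ φ₃ 0 = 0 ∧ a 0 ≠ 0 ∧
    (∀ z, Φ z = (fun i => z.1 i * φ₁ z i, φ₂ z, φ₃ z.2.2)) ∧
    Function.Bijective (fderiv ℝ Φ 0) ∧
    ∀ᶠ z in 𝓝 (0 : Par k), (∀ i, 0 ≤ z.1 i) → G z = a z.2.2 * F (Φ z) + b z.2.2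

/-! Equivalence classes of symplectic diffeomorphism germs. -/

/-- A reticular diffeomorphism: a symplectic diffeomorphism germ that maps each set germ `L_σ⁰`
to itself. -/
def IsReticularDiffeo (φ : Cot → Cot) : Prop :=
  IsSymplecticGerm φ ∧ ∀ σ, ∀ᶠ z in 𝓝 (0 : Cot), (φ z ∈ L0 σ ↔ z ∈ L0 σ)

/-- A Lagrangian equivalence of `π : T*ℝ³ → ℝ³`, `π(q, p) = q`: a symplectic diffeomorphism germ
that maps fibres of `π` to fibres of `π`. -/
def IsLagrangianDiffeo (Θ : Cot → Cot) : Prop :=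
  IsSymplecticGerm Θ ∧ ∃ g : (Fin 3 → ℝ) → (Fin 3 → ℝ), ∀ᶠ z in 𝓝 (0 : Cot), (Θ z).1 = g z.1

/-- The reticular Lagrangian maps of `S` and `T` are Lagrangian equivalent: `T ∘ φ = Θ ∘ S` for
a reticular diffeomorphism `φ` and a Lagrangian equivalence `Θ`. (Asking for this equality only on
`𝕃` gives the same relation, with `φ` replaced by `T⁻¹ ∘ Θ ∘ S`.) -/
def LagrangianEquiv (S T : Cot → Cot) : Prop :=
  ∃ φ Θ, IsReticularDiffeo φ ∧ IsLagrangianDiffeo Θ ∧ ∀ᶠ z in 𝓝 (0 : Cot), T (φ z) = Θ (S z)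

/-- The Lagrangian equivalence class `[S]_L ⊆ S(T*ℝ³, 0)`. -/
def lagrangianClass (S : Cot → Cot) : Set (Cot → Cot) :=
  {T | IsSymplecticGerm T ∧ LagrangianEquiv S T}

/-- The caustic-equivalence class `[S]_c ⊆ S(T*ℝ³, 0)`: the union of the classes `[R]_L` over all
`R` such that the reticular Lagrangian maps of `S` and `R` have (stably) reticular
𝒫-𝒞-equivalent generating families. (Stabilisation is built in: `k` is arbitrary, and adding a
non-degenerate quadratic form in new variables `y` to a generating family gives another generating
family of the same map.) -/
def causticClass (S : Cot → Cot) : Set (Cot → Cot) :=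
  {T | ∃ R, IsSymplecticGerm R ∧
    (∃ (k : ℕ) (F G : Par k → ℝ),
      IsGeneratingFamily F S ∧ IsGeneratingFamily G R ∧ PCEquiv F G) ∧
    T ∈ lagrangianClass R}

/-! Jets and immersed manifolds. -/

/-- Taylor data of order `≤ l` at `0` of maps `T*ℝ³ → T*ℝ³`, a finite-dimensional vector space. -/
abbrev JetSpace (l : ℕ) : Type :=
  ∀ m : Fin (l + 1), ContinuousMultilinearMap ℝ (fun _ : Fin (m : ℕ) => Cot) Cot

/-- The `l`-jet `j^l S(0)`, given by the derivatives of order `≤ l` at `0`. -/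
def jet (l : ℕ) (S : Cot → Cot) : JetSpace l := fun m => iteratedFDeriv ℝ (m : ℕ) S 0

/-- `S^l(3)`, the set of `l`-jets of elements of `S(T*ℝ³, 0)`; it is an embedded smooth submanifold
of the vector space `JetSpace l`, and carries that manifold structure. -/
def symplecticJets (l : ℕ) : Set (JetSpace l) := jet l '' {S | IsSymplecticGerm S}

/-- `W` is an immersed manifold in `N`, where `N` is an embedded submanifold of the vector space
`V`: `W ⊆ N`, and `W` is the image of an injective immersion of a smooth (Hausdorff, second
countable, finite-dimensional) manifold. As `N` is embedded in `V`, smoothness and the immersion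
property of a map into `N` can be tested in `V`. -/
def IsImmersedManifoldIn {V : Type} [NormedAddCommGroup V] [NormedSpace ℝ V] (W N : Set V) :
    Prop :=
  W ⊆ N ∧
    ∃ (d : ℕ) (M : Type) (_ : TopologicalSpace M)
      (_ : ChartedSpace (EuclideanSpace ℝ (Fin d)) M) (f : M → V),
      T2Space M ∧ SecondCountableTopology M ∧ IsManifold (𝓡 d) ∞ M ∧
      ContMDiff (𝓡 d) 𝓘(ℝ, V) ∞ f ∧ Function.Injective f ∧
      (∀ x : M, Function.Injective (mfderiv (𝓡 d) 𝓘(ℝ, V) f x)) ∧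
      Set.range f = W

/-- `F'_a(x, q) = x₁² + x₁x₂ + a x₂² + q₁x₁ + q₂x₂ + q₃x₂²` (no variables `y`). -/
def Fa (a : ℝ) (z : Par 0) : ℝ :=
  z.1 0 ^ 2 + z.1 0 * z.1 1 + a * z.1 1 ^ 2 +
    z.2.2 0 * z.1 0 + z.2.2 1 * z.1 1 + z.2.2 2 * z.1 1 ^ 2

/-- The weak caustic-equivalence class `⋃_{a > 1/4} [j^l S'_a(0)]_c` of a family `S'`, where
`[j^l S(0)]_c` is the set of `l`-jets of the elements of `[S]_c`. -/
def weakCausticClass (l : ℕ) (S' : ℝ → Cot → Cot) : Set (JetSpace l) :=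
  ⋃ a ∈ Set.Ioi (1 / 4 : ℝ), jet l '' causticClass (S' a)

end RetLag

end

/-! The weak class is parametrised by an open set of generating functions. A symplectic germ (q, p)
↦ (Q, P) for which (q, Q) are coordinates is given by a function A(q, Q) with p = -∂A/∂q and P =
∂A/∂Q. The (l+1)-jet of A and the l-jet of the germ determine each other, smoothly in both
directions (`IsGen.jetEq`, `smoothNear_genJet`, `exists_smooth_potentialJet`). Since A vanishes to
second order at 0, its jets form a vector space, `potentialJets`. Every germ of the weak class has
such an A (`genJet_image_potentialClass`), so the class is the image of a set of potentials under an
injective map with local smooth left inverses. It remains to see that this set is open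
(`isOpen_potentialClass`).

Restricting A to q₃ = 0 gives a generating family without y-variables, with x = (q₁, q₂), because
all the sets L⁰_σ lie in q₃ = 0 (`IsGen.isGeneratingFamily`). Hence a multiple of q₃ may be added to
A at no cost, as long as the mixed Hessian stays invertible. Up to Lagrangian equivalence, the germs
of the class are generated by A = c(Q) F_a(x, g(Q)) + b(Q) + q₃B (`exists_normalData`). To get there
without a uniqueness theorem for generating families, one compares Lagrangian sets. An equivalence
moves a Lagrangian point in a way that depends only on the point, on the value of the family there
and on the action on parameters (`PCEquivOver.exists_map`). That value is the same for all families
of the same map: F_a is homogeneous of degree 2 when x, q₁, q₂ have weight 1 and q₃ has weight 0, so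
the value on the critical sets is (q₁p₁ + q₂p₂)/2 (`IsGeneratingFamily.critical_value`).

Openness is infinitesimal versality: every polynomial potential is tangent to the family of normal
forms (`inTangent_potential`). Modulo the fields x₁∂/∂x₁ and x₂∂/∂x₂, the monomials 1, x₁, x₂, x₂²
suffice, because 4a - 1 and a are nonzero. The monomial x₂² belongs to the unfolding parameter q₃
and also moves the modulus a, so the union over a fills an open set
(`NormalData.eventually_exists_good`). Conjugation by a fixed Lagrangian equivalence carries this
from the normal forms to the whole class. -/

noncomputable section

namespace RetLag

/-! ### Germs that are smooth near a point -/

section Smooth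

variable {E F G H : Type} [NormedAddCommGroup E] [NormedSpace ℝ E]
  [NormedAddCommGroup F] [NormedSpace ℝ F] [NormedAddCommGroup G] [NormedSpace ℝ G]
  [NormedAddCommGroup H] [NormedSpace ℝ H]

/-- `f` is `C^∞` on a neighbourhood of `x`. -/
def SmoothNear (f : E → F) (x : E) : Prop := ∀ᶠ z in 𝓝 x, ContDiffAt ℝ ∞ f z

theorem SmoothNear.contDiffAt {f : E → F} {x : E} (h : SmoothNear f x) : ContDiffAt ℝ ∞ f x :=
  h.self_of_nhds

theorem SmoothNear.differentiableAt {f : E → F} {x : E} (h : SmoothNear f x) :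
    DifferentiableAt ℝ f x :=
  h.contDiffAt.differentiableAt (by simp)

theorem SmoothNear.continuousAt {f : E → F} {x : E} (h : SmoothNear f x) : ContinuousAt f x :=
  h.contDiffAt.continuousAt

theorem SmoothNear.eventually {f : E → F} {x : E} (h : SmoothNear f x) :
    ∀ᶠ z in 𝓝 x, SmoothNear f z :=
  eventually_eventually_nhds.2 h

theorem SmoothNear.eventually_differentiableAt {f : E → F} {x : E} (h : SmoothNear f x) :
    ∀ᶠ z in 𝓝 x, DifferentiableAt ℝ f z :=
  h.mono fun _ hz => hz.differentiableAt (by simp)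

theorem ContDiff.smoothNear {f : E → F} (h : ContDiff ℝ ∞ f) (x : E) : SmoothNear f x :=
  Filter.Eventually.of_forall fun _ => h.contDiffAt

theorem SmoothNear.congr {f g : E → F} {x : E} (h : SmoothNear f x) (hfg : g =ᶠ[𝓝 x] f) :
    SmoothNear g x := by
  filter_upwards [h, eventually_eventually_nhds.2 hfg] with z hz hz'
  exact hz.congr_of_eventuallyEq hz'

theorem SmoothNear.comp {g : F → G} {f : E → F} {x : E} (hg : SmoothNear g (f x))
    (hf : SmoothNear f x) : SmoothNear (fun z => g (f z)) x := by
  filter_upwards [hf, hf.continuousAt.eventually hg] with z h1 h2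
  exact ContDiffAt.comp z h2 h1

theorem SmoothNear.comp_of_eq {g : F → G} {f : E → F} {x : E} {y : F} (hg : SmoothNear g y)
    (hf : SmoothNear f x) (hy : f x = y) : SmoothNear (fun z => g (f z)) x := by
  subst hy; exact hg.comp hf

theorem SmoothNear.prodMk {f : E → F} {g : E → G} {x : E} (hf : SmoothNear f x)
    (hg : SmoothNear g x) : SmoothNear (fun z => (f z, g z)) x := by
  filter_upwards [hf, hg] with z h1 h2
  exact h1.prodMk h2

theorem smoothNear_const (c : F) (x : E) : SmoothNear (fun _ : E => c) x :=
  ContDiff.smoothNear contDiff_const x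

theorem smoothNear_id (x : E) : SmoothNear (fun z : E => z) x := ContDiff.smoothNear contDiff_id x

theorem SmoothNear.fst {f : E → F × G} {x : E} (hf : SmoothNear f x) :
    SmoothNear (fun z => (f z).1) x := hf.mono fun _ h => h.fst

theorem SmoothNear.snd {f : E → F × G} {x : E} (hf : SmoothNear f x) :
    SmoothNear (fun z => (f z).2) x := hf.mono fun _ h => h.snd

theorem SmoothNear.add {f g : E → F} {x : E} (hf : SmoothNear f x)
    (hg : SmoothNear g x) : SmoothNear (fun z => f z + g z) x := by
  filter_upwards [hf, hg] with z h1 h2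
  exact h1.add h2

theorem SmoothNear.sub {f g : E → F} {x : E} (hf : SmoothNear f x)
    (hg : SmoothNear g x) : SmoothNear (fun z => f z - g z) x := by
  filter_upwards [hf, hg] with z h1 h2
  exact h1.sub h2

theorem SmoothNear.neg {f : E → F} {x : E} (hf : SmoothNear f x) :
    SmoothNear (fun z => -f z) x := hf.mono fun _ h => h.neg

theorem SmoothNear.mul {f g : E → ℝ} {x : E} (hf : SmoothNear f x)
    (hg : SmoothNear g x) : SmoothNear (fun z => f z * g z) x := by
  filter_upwards [hf, hg] with z h1 h2
  exact h1.mul h2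

theorem SmoothNear.inv {f : E → ℝ} {x : E} (hf : SmoothNear f x) (h : f x ≠ 0) :
    SmoothNear (fun z => (f z)⁻¹) x := by
  filter_upwards [hf, hf.continuousAt.eventually_ne h] with z h1 h2
  exact h1.inv h2

theorem SmoothNear.sum {ι : Type*} {s : Finset ι} {f : ι → E → F} {x : E}
    (hf : ∀ i ∈ s, SmoothNear (f i) x) : SmoothNear (fun z => ∑ i ∈ s, f i z) x := by
  have : ∀ᶠ z in 𝓝 x, ∀ i ∈ s, ContDiffAt ℝ ∞ (f i) z := (Finset.eventually_all s).2 hf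
  filter_upwards [this] with z hz
  exact ContDiffAt.sum hz

theorem smoothNear_pi {ι : Type} [Fintype ι] {f : E → ι → ℝ} {x : E} :
    SmoothNear f x ↔ ∀ i, SmoothNear (fun z => f z i) x := by
  simp only [SmoothNear, contDiffAt_pi, Filter.eventually_all]

theorem SmoothNear.clm (L : F →L[ℝ] G) {f : E → F} {x : E} (hf : SmoothNear f x) :
    SmoothNear (fun z => L (f z)) x := (ContDiff.smoothNear L.contDiff _).comp hf

theorem SmoothNear.clm_apply {f : E → F →L[ℝ] G} {g : E → F} {x : E} (hf : SmoothNear f x)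
    (hg : SmoothNear g x) : SmoothNear (fun z => f z (g z)) x := by
  filter_upwards [hf, hg] with z h1 h2
  exact h1.clm_apply h2

theorem SmoothNear.bilin (B : F →L[ℝ] G →L[ℝ] H) {f : E → F} {g : E → G} {x : E}
    (hf : SmoothNear f x) (hg : SmoothNear g x) : SmoothNear (fun z => B (f z) (g z)) x :=
  (hf.clm B).clm_apply hg

theorem SmoothNear.fderiv {f : E → F} {x : E} (hf : SmoothNear f x) :
    SmoothNear (fun z => fderiv ℝ f z) x :=
  hf.mono fun _ h => h.fderiv_right (by simp)

theorem SmoothNear.partial_fderiv {G' : E → F → G} {x : E} {y : F}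
    (h : SmoothNear (Function.uncurry G') (x, y)) :
    SmoothNear (Function.uncurry fun t z => _root_.fderiv ℝ (G' t) z) (x, y) := by
  refine h.mono fun p hp => ?_
  refine ContDiffAt.fderiv (f := fun (q : E × F) (z : F) => G' q.1 z) (g := fun q => q.2)
    (x₀ := p) (n := ∞) ?_ contDiffAt_snd (by simp)
  exact ContDiffAt.comp (f := fun q : (E × F) × F => (q.1.1, q.2))
    (g := Function.uncurry G') (p, p.2) (by simpa using hp) (by fun_prop)

theorem SmoothNear.eventually_right {G' : E → F → G} {x : E} {y : F}
    (h : SmoothNear (Function.uncurry G') (x, y)) : ∀ᶠ t in 𝓝 x, SmoothNear (G' t) y := by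
  filter_upwards [Filter.Eventually.curry_nhds h] with t ht
  filter_upwards [ht] with z hz
  exact ContDiffAt.comp (f := fun z : F => (t, z)) (g := Function.uncurry G') z hz (by fun_prop)

theorem SmoothNear.left {G' : E → F → G} {x : E} {y : F}
    (h : SmoothNear (Function.uncurry G') (x, y)) : SmoothNear (fun t => G' t y) x :=
  SmoothNear.comp (g := Function.uncurry G') (f := fun t => (t, y)) h
    ((smoothNear_id x).prodMk (smoothNear_const y x))

/-- Iterated derivatives at a point depend smoothly on parameters. -/
theorem SmoothNear.iteratedFDeriv {G' : E → F → G} {x : E} {y : F}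
    (h : SmoothNear (Function.uncurry G') (x, y)) (m : ℕ) :
    SmoothNear (fun t => iteratedFDeriv ℝ m (G' t) y) x := by
  induction m generalizing G with
  | zero =>
    simp only [iteratedFDeriv_zero_eq_comp, Function.comp_apply]
    exact h.left.clm (continuousMultilinearCurryFin0 ℝ F G).symm.toContinuousLinearEquiv.toContinuousLinearMap
  | succ m ih =>
    simp only [iteratedFDeriv_succ_eq_comp_right, Function.comp_apply]
    exact (ih h.partial_fderiv).clm
      (continuousMultilinearCurryRightEquiv' ℝ m F G).symm.toContinuousLinearEquiv.toContinuousLinearMap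

/-- Second derivatives are symmetric. -/
theorem SmoothNear.fderiv_fderiv_symm {f : E → F} {x : E} (hf : SmoothNear f x) (u v : E) :
    _root_.fderiv ℝ (_root_.fderiv ℝ f) x u v = _root_.fderiv ℝ (_root_.fderiv ℝ f) x v u :=
  second_derivative_symmetric_of_eventually_of_real
    (hf.eventually_differentiableAt.mono fun _ h => h.hasFDerivAt)
    hf.fderiv.differentiableAt.hasFDerivAt u v

/-- Iterated derivatives are symmetric. -/
theorem SmoothNear.iteratedFDeriv_comp_perm {f : E → F} {x : E} (hf : SmoothNear f x) {m : ℕ}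
    (σ : Equiv.Perm (Fin m)) (v : Fin m → E) :
    _root_.iteratedFDeriv ℝ m f x (v ∘ σ) = _root_.iteratedFDeriv ℝ m f x v := by
  induction m generalizing F x with
  | zero => congr 1; ext i; exact i.elim0
  | succ m ih =>
    -- Adjacent transpositions generate all permutations, so only they need to be checked.
    suffices h : σ ∈ (⊤ : Submonoid (Equiv.Perm (Fin (m + 1)))) → ∀ v : Fin (m + 1) → E,
        _root_.iteratedFDeriv ℝ (m + 1) f x (v ∘ σ) = _root_.iteratedFDeriv ℝ (m + 1) f x v from
      h trivial v
    clear v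
    rw [← Equiv.Perm.mclosure_swap_castSucc_succ m]
    intro hσ
    induction hσ using Submonoid.closure_induction with
    | one => intro v; rfl
    | mul a b _ _ ha hb =>
      intro v
      rw [Equiv.Perm.coe_mul, ← Function.comp_assoc, hb, ha]
    | mem s hs =>
      obtain ⟨i, rfl⟩ := hs
      intro v
      obtain _ | m := m
      · exact i.elim0
      -- In order two this is the symmetry of second derivatives. Beyond that, swapping the last two
      -- slots fixes slot 0, so the outermost derivative is peeled off; any other adjacent swap
      -- fixes the last slot, so the innermost one is.
      by_cases hi : i = Fin.last m
      · subst hi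
        obtain _ | m := m
        · rw [iteratedFDeriv_two_apply, iteratedFDeriv_two_apply]
          have := hf.fderiv_fderiv_symm (v 1) (v 0)
          simpa using this
        · rw [iteratedFDeriv_succ_apply_left, iteratedFDeriv_succ_apply_left]
          set σ := Equiv.swap (Fin.last (m + 1)).castSucc (Fin.last (m + 1)).succ
          have h0 : σ 0 = 0 := Equiv.swap_apply_of_ne_of_ne (by simp [Fin.ext_iff])
            (by simp [Fin.ext_iff])
          let τ : Equiv.Perm (Fin (m + 2)) := Equiv.swap (Fin.last m).castSucc (Fin.last m).succ
          have ht : Fin.tail (v ∘ σ) = Fin.tail v ∘ τ := by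
            ext j : 1
            simp only [Fin.tail, Function.comp_apply]
            congr 1
            simp only [σ, τ]
            rw [show (Fin.last (m + 1)).castSucc = ((Fin.last m).castSucc).succ by
                ext; simp,
              show (Fin.last (m + 1)).succ = ((Fin.last m).succ).succ by ext; simp]
            exact ((Fin.succ_injective _).map_swap ..).symm
          have hev : (fun y => _root_.iteratedFDeriv ℝ (m + 2) f y) =ᶠ[𝓝 x]
              fun y => (_root_.iteratedFDeriv ℝ (m + 2) f y).domDomCongr τ := by
            filter_upwards [hf.eventually] with y hy
            ext w
            exact (ih hy τ w).symm
          rw [ht, Function.comp_apply, h0]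
          have hd : DifferentiableAt ℝ (_root_.iteratedFDeriv ℝ (m + 2) f) x :=
            hf.contDiffAt.differentiableAt_iteratedFDeriv
              (WithTop.coe_lt_coe.2 (ENat.natCast_lt_top (m + 2)))
          have key : ∀ w : Fin (m + 2) → E,
              (_root_.fderiv ℝ (_root_.iteratedFDeriv ℝ (m + 2) f) x) (v 0) w =
                _root_.fderiv ℝ (fun y => _root_.iteratedFDeriv ℝ (m + 2) f y w) x (v 0) := by
            intro w
            have := (hd.hasFDerivAt.continuousMultilinear_apply_const w).fderiv
            rw [this]; rfl
          rw [key, key]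
          congr 1
          apply Filter.EventuallyEq.fderiv_eq
          filter_upwards [hf.eventually] with y hy
          exact ih hy τ _
      · obtain ⟨j, rfl⟩ := Fin.eq_castSucc_of_ne_last hi
        obtain _ | m := m
        · exact j.elim0
        set σ := Equiv.swap j.castSucc.castSucc j.castSucc.succ
        have h0 : σ (Fin.last _) = Fin.last _ := Equiv.swap_apply_of_ne_of_ne
          (by simp [Fin.ext_iff]; omega) (by simp [Fin.ext_iff]; omega)
        let τ : Equiv.Perm (Fin (m + 2)) := Equiv.swap j.castSucc j.succ
        have ht : Fin.init (v ∘ σ) = Fin.init v ∘ τ := by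
          ext k : 1
          simp only [Fin.init, Function.comp_apply]
          congr 1
          simp only [σ, τ]
          rw [show j.castSucc.succ = j.succ.castSucc by ext; simp]
          exact ((Fin.castSucc_injective _).map_swap ..).symm
        have hl : ∀ w : Fin (m + 3) → E, _root_.iteratedFDeriv ℝ (m + 3) f x w =
            _root_.iteratedFDeriv ℝ (m + 2) (_root_.fderiv ℝ f) x (Fin.init w)
              (w (Fin.last _)) := fun w => iteratedFDeriv_succ_apply_right _
        change _root_.iteratedFDeriv ℝ (m + 3) f x (v ∘ σ) = _
        rw [hl, hl, ht, Function.comp_apply, h0, ih hf.fderiv τ (Fin.init v)]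

end Smooth

/-! ### Jets at the origin -/

section Jets

variable {E F G H : Type} [NormedAddCommGroup E] [NormedSpace ℝ E]
  [NormedAddCommGroup F] [NormedSpace ℝ F] [NormedAddCommGroup G] [NormedSpace ℝ G]
  [NormedAddCommGroup H] [NormedSpace ℝ H]

/-- `f` and `g` have the same derivatives of order `≤ l` at `0`. -/
def JetEq (l : ℕ) (f g : E → F) : Prop :=
  ∀ m ≤ l, iteratedFDeriv ℝ m f 0 = iteratedFDeriv ℝ m g 0

theorem JetEq.refl (l : ℕ) (f : E → F) : JetEq l f f := fun _ _ => rfl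

theorem JetEq.symm {l : ℕ} {f g : E → F} (h : JetEq l f g) : JetEq l g f :=
  fun m hm => (h m hm).symm

theorem JetEq.trans {l : ℕ} {f g h : E → F} (h1 : JetEq l f g) (h2 : JetEq l g h) : JetEq l f h :=
  fun m hm => (h1 m hm).trans (h2 m hm)

theorem JetEq.mono {l l' : ℕ} {f g : E → F} (h : JetEq l f g) (hl : l' ≤ l) : JetEq l' f g :=
  fun m hm => h m (hm.trans hl)

theorem JetEq.of_eventuallyEq {l : ℕ} {f g : E → F} (h : f =ᶠ[𝓝 0] g) : JetEq l f g :=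
  fun m _ => (h.iteratedFDeriv ℝ m).eq_of_nhds

theorem jetEq_zero {f g : E → F} : JetEq 0 f g ↔ f 0 = g 0 := by
  constructor
  · intro h
    have := congrArg (fun p => p 0) (h 0 le_rfl)
    simpa using this
  · intro h m hm
    obtain rfl : m = 0 := by omega
    ext v
    simpa using h

theorem JetEq.eq {l : ℕ} {f g : E → F} (h : JetEq l f g) : f 0 = g 0 :=
  jetEq_zero.1 (h.mono (Nat.zero_le l))

theorem jetEq_succ {l : ℕ} {f g : E → F} :
    JetEq (l + 1) f g ↔ f 0 = g 0 ∧ JetEq l (fderiv ℝ f) (fderiv ℝ g) := by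
  constructor
  · intro h
    refine ⟨h.eq, fun m hm => ?_⟩
    have := h (m + 1) (by omega)
    simp only [iteratedFDeriv_succ_eq_comp_right, Function.comp_apply] at this
    exact (continuousMultilinearCurryRightEquiv' ℝ m E F).symm.injective this
  · rintro ⟨h0, h⟩ m hm
    obtain _ | m := m
    · exact jetEq_zero.2 h0 0 le_rfl
    · simp only [iteratedFDeriv_succ_eq_comp_right, Function.comp_apply]
      exact congrArg _ (h m (by omega))

theorem JetEq.fderiv {l : ℕ} {f g : E → F} (h : JetEq (l + 1) f g) :
    JetEq l (fderiv ℝ f) (fderiv ℝ g) := (jetEq_succ.1 h).2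

theorem JetEq.fderiv_eq {l : ℕ} {f g : E → F} (h : JetEq (l + 1) f g) :
    _root_.fderiv ℝ f 0 = _root_.fderiv ℝ g 0 := h.fderiv.eq

theorem JetEq.add {l : ℕ} {f f' g g' : E → F} (h1 : JetEq l f f') (h2 : JetEq l g g')
    (hf : SmoothNear f 0) (hf' : SmoothNear f' 0) (hg : SmoothNear g 0) (hg' : SmoothNear g' 0) :
    JetEq l (fun z => f z + g z) (fun z => f' z + g' z) := by
  intro m hm
  have hmm : ((m : ℕ) : ℕ∞ω) ≤ ∞ := (WithTop.coe_lt_coe.2 (ENat.natCast_lt_top m)).le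
  have e1 := iteratedFDeriv_add_apply (𝕜 := ℝ) (hf.contDiffAt.of_le hmm) (hg.contDiffAt.of_le hmm)
  have e2 := iteratedFDeriv_add_apply (𝕜 := ℝ) (hf'.contDiffAt.of_le hmm)
    (hg'.contDiffAt.of_le hmm)
  have e1' : iteratedFDeriv ℝ m (fun z => f z + g z) 0 = _ := e1
  have e2' : iteratedFDeriv ℝ m (fun z => f' z + g' z) 0 = _ := e2
  rw [e1', e2', h1 m hm, h2 m hm]

theorem JetEq.clm {l : ℕ} {f f' : E → F} (L : F →L[ℝ] G) (h : JetEq l f f')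
    (hf : SmoothNear f 0) (hf' : SmoothNear f' 0) :
    JetEq l (fun z => L (f z)) (fun z => L (f' z)) := by
  intro m hm
  have hmm : ((m : ℕ) : ℕ∞ω) ≤ ∞ := (WithTop.coe_lt_coe.2 (ENat.natCast_lt_top m)).le
  have e1 : iteratedFDeriv ℝ m (fun z => L (f z)) 0 = _ :=
    L.iteratedFDeriv_comp_left hf.contDiffAt hmm
  have e2 : iteratedFDeriv ℝ m (fun z => L (f' z)) 0 = _ :=
    L.iteratedFDeriv_comp_left hf'.contDiffAt hmm
  rw [e1, e2, h m hm]

theorem JetEq.prodMk {l : ℕ} {f f' : E → F} {g g' : E → G} (h1 : JetEq l f f')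
    (h2 : JetEq l g g') (hf : SmoothNear f 0) (hf' : SmoothNear f' 0) (hg : SmoothNear g 0)
    (hg' : SmoothNear g' 0) : JetEq l (fun z => (f z, g z)) (fun z => (f' z, g' z)) := by
  have a := h1.clm (ContinuousLinearMap.inl ℝ F G) hf hf'
  have b := h2.clm (ContinuousLinearMap.inr ℝ F G) hg hg'
  have := a.add b (hf.clm _) (hf'.clm _) (hg.clm _) (hg'.clm _)
  simpa using this

/-- Induction on `l` by the Leibniz rule. Both of its terms are again bilinear, with values in a
space of linear maps, so the induction has to let the target spaces vary. -/
theorem JetEq.bilin {l : ℕ} (B : F →L[ℝ] G →L[ℝ] H) {f f' : E → F} {g g' : E → G}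
    (h1 : JetEq l f f') (h2 : JetEq l g g') (hf : SmoothNear f 0) (hf' : SmoothNear f' 0)
    (hg : SmoothNear g 0) (hg' : SmoothNear g' 0) :
    JetEq l (fun z => B (f z) (g z)) (fun z => B (f' z) (g' z)) := by
  induction l generalizing F G H with
  | zero =>
    rw [jetEq_zero] at *
    rw [h1, h2]
  | succ l ih =>
    rw [jetEq_succ]
    refine ⟨by rw [h1.eq, h2.eq], ?_⟩
    have key : ∀ {a : E → F} {b : E → G}, SmoothNear a 0 → SmoothNear b 0 →
        _root_.fderiv ℝ (fun z => B (a z) (b z)) =ᶠ[𝓝 0] fun z =>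
          B.precompR E (a z) (_root_.fderiv ℝ b z) + B.precompL E (_root_.fderiv ℝ a z) (b z) := by
      intro a b ha hb
      filter_upwards [ha.eventually_differentiableAt, hb.eventually_differentiableAt] with z hz hz'
      exact B.fderiv_of_bilinear hz hz'
    refine (JetEq.of_eventuallyEq (key hf hg)).trans
      (JetEq.trans ?_ (JetEq.of_eventuallyEq (key hf' hg')).symm)
    exact (ih _ (h1.mono (Nat.le_succ l)) h2.fderiv hf hf' hg.fderiv hg'.fderiv).add
      (ih _ h1.fderiv (h2.mono (Nat.le_succ l)) hf.fderiv hf'.fderiv hg hg')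
      (hf.bilin _ hg.fderiv) (hf'.bilin _ hg'.fderiv) (hf.fderiv.bilin _ hg)
      (hf'.fderiv.bilin _ hg')

/-- By the chain rule the derivative is a bilinear expression in Dg ∘ f and Df, whose jets of one
order less are known by induction. -/
theorem JetEq.comp {l : ℕ} {g g' : F → G} {f f' : E → F} (h1 : JetEq l g g') (h2 : JetEq l f f')
    (hg : SmoothNear g 0) (hg' : SmoothNear g' 0) (hf : SmoothNear f 0) (hf' : SmoothNear f' 0)
    (hf0 : f 0 = 0) (hf0' : f' 0 = 0) :
    JetEq l (fun z => g (f z)) (fun z => g' (f' z)) := by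
  induction l generalizing G with
  | zero =>
    rw [jetEq_zero] at *
    rw [hf0, hf0', h1]
  | succ l ih =>
    rw [jetEq_succ]
    refine ⟨by rw [hf0, hf0', h1.eq], ?_⟩
    have key : ∀ {a : F → G} {b : E → F}, SmoothNear a 0 → SmoothNear b 0 → b 0 = 0 →
        _root_.fderiv ℝ (fun z => a (b z)) =ᶠ[𝓝 0] fun z =>
          ContinuousLinearMap.compL ℝ E F G (_root_.fderiv ℝ a (b z)) (_root_.fderiv ℝ b z) := by
      intro a b ha hb hb0
      have hb' : Filter.Tendsto b (𝓝 0) (𝓝 0) := by simpa [ContinuousAt, hb0] using hb.continuousAt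
      filter_upwards [hb'.eventually ha.eventually_differentiableAt,
        hb.eventually_differentiableAt] with z hz hz'
      exact fderiv_comp z hz hz'
    refine (JetEq.of_eventuallyEq (key hg hf hf0)).trans
      (JetEq.trans ?_ (JetEq.of_eventuallyEq (key hg' hf' hf0')).symm)
    exact JetEq.bilin _ (ih h1.fderiv (h2.mono (Nat.le_succ l)) hg.fderiv hg'.fderiv) h2.fderiv
      (hg.fderiv.comp_of_eq hf hf0) (hg'.fderiv.comp_of_eq hf' hf0') hf.fderiv hf'.fderiv

/-- The jet of a local inverse is determined by the jet of the map. -/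
theorem JetEq.inverse {l : ℕ} {K K' : E → F} {g g' : F → E} (h : JetEq l K K')
    (hK : SmoothNear K 0) (hK' : SmoothNear K' 0) (hg : SmoothNear g 0) (hg' : SmoothNear g' 0)
    (hg0 : g 0 = 0) (hg0' : g' 0 = 0)
    (hgK : ∀ᶠ x in 𝓝 0, g (K x) = x) (hKg : ∀ᶠ y in 𝓝 0, K (g y) = y)
    (hKg' : ∀ᶠ y in 𝓝 0, K' (g' y) = y) : JetEq l g g' := by
  induction l with
  | zero => rw [jetEq_zero, hg0, hg0']
  | succ l ih =>
    rw [jetEq_succ]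
    refine ⟨by rw [hg0, hg0'], ?_⟩
    have hgg := ih (h.mono (Nat.le_succ l))
    let C := ContinuousLinearMap.compL ℝ F E F
    let C' := ContinuousLinearMap.compL ℝ F F E
    have tg : Filter.Tendsto g (𝓝 0) (𝓝 0) := by simpa [ContinuousAt, hg0] using hg.continuousAt
    have tg' : Filter.Tendsto g' (𝓝 0) (𝓝 0) := by
      simpa [ContinuousAt, hg0'] using hg'.continuousAt
    have sM := hK.fderiv.comp_of_eq hg hg0
    have sM' := hK'.fderiv.comp_of_eq hg' hg0'
    have hM : JetEq l (fun y => _root_.fderiv ℝ K (g y)) (fun y => _root_.fderiv ℝ K' (g' y)) :=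
      JetEq.comp h.fderiv hgg hK.fderiv hK'.fderiv hg hg' hg0 hg0'
    have e1 : ∀ᶠ y in 𝓝 0, (_root_.fderiv ℝ g y).comp (_root_.fderiv ℝ K (g y)) =
        ContinuousLinearMap.id ℝ E := by
      filter_upwards [tg.eventually hgK.eventually_nhds, hKg, hg.eventually_differentiableAt,
        tg.eventually hK.eventually_differentiableAt] with y h1 h2 h3 h4
      have := fderiv_comp (g y) (g := g) (f := K) (by rwa [h2]) h4
      rw [h2] at this
      rw [← this, show (ContinuousLinearMap.id ℝ E) = _root_.fderiv ℝ (fun x : E => x) (g y) by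
        simp]
      exact (show (fun x => g (K x)) =ᶠ[𝓝 (g y)] fun x => x from h1).fderiv_eq
    have e2 : ∀ᶠ y in 𝓝 0, (_root_.fderiv ℝ K' (g' y)).comp (_root_.fderiv ℝ g' y) =
        ContinuousLinearMap.id ℝ F := by
      filter_upwards [hKg'.eventually_nhds, hg'.eventually_differentiableAt,
        tg'.eventually hK'.eventually_differentiableAt] with y h1 h3 h4
      have := fderiv_comp y (g := K') (f := g') h4 h3
      rw [← this, show (ContinuousLinearMap.id ℝ F) = _root_.fderiv ℝ (fun x : F => x) y by simp]
      exact (show (fun x => K' (g' x)) =ᶠ[𝓝 y] fun x => x from h1).fderiv_eq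
    -- The product Dg · DK(g) · Dg' equals Dg', and Dg · DK'(g') · Dg' equals Dg. The middle factors
    -- have equal `l`-jets by induction, hence so do Dg and Dg'.
    have a1 : JetEq l (fun y => C' (_root_.fderiv ℝ g y)
          (C (_root_.fderiv ℝ K (g y)) (_root_.fderiv ℝ g' y)))
        (fun y => C' (_root_.fderiv ℝ g y)
          (C (_root_.fderiv ℝ K' (g' y)) (_root_.fderiv ℝ g' y))) :=
      JetEq.bilin C' (JetEq.refl _ _)
        (JetEq.bilin C hM (JetEq.refl _ _) sM sM' hg'.fderiv hg'.fderiv)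
        hg.fderiv hg.fderiv (sM.bilin C hg'.fderiv) (sM'.bilin C hg'.fderiv)
    have a2 : (fun y => C' (_root_.fderiv ℝ g y)
          (C (_root_.fderiv ℝ K (g y)) (_root_.fderiv ℝ g' y))) =ᶠ[𝓝 0] _root_.fderiv ℝ g' := by
      filter_upwards [e1] with y hy
      simp only [C, C', ContinuousLinearMap.compL_apply]
      rw [← ContinuousLinearMap.comp_assoc, hy, ContinuousLinearMap.id_comp]
    have a3 : (fun y => C' (_root_.fderiv ℝ g y)
          (C (_root_.fderiv ℝ K' (g' y)) (_root_.fderiv ℝ g' y))) =ᶠ[𝓝 0] _root_.fderiv ℝ g := by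
      filter_upwards [e2] with y hy
      simp only [C, C', ContinuousLinearMap.compL_apply]
      rw [hy, ContinuousLinearMap.comp_id]
    exact ((JetEq.of_eventuallyEq a3).symm.trans a1.symm).trans (JetEq.of_eventuallyEq a2)

end Jets

/-! ### Inverse functions -/

section Inverse

variable {E F Θ : Type} [NormedAddCommGroup E] [NormedSpace ℝ E] [CompleteSpace E]
  [NormedAddCommGroup F] [NormedSpace ℝ F] [CompleteSpace F]
  [NormedAddCommGroup Θ] [NormedSpace ℝ Θ] [CompleteSpace Θ]

theorem exists_equiv_of_bijective {L : E →L[ℝ] F} (h : Function.Bijective L) :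
    ∃ e : E ≃L[ℝ] F, (e : E →L[ℝ] F) = L :=
  ⟨ContinuousLinearEquiv.ofBijective L (LinearMap.ker_eq_bot.2 h.1) (LinearMap.range_eq_top.2 h.2),
    ContinuousLinearEquiv.coe_ofBijective _ _ _⟩

theorem eventually_bijective {X : Type*} [TopologicalSpace X] {L : X → E →L[ℝ] F} {x : X}
    (hL : ContinuousAt L x) (h : Function.Bijective (L x)) :
    ∀ᶠ y in 𝓝 x, Function.Bijective (L y) := by
  obtain ⟨e, he⟩ := exists_equiv_of_bijective h
  have := ContinuousLinearEquiv.nhds e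
  rw [he] at this
  filter_upwards [hL.eventually this] with y hy
  obtain ⟨e', he'⟩ := hy
  rw [← he']
  exact e'.bijective

/-- The inverse function theorem for germs. -/
theorem SmoothNear.exists_inverse {K : E → F} {x : E} (hK : SmoothNear K x)
    (h : Function.Bijective (_root_.fderiv ℝ K x)) :
    ∃ g : F → E, SmoothNear g (K x) ∧ g (K x) = x ∧ (∀ᶠ z in 𝓝 x, g (K z) = z) ∧
      ∀ᶠ y in 𝓝 (K x), K (g y) = y := by
  obtain ⟨e, he⟩ := exists_equiv_of_bijective h
  have hd : HasFDerivAt K (e : E →L[ℝ] F) x := he ▸ hK.differentiableAt.hasFDerivAt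
  set P := hK.contDiffAt.toOpenPartialHomeomorph K hd (by simp) with hP
  have hPK : ∀ z, P z = K z := fun _ => rfl
  have hx : x ∈ P.source := hK.contDiffAt.mem_toOpenPartialHomeomorph_source hd (by simp)
  have hy : K x ∈ P.target := P.map_source hx
  have hgx : P.symm (K x) = x := P.left_inv hx
  have hc : ContinuousAt P.symm (K x) := P.continuousAt_symm hy
  have hc' : Filter.Tendsto P.symm (𝓝 (K x)) (𝓝 x) := by
    simpa [ContinuousAt, hgx] using hc
  refine ⟨P.symm, ?_, hgx, ?_, ?_⟩
  · filter_upwards [P.open_target.mem_nhds hy, hc'.eventually hK,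
      hc'.eventually (eventually_bijective hK.fderiv.continuousAt h)] with y h1 h2 h3
    obtain ⟨e', he'⟩ := exists_equiv_of_bijective h3
    refine P.contDiffAt_symm (f₀' := e') h1 ?_ h2
    rw [he']
    exact (h2.differentiableAt (by simp)).hasFDerivAt
  · filter_upwards [P.open_source.mem_nhds hx] with z hz using P.left_inv hz
  · filter_upwards [P.open_target.mem_nhds hy] with y hy using P.right_inv hy

/-- The inverse function theorem for germs that depend on parameters. -/
theorem SmoothNear.exists_inverse_param {K : Θ → E → F} {t : Θ}
    (hK : SmoothNear (Function.uncurry K) (t, 0)) (h0 : ∀ᶠ s in 𝓝 t, K s 0 = 0)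
    (h : Function.Bijective (_root_.fderiv ℝ (K t) 0)) :
    ∃ g : Θ → F → E, SmoothNear (Function.uncurry g) (t, 0) ∧ (∀ᶠ s in 𝓝 t, g s 0 = 0) ∧
      (∀ᶠ p in 𝓝 (t, (0 : E)), g p.1 (K p.1 p.2) = p.2) ∧
      ∀ᶠ p in 𝓝 (t, (0 : F)), K p.1 (g p.1 p.2) = p.2 := by
  -- With the parameter adjoined, the derivative is block triangular, hence bijective as soon as the
  -- derivative in the second variable is.
  let X : Θ × E → Θ × F := fun p => (p.1, K p.1 p.2)
  have hX : SmoothNear X (t, 0) := (smoothNear_id _).fst.prodMk hK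
  have hX0 : X (t, 0) = (t, 0) := by simp [X, h0.self_of_nhds]
  have hd : ∀ a : Θ, ∀ b : E, _root_.fderiv ℝ X (t, 0) (a, b) =
      (a, _root_.fderiv ℝ (Function.uncurry K) (t, 0) (a, 0) + _root_.fderiv ℝ (K t) 0 b) := by
    intro a b
    have h1 : _root_.fderiv ℝ X (t, 0) = (ContinuousLinearMap.fst ℝ Θ E).prod
        (_root_.fderiv ℝ (Function.uncurry K) (t, 0)) :=
      ((hasFDerivAt_fst).prodMk hK.differentiableAt.hasFDerivAt).fderiv
    have h2 : _root_.fderiv ℝ (K t) 0 =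
        (_root_.fderiv ℝ (Function.uncurry K) (t, 0)).comp (ContinuousLinearMap.inr ℝ Θ E) := by
      have := (hK.differentiableAt.hasFDerivAt).comp (0 : E) (hasFDerivAt_prodMk_right t (0 : E))
      exact this.fderiv
    rw [h1, h2]
    simp [← map_add]
  have hb : Function.Bijective (_root_.fderiv ℝ X (t, 0)) := by
    constructor
    · rw [injective_iff_map_eq_zero]
      rintro ⟨a, b⟩ hab
      rw [hd] at hab
      obtain ⟨rfl, h2⟩ := Prod.mk.inj hab
      have h3 : _root_.fderiv ℝ (K t) 0 b = 0 := by
        have e : ((0 : Θ), (0 : E)) = 0 := rfl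
        rw [e, map_zero, zero_add] at h2; exact h2
      rw [(injective_iff_map_eq_zero _).1 h.1 b h3]; rfl
    · rintro ⟨a, c⟩
      obtain ⟨b, hb⟩ := h.2 (c - _root_.fderiv ℝ (Function.uncurry K) (t, 0) (a, 0))
      exact ⟨(a, b), by rw [hd, hb]; simp⟩
  obtain ⟨g, hg, hg0, hgX, hXg⟩ := hX.exists_inverse hb
  rw [hX0] at hg hg0 hXg
  refine ⟨fun s y => (g (s, y)).2, hg.snd, ?_, ?_, ?_⟩
  · have hc : Filter.Tendsto (fun s : Θ => (s, (0 : E))) (𝓝 t) (𝓝 (t, 0)) :=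
      (Continuous.prodMk continuous_id continuous_const).tendsto' _ _ rfl
    filter_upwards [h0, hc.eventually hgX] with s h1 h2
    simp only [X, h1] at h2
    rw [h2]
  · filter_upwards [hgX] with p hp
    simp only [X] at hp
    rw [hp]
  · filter_upwards [hXg] with p hp
    simp only [X] at hp
    have h1 : (g p).1 = p.1 := congrArg Prod.fst hp
    have h2 : K (g p).1 (g p).2 = p.2 := congrArg Prod.snd hp
    rwa [h1] at h2

end Inverse

/-! ### Spaces of jets and Taylor polynomials -/

section Taylor

variable {E F Θ : Type} [NormedAddCommGroup E] [NormedSpace ℝ E]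
  [NormedAddCommGroup F] [NormedSpace ℝ F] [NormedAddCommGroup Θ] [NormedSpace ℝ Θ] {n : ℕ}

/-- Taylor data of order `≤ n`. -/
abbrev Jets (n : ℕ) (E F : Type) [NormedAddCommGroup E] [NormedSpace ℝ E]
    [NormedAddCommGroup F] [NormedSpace ℝ F] : Type :=
  ∀ m : Fin (n + 1), ContinuousMultilinearMap ℝ (fun _ : Fin (m : ℕ) => E) F

/-- The `n`-jet of `f` at `0`. -/
def jets (n : ℕ) (f : E → F) : Jets n E F := fun m => iteratedFDeriv ℝ (m : ℕ) f 0

theorem jets_eq_iff {f g : E → F} : jets n f = jets n g ↔ JetEq n f g := by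
  constructor
  · intro h m hm
    exact congrFun h ⟨m, by omega⟩
  · intro h
    funext m
    exact h m (by omega)

theorem jets_add {f g : E → F} (hf : SmoothNear f 0) (hg : SmoothNear g 0) :
    jets n (fun z => f z + g z) = jets n f + jets n g := by
  funext m
  have hmm : ((m : ℕ) : ℕ∞ω) ≤ ∞ := (WithTop.coe_lt_coe.2 (ENat.natCast_lt_top m)).le
  exact iteratedFDeriv_add_apply (𝕜 := ℝ) (hf.contDiffAt.of_le hmm) (hg.contDiffAt.of_le hmm)

theorem jets_smul {f : E → F} (c : ℝ) (hf : SmoothNear f 0) :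
    jets n (fun z => c • f z) = c • jets n f := by
  funext m
  have hmm : ((m : ℕ) : ℕ∞ω) ≤ ∞ := (WithTop.coe_lt_coe.2 (ENat.natCast_lt_top m)).le
  exact iteratedFDeriv_const_smul_apply (hf.contDiffAt.of_le hmm)

theorem SmoothNear.jets {G : Θ → E → F} {t : Θ} (h : SmoothNear (Function.uncurry G) (t, 0)) :
    SmoothNear (fun s => jets n (G s)) t := by
  have : ∀ m : Fin (n + 1), ∀ᶠ s in 𝓝 t,
      ContDiffAt ℝ ∞ (fun s => _root_.iteratedFDeriv ℝ (m : ℕ) (G s) 0) s :=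
    fun m => h.iteratedFDeriv m
  filter_upwards [Filter.eventually_all.2 this] with s hs
  exact contDiffAt_pi.2 hs

/-- The polynomial map with given Taylor data. -/
def taylorPoly (p : Jets n E F) (z : E) : F :=
  ∑ m : Fin (n + 1), ((m : ℕ).factorial : ℝ)⁻¹ • p m fun _ => z

theorem contDiff_taylorPoly :
    ContDiff ℝ ∞ (Function.uncurry (taylorPoly : Jets n E F → E → F)) := by
  unfold Function.uncurry taylorPoly
  refine ContDiff.sum fun m _ => ContDiff.smul contDiff_const ?_
  have h := (ContinuousLinearMap.id ℝ
    (ContinuousMultilinearMap ℝ (fun _ : Fin (m : ℕ) => E) F)).analyticOnNhd_uncurry_of_multilinear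
    (s := Set.univ)
  have h' := h.contDiffOn (n := ∞) uniqueDiffOn_univ
  rw [contDiffOn_univ] at h'
  refine h'.comp (f := fun q : Jets n E F × E => (q.1 m, fun _ : Fin (m : ℕ) => q.2))
    (ContDiff.prodMk ?_ (by fun_prop))
  have hp : ContDiff ℝ ∞ (fun p : Jets n E F => p m) := by
    have := contDiff_id (𝕜 := ℝ) (n := ∞) (E := Jets n E F)
    rw [contDiff_pi] at this
    exact this m
  exact hp.comp contDiff_fst

theorem smoothNear_taylorPoly (p : Jets n E F) (z : E) : SmoothNear (taylorPoly p) z :=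
  ContDiff.smoothNear (contDiff_taylorPoly.comp (contDiff_const.prodMk contDiff_id)) z

/-- Differentiating the polynomial symmetrises its coefficients. The derivatives of a smooth
function are already symmetric, so the k! equal terms cancel the factorial. -/
theorem jetEq_taylorPoly [CompleteSpace F] {f : E → F} (hf : SmoothNear f 0) :
    JetEq n (taylorPoly (jets n f)) f := by
  intro k hk
  let P : FormalMultilinearSeries ℝ E F := fun m =>
    if m < n + 1 then ((m : ℕ).factorial : ℝ)⁻¹ • iteratedFDeriv ℝ m f 0 else 0
  have hP : HasFiniteFPowerSeriesOnBall (taylorPoly (jets n f)) P 0 (n + 1) ⊤ := by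
    refine HasFiniteFPowerSeriesOnBall.mk' (fun m hm => if_neg (by omega)) ENNReal.zero_lt_top ?_
    intro y _
    rw [zero_add, taylorPoly, Finset.sum_range]
    refine Finset.sum_congr rfl fun m _ => ?_
    simp only [P, m.2, if_true]
    rfl
  have hA : AnalyticOn ℝ (taylorPoly (jets n f)) Set.univ := by
    have := hP.toHasFPowerSeriesOnBall.analyticOnNhd
    intro x _
    exact (this x (by simp)).analyticWithinAt
  ext v
  rw [hP.toHasFPowerSeriesOnBall.iteratedFDeriv_eq_sum hA]
  have : ∀ σ : Equiv.Perm (Fin k), P k (fun i => v (σ i)) =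
      (k.factorial : ℝ)⁻¹ • iteratedFDeriv ℝ k f 0 v := by
    intro σ
    simp only [P, if_pos (show k < n + 1 by omega)]
    rw [← hf.iteratedFDeriv_comp_perm σ v]
    rfl
  rw [Finset.sum_congr rfl fun σ _ => this σ, Finset.sum_const, Finset.card_univ,
    Fintype.card_perm, Fintype.card_fin, ← Nat.cast_smul_eq_nsmul ℝ, smul_smul,
    mul_inv_cancel₀ (by positivity), one_smul]

theorem jets_taylorPoly_jets [CompleteSpace F] {f : E → F} (hf : SmoothNear f 0) :
    jets n (taylorPoly (jets n f)) = jets n f := jets_eq_iff.2 (jetEq_taylorPoly hf)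

end Taylor

theorem contDiff_submodule_val {V : Type} [NormedAddCommGroup V] [NormedSpace ℝ V]
    (p : Submodule ℝ V) : ContDiff ℝ ∞ (fun θ : p => (θ : V)) := p.subtypeL.contDiff

/-- The space of `n`-jets of functions on `T*ℝ³` that vanish at `0` to second order. -/
def potentialJets (n : ℕ) : Submodule ℝ (Jets n Cot ℝ) where
  carrier := {p | ∃ A : Cot → ℝ, SmoothNear A 0 ∧ A 0 = 0 ∧ fderiv ℝ A 0 = 0 ∧ jets n A = p}
  zero_mem' := by
    refine ⟨fun _ => 0, smoothNear_const _ _, rfl, by simp, ?_⟩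
    have := jets_smul (n := n) (0 : ℝ) (smoothNear_const (0 : ℝ) (0 : Cot))
    simpa using this
  add_mem' := by
    rintro _ _ ⟨A, hA, hA0, hA1, rfl⟩ ⟨B, hB, hB0, hB1, rfl⟩
    refine ⟨fun z => A z + B z, hA.add hB, by simp [hA0, hB0], ?_, jets_add hA hB⟩
    rw [fderiv_fun_add hA.differentiableAt hB.differentiableAt, hA1, hB1, add_zero]
  smul_mem' := by
    rintro c _ ⟨A, hA, hA0, hA1, rfl⟩
    refine ⟨fun z => c • A z, (smoothNear_const c 0).mul hA, by simp [hA0], ?_, jets_smul c hA⟩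
    rw [fderiv_fun_const_smul hA.differentiableAt, hA1, smul_zero]

/-- The polynomial with given Taylor data in `potentialJets`. -/
def potential {n : ℕ} (θ : potentialJets n) : Cot → ℝ := taylorPoly (θ : Jets n Cot ℝ)

section Potential

variable {n : ℕ}

theorem finiteDimensional_continuousMultilinearMap (m : ℕ) {E F : Type} [NormedAddCommGroup E]
    [NormedSpace ℝ E] [FiniteDimensional ℝ E] [NormedAddCommGroup F] [NormedSpace ℝ F]
    [FiniteDimensional ℝ F] :
    FiniteDimensional ℝ (ContinuousMultilinearMap ℝ (fun _ : Fin m => E) F) :=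
  Module.Finite.of_injective
    (ContinuousMultilinearMap.toMultilinearMapLinear :
      ContinuousMultilinearMap ℝ (fun _ : Fin m => E) F →ₗ[ℝ] _)
    ContinuousMultilinearMap.toMultilinearMap_injective

instance finiteDimensional_jets {E F : Type} [NormedAddCommGroup E]
    [NormedSpace ℝ E] [FiniteDimensional ℝ E] [NormedAddCommGroup F] [NormedSpace ℝ F]
    [FiniteDimensional ℝ F] : FiniteDimensional ℝ (Jets n E F) :=
  haveI : ∀ m : Fin (n + 1), Module.Finite ℝ
      (ContinuousMultilinearMap ℝ (fun _ : Fin (m : ℕ) => E) F) :=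
    fun m => finiteDimensional_continuousMultilinearMap m
  Module.Finite.pi

instance completeSpace_jetSpace : CompleteSpace (JetSpace n) :=
  haveI : FiniteDimensional ℝ (JetSpace n) := finiteDimensional_jets (E := Cot) (F := Cot)
  FiniteDimensional.complete ℝ _

instance finiteDimensional_potentialJets : FiniteDimensional ℝ (potentialJets n) :=
  FiniteDimensional.finiteDimensional_submodule _

instance completeSpace_potentialJets : CompleteSpace (potentialJets n) :=
  FiniteDimensional.complete ℝ _

/-- Elements of `potentialJets` come from functions and are therefore symmetric; for arbitrary
multilinear data this would fail. -/
theorem jets_potential (θ : potentialJets n) : jets n (potential θ) = θ := by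
  obtain ⟨A, hA, _, _, h⟩ := θ.2
  rw [potential, ← h, jets_taylorPoly_jets hA]

theorem contDiff_potential :
    ContDiff ℝ ∞ (Function.uncurry (potential : potentialJets n → Cot → ℝ)) := by
  have h : ContDiff ℝ ∞ (fun θ : potentialJets n => (θ : Jets n Cot ℝ)) :=
    contDiff_submodule_val (V := Jets n Cot ℝ) (potentialJets n)
  exact contDiff_taylorPoly.comp ((h.comp contDiff_fst).prodMk contDiff_snd)

theorem smoothNear_potential (θ : potentialJets n) (z : Cot) : SmoothNear (potential θ) z :=
  smoothNear_taylorPoly _ z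

theorem potential_zero (θ : potentialJets n) : potential θ 0 = 0 := by
  obtain ⟨A, hA, h0, _, h⟩ := θ.2
  rw [potential, ← h, (jetEq_taylorPoly hA).eq, h0]

theorem fderiv_potential_zero (hn : 1 ≤ n) (θ : potentialJets n) :
    fderiv ℝ (potential θ) 0 = 0 := by
  obtain ⟨A, hA, _, h1, h⟩ := θ.2
  rw [potential, ← h, ((jetEq_taylorPoly hA).mono hn).fderiv_eq (l := 0), h1]

end Potential

/-! ### Symplectic germs -/

section Symplectic

theorem omega_nondegenerate {u : Cot} (h : ∀ v, omega u v = 0) : u = 0 := by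
  refine Prod.ext (funext fun i => ?_) (funext fun i => ?_)
  · have := h (0, Pi.single i 1)
    simpa [omega, Pi.single_apply] using this
  · have := h (Pi.single i 1, 0)
    simpa [omega, Pi.single_apply] using this

theorem IsSymplecticGerm.smooth {S : Cot → Cot} (hS : IsSymplecticGerm S) : SmoothNear S 0 := hS.2.1

theorem IsSymplecticGerm.zero {S : Cot → Cot} (hS : IsSymplecticGerm S) : S 0 = 0 := hS.1

theorem tendsto_zero_of_smooth {E F : Type} [NormedAddCommGroup E] [NormedSpace ℝ E]
    [NormedAddCommGroup F] [NormedSpace ℝ F] {f : E → F} (hf : SmoothNear f 0) (h0 : f 0 = 0) :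
    Filter.Tendsto f (𝓝 0) (𝓝 0) := by
  simpa [ContinuousAt, h0] using hf.continuousAt

theorem IsSymplecticGerm.tendsto {S : Cot → Cot} (hS : IsSymplecticGerm S) :
    Filter.Tendsto S (𝓝 0) (𝓝 0) := tendsto_zero_of_smooth hS.smooth hS.zero

theorem bijective_of_omega_eq {L : Cot →L[ℝ] Cot} (h : ∀ u v, omega (L u) (L v) = omega u v) :
    Function.Bijective L := by
  have hinj : Function.Injective L := by
    rw [injective_iff_map_eq_zero]
    intro u hu
    refine omega_nondegenerate fun v => ?_
    rw [← h, hu]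
    simp [omega]
  exact ⟨hinj, (LinearMap.injective_iff_surjective (f := (L : Cot →ₗ[ℝ] Cot))).1 hinj⟩

theorem IsSymplecticGerm.bijective {S : Cot → Cot} (hS : IsSymplecticGerm S) :
    Function.Bijective (fderiv ℝ S 0) := bijective_of_omega_eq hS.2.2.self_of_nhds

theorem IsSymplecticGerm.comp {S T : Cot → Cot} (hS : IsSymplecticGerm S)
    (hT : IsSymplecticGerm T) : IsSymplecticGerm (fun z => S (T z)) := by
  refine ⟨by simp only [hT.zero, hS.zero], hS.smooth.comp_of_eq hT.smooth hT.zero, ?_⟩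
  filter_upwards [hT.2.2, hT.tendsto.eventually hS.2.2, hT.smooth.eventually_differentiableAt,
    hT.tendsto.eventually hS.smooth.eventually_differentiableAt] with z h1 h2 h3 h4 u v
  rw [show fderiv ℝ (fun z => S (T z)) z = (fderiv ℝ S (T z)).comp (fderiv ℝ T z) from
    fderiv_comp z h4 h3]
  simp only [ContinuousLinearMap.comp_apply, h1, h2]

theorem IsSymplecticGerm.exists_inverse {S : Cot → Cot} (hS : IsSymplecticGerm S) :
    ∃ T, IsSymplecticGerm T ∧ (∀ᶠ z in 𝓝 0, T (S z) = z) ∧ ∀ᶠ z in 𝓝 0, S (T z) = z := by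
  obtain ⟨T, hT, hT0, h1, h2⟩ := hS.smooth.exists_inverse hS.bijective
  rw [hS.zero] at hT hT0 h2
  refine ⟨T, ⟨hT0, hT, ?_⟩, h1, h2⟩
  have tT := tendsto_zero_of_smooth hT hT0
  filter_upwards [h2.eventually_nhds, hT.eventually_differentiableAt,
    tT.eventually hS.smooth.eventually_differentiableAt, tT.eventually hS.2.2] with z h3 h4 h5 h6 u v
  have hc : (fderiv ℝ S (T z)).comp (fderiv ℝ T z) = ContinuousLinearMap.id ℝ Cot := by
    rw [← fderiv_comp z h5 h4, show ContinuousLinearMap.id ℝ Cot = fderiv ℝ (fun x => x) z by simp]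
    exact (show S ∘ T =ᶠ[𝓝 z] fun x => x from h3).fderiv_eq
  have hc' : ∀ u, fderiv ℝ S (T z) (fderiv ℝ T z u) = u := fun u => DFunLike.congr_fun hc u
  rw [← h6, hc', hc']

end Symplectic

/-! ### Generating functions -/

section Generating

/-- The components of a linear functional. -/
def grad : (Cot →L[ℝ] ℝ) →L[ℝ] Cot :=
  (ContinuousLinearMap.pi fun i : Fin 3 =>
      ContinuousLinearMap.apply ℝ ℝ ((Pi.single i 1, 0) : Cot)).prod
    (ContinuousLinearMap.pi fun i : Fin 3 =>
      ContinuousLinearMap.apply ℝ ℝ ((0, Pi.single i 1) : Cot))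

theorem grad_fst (ℓ : Cot →L[ℝ] ℝ) (i : Fin 3) : (grad ℓ).1 i = ℓ (Pi.single i 1, 0) := rfl

theorem grad_snd (ℓ : Cot →L[ℝ] ℝ) (i : Fin 3) : (grad ℓ).2 i = ℓ (0, Pi.single i 1) := rfl

theorem apply_eq_grad (ℓ : Cot →L[ℝ] ℝ) (v : Cot) :
    ℓ v = ∑ i, ((grad ℓ).1 i * v.1 i + (grad ℓ).2 i * v.2 i) := by
  have hv : v = ∑ i : Fin 3, (v.1 i • ((Pi.single i 1, 0) : Cot) +
      v.2 i • ((0, Pi.single i 1) : Cot)) := by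
    refine Prod.ext (funext fun j => ?_) (funext fun j => ?_) <;>
      simp [Fin.sum_univ_three, Pi.single_apply] <;> fin_cases j <;> simp
  conv_lhs => rw [hv]
  simp only [map_sum, map_add, map_smul, smul_eq_mul, grad_fst, grad_snd]
  exact Finset.sum_congr rfl fun i _ => by ring

theorem grad_injective : Function.Injective grad := by
  intro a b h
  refine ContinuousLinearMap.ext fun v => ?_
  rw [apply_eq_grad a, apply_eq_grad b, h]

theorem grad_surjective : Function.Surjective grad := by
  have hfin : Module.finrank ℝ (Cot →L[ℝ] ℝ) = Module.finrank ℝ Cot := by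
    rw [← (LinearMap.toContinuousLinearMap (𝕜 := ℝ) (E := Cot) (F' := ℝ)).finrank_eq]
    exact Subspace.dual_finrank_eq
  exact (LinearMap.injective_iff_surjective_of_finrank_eq_finrank hfin
    (f := (grad : (Cot →L[ℝ] ℝ) →ₗ[ℝ] Cot))).1 grad_injective

/-- The linear functional with given components. -/
def gradEquiv : (Cot →L[ℝ] ℝ) ≃L[ℝ] Cot :=
  ContinuousLinearEquiv.ofBijective grad (LinearMap.ker_eq_bot.2 grad_injective)
    (LinearMap.range_eq_top.2 grad_surjective)

theorem grad_symm (c : Cot) : grad (gradEquiv.symm c) = c := gradEquiv.apply_symm_apply c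

/-- The map `(q, Q) ↦ (q, -∂A/∂q)`. -/
def initialPoint (A : Cot → ℝ) (w : Cot) : Cot := (w.1, -(grad (fderiv ℝ A w)).1)

/-- The map `(q, Q) ↦ (Q, ∂A/∂Q)`. -/
def finalPoint (A : Cot → ℝ) (w : Cot) : Cot := (w.2, (grad (fderiv ℝ A w)).2)

/-- `A(q, Q)` is a potential whose mixed Hessian `∂²A/∂q∂Q` at `0` is invertible. -/
structure IsPotential (A : Cot → ℝ) : Prop where
  smooth : SmoothNear A 0
  zero : A 0 = 0
  fderiv_zero : fderiv ℝ A 0 = 0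
  bijective : Function.Bijective (fderiv ℝ (initialPoint A) 0)

/-- `A(q, Q)` is a generating function of `S : (q, p) ↦ (Q, P)`: `p = -∂A/∂q`, `P = ∂A/∂Q`. -/
def IsGen (A : Cot → ℝ) (S : Cot → Cot) : Prop :=
  ∀ᶠ w in 𝓝 0, S (initialPoint A w) = finalPoint A w

variable {A : Cot → ℝ} {S : Cot → Cot}

theorem smoothNear_initialPoint {w : Cot} (hA : SmoothNear A w) :
    SmoothNear (initialPoint A) w :=
  (smoothNear_id w).fst.prodMk (hA.fderiv.clm grad).fst.neg

theorem smoothNear_finalPoint {w : Cot} (hA : SmoothNear A w) :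
    SmoothNear (finalPoint A) w :=
  (smoothNear_id w).snd.prodMk (hA.fderiv.clm grad).snd

theorem initialPoint_zero (h : fderiv ℝ A 0 = 0) : initialPoint A 0 = 0 := by
  simp [initialPoint, h]

theorem finalPoint_zero (h : fderiv ℝ A 0 = 0) : finalPoint A 0 = 0 := by
  simp [finalPoint, h]

theorem fderiv_initialPoint {w : Cot} (hA : SmoothNear A w) (u : Cot) :
    fderiv ℝ (initialPoint A) w u = (u.1, -(grad (fderiv ℝ (fderiv ℝ A) w u)).1) := by
  have h1 : HasFDerivAt (fun w => grad (fderiv ℝ A w)) (grad.comp (fderiv ℝ (fderiv ℝ A) w)) w :=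
    grad.hasFDerivAt.comp w hA.fderiv.differentiableAt.hasFDerivAt
  have h2 := (hasFDerivAt_fst (𝕜 := ℝ) (p := w)).prodMk h1.fst.neg
  rw [show fderiv ℝ (initialPoint A) w = _ from h2.fderiv]
  rfl

theorem fderiv_finalPoint {w : Cot} (hA : SmoothNear A w) (u : Cot) :
    fderiv ℝ (finalPoint A) w u = (u.2, (grad (fderiv ℝ (fderiv ℝ A) w u)).2) := by
  have h1 : HasFDerivAt (fun w => grad (fderiv ℝ A w)) (grad.comp (fderiv ℝ (fderiv ℝ A) w)) w :=
    grad.hasFDerivAt.comp w hA.fderiv.differentiableAt.hasFDerivAt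
  have h2 := (hasFDerivAt_snd (𝕜 := ℝ) (p := w)).prodMk h1.snd
  rw [show fderiv ℝ (finalPoint A) w = _ from h2.fderiv]
  rfl

theorem IsPotential.exists_inverse (hA : IsPotential A) :
    ∃ κ : Cot → Cot, SmoothNear κ 0 ∧ κ 0 = 0 ∧ (∀ᶠ w in 𝓝 0, κ (initialPoint A w) = w) ∧
      ∀ᶠ z in 𝓝 0, initialPoint A (κ z) = z := by
  have := (smoothNear_initialPoint hA.smooth).exists_inverse hA.bijective
  rwa [initialPoint_zero hA.fderiv_zero] at this

theorem IsPotential.tendsto_initialPoint (hA : IsPotential A) :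
    Filter.Tendsto (initialPoint A) (𝓝 0) (𝓝 0) :=
  tendsto_zero_of_smooth (smoothNear_initialPoint hA.smooth) (initialPoint_zero hA.fderiv_zero)

theorem IsPotential.exists_isGen (hA : IsPotential A) :
    ∃ S, SmoothNear S 0 ∧ S 0 = 0 ∧ IsGen A S := by
  obtain ⟨κ, hκ, hκ0, h1, -⟩ := hA.exists_inverse
  refine ⟨fun z => finalPoint A (κ z), (smoothNear_finalPoint hA.smooth).comp_of_eq hκ hκ0, ?_, ?_⟩
  · simp only [hκ0, finalPoint_zero hA.fderiv_zero]
  · filter_upwards [h1] with w hw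
    rw [hw]

/-- The difference of the two sides is D²A(u, v) - D²A(v, u). The symmetry of the Hessian is what
makes a generated germ symplectic. -/
theorem omega_finalPoint {w : Cot} (hA : SmoothNear A w) (u v : Cot) :
    omega (fderiv ℝ (finalPoint A) w u) (fderiv ℝ (finalPoint A) w v) =
      omega (fderiv ℝ (initialPoint A) w u) (fderiv ℝ (initialPoint A) w v) := by
  have h := hA.fderiv_fderiv_symm u v
  rw [apply_eq_grad _ v, apply_eq_grad _ u] at h
  simp only [fderiv_initialPoint hA, fderiv_finalPoint hA, omega, Fin.sum_univ_three,
    Pi.neg_apply] at h ⊢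
  linarith

theorem IsGen.isSymplecticGerm (hA : IsPotential A) (hS : SmoothNear S 0) (hS0 : S 0 = 0)
    (h : IsGen A S) : IsSymplecticGerm S := by
  refine ⟨hS0, hS, ?_⟩
  obtain ⟨κ, hκ, hκ0, -, h2⟩ := hA.exists_inverse
  have tκ := tendsto_zero_of_smooth hκ hκ0
  have key : ∀ᶠ w in 𝓝 0, ∀ u v, omega (fderiv ℝ S (initialPoint A w) u)
      (fderiv ℝ S (initialPoint A w) v) = omega u v := by
    filter_upwards [hA.smooth.eventually, eventually_bijective
        (smoothNear_initialPoint hA.smooth).fderiv.continuousAt hA.bijective,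
      hA.tendsto_initialPoint.eventually hS.eventually_differentiableAt,
      Filter.Eventually.eventually_nhds h] with w h1 hb h3 h4 u v
    obtain ⟨u, rfl⟩ := hb.2 u
    obtain ⟨v, rfl⟩ := hb.2 v
    have hc : ∀ u, fderiv ℝ S (initialPoint A w) (fderiv ℝ (initialPoint A) w u) =
        fderiv ℝ (finalPoint A) w u := by
      intro u
      have e := fderiv_comp w h3 (smoothNear_initialPoint h1).differentiableAt
      rw [← ContinuousLinearMap.comp_apply, ← e]
      exact DFunLike.congr_fun
        (show S ∘ initialPoint A =ᶠ[𝓝 w] finalPoint A from h4).fderiv_eq u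
    rw [hc, hc, omega_finalPoint h1]
  filter_upwards [tκ.eventually key, h2] with z h3 h4
  rwa [h4] at h3

/-- The map `(q, p) ↦ (q, Q)`. -/
def mixedPoint (S : Cot → Cot) (z : Cot) : Cot := (z.1, (S z).1)

theorem smoothNear_mixedPoint {z : Cot} (hS : SmoothNear S z) : SmoothNear (mixedPoint S) z :=
  (smoothNear_id z).fst.prodMk hS.fst

theorem IsGen.mixedPoint_initialPoint (h : IsGen A S) :
    ∀ᶠ w in 𝓝 0, mixedPoint S (initialPoint A w) = w := by
  filter_upwards [h] with w hw
  simp only [mixedPoint, hw]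
  rfl

/-- The components of `dA` at `(q, Q)`, for a local inverse `ψ` of `mixedPoint S`. -/
def primitiveForm (S ψ : Cot → Cot) (w : Cot) : Cot →L[ℝ] ℝ :=
  gradEquiv.symm (-(ψ w).2, (S (ψ w)).2)

theorem smoothNear_primitiveForm {ψ : Cot → Cot} (hS : SmoothNear S 0) (hψ : SmoothNear ψ 0)
    (h0 : ψ 0 = 0) : SmoothNear (primitiveForm S ψ) 0 :=
  SmoothNear.clm gradEquiv.symm.toContinuousLinearMap
    (hψ.snd.neg.prodMk (hS.comp_of_eq hψ h0).snd)

/-- The hypothesis makes (q, Q) local coordinates. In them the 1-form -p dq + P dQ is closed,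
because its differential is the pullback of the symplectic form by S minus the form itself. The
Poincaré lemma on a ball gives A. -/
theorem IsSymplecticGerm.exists_isGen (hS : IsSymplecticGerm S)
    (hb : Function.Bijective (fderiv ℝ (mixedPoint S) 0)) : ∃ A, IsPotential A ∧ IsGen A S := by
  have h00 : mixedPoint S 0 = 0 := by simp [mixedPoint, hS.zero]
  obtain ⟨ψ, hψ, hψ0, h1, h2⟩ := (smoothNear_mixedPoint hS.smooth).exists_inverse hb
  rw [h00] at hψ hψ0 h2
  have tψ := tendsto_zero_of_smooth hψ hψ0
  have hα := smoothNear_primitiveForm hS.smooth hψ hψ0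
  have hSψ := hS.smooth.comp_of_eq hψ hψ0
  have hclosed : ∀ᶠ w in 𝓝 0, ∀ u v, fderiv ℝ (primitiveForm S ψ) w u v =
      fderiv ℝ (primitiveForm S ψ) w v u := by
    filter_upwards [h2.eventually_nhds, hψ.eventually_differentiableAt,
      hSψ.eventually_differentiableAt, tψ.eventually hS.2.2,
      tψ.eventually hS.smooth.eventually_differentiableAt] with w h3 h4 h5 h6 h7 u v
    have e1 : ∀ u, (fderiv ℝ ψ w u).1 = u.1 := by
      intro u
      have : (fun w => (ψ w).1) =ᶠ[𝓝 w] fun w => w.1 := 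
        h3.mono fun w hw => (congrArg Prod.fst hw :)
      have := this.fderiv_eq (𝕜 := ℝ)
      rw [h4.hasFDerivAt.fst.fderiv, (hasFDerivAt_fst (𝕜 := ℝ) (p := w)).fderiv] at this
      exact DFunLike.congr_fun this u
    have e2 : ∀ u, (fderiv ℝ (fun w => S (ψ w)) w u).1 = u.2 := by
      intro u
      have : (fun w => (S (ψ w)).1) =ᶠ[𝓝 w] fun w => w.2 := 
        h3.mono fun w hw => (congrArg Prod.snd hw :)
      have := this.fderiv_eq (𝕜 := ℝ)
      rw [h5.hasFDerivAt.fst.fderiv, (hasFDerivAt_snd (𝕜 := ℝ) (p := w)).fderiv] at this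
      exact DFunLike.congr_fun this u
    have e3 : ∀ u, fderiv ℝ (fun w => S (ψ w)) w u = fderiv ℝ S (ψ w) (fderiv ℝ ψ w u) := by
      intro u
      rw [show fderiv ℝ (fun w => S (ψ w)) w = _ from fderiv_comp w h7 h4]; rfl
    have e4 : ∀ u, grad (fderiv ℝ (primitiveForm S ψ) w u) =
        (-(fderiv ℝ ψ w u).2, (fderiv ℝ (fun w => S (ψ w)) w u).2) := by
      intro u
      have h := (gradEquiv.symm.toContinuousLinearMap.hasFDerivAt).comp w
        (h4.hasFDerivAt.snd.neg.prodMk h5.hasFDerivAt.snd)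
      rw [show fderiv ℝ (primitiveForm S ψ) w = _ from h.fderiv]
      exact grad_symm _
    have e5 := h6 (fderiv ℝ ψ w u) (fderiv ℝ ψ w v)
    rw [← e3, ← e3] at e5
    rw [apply_eq_grad _ v, apply_eq_grad _ u, e4, e4]
    simp only [omega, e1, e2, Fin.sum_univ_three, Pi.neg_apply] at e5 ⊢
    linarith
  obtain ⟨ε, hε, hball⟩ := Metric.eventually_nhds_iff_ball.1 (hα.and hclosed)
  obtain ⟨f, hf⟩ := (convex_ball (0 : Cot) ε).exists_forall_hasFDerivAt_of_fderiv_symmetric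
    Metric.isOpen_ball
    (fun w hw => ((hball w hw).1.differentiableAt (by simp)).differentiableWithinAt)
    fun w hw => (hball w hw).2
  let A : Cot → ℝ := fun w => f w - f 0
  have hA' : ∀ w ∈ Metric.ball (0 : Cot) ε, HasFDerivAt A (primitiveForm S ψ w) w :=
    fun w hw => (hf w hw).sub_const _
  have hb0 : (0 : Cot) ∈ Metric.ball (0 : Cot) ε := Metric.mem_ball_self hε
  have hdA : fderiv ℝ A =ᶠ[𝓝 0] primitiveForm S ψ := by
    filter_upwards [Metric.ball_mem_nhds (0 : Cot) hε] with w hw using (hA' w hw).fderiv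
  have hAs : SmoothNear A 0 := by
    filter_upwards [Metric.ball_mem_nhds (0 : Cot) hε] with w hw
    -- The derivative of A on the ball is the smooth form, so A gains one order over every finite n.
    refine contDiffAt_infty.2 fun n => ContDiffAt.of_le (n := ((n : ℕ) : ℕ∞ω) + 1) ?_ le_self_add
    rw [contDiffAt_succ_iff_hasFDerivAt]
    exact ⟨primitiveForm S ψ, ⟨Metric.ball 0 ε, Metric.isOpen_ball.mem_nhds hw, hA'⟩,
      contDiffAt_infty.1 (hball w hw).1 n⟩
  have hK : initialPoint A =ᶠ[𝓝 0] ψ := by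
    filter_upwards [hdA, h2] with w h3 h4
    rw [initialPoint, h3, primitiveForm, grad_symm]
    refine Prod.ext ?_ (by simp)
    exact (congrArg Prod.fst h4 :).symm
  refine ⟨A, ⟨hAs, by simp [A], ?_, ?_⟩, ?_⟩
  · rw [hdA.self_of_nhds, primitiveForm, hψ0, hS.zero]
    simp
  · rw [hK.fderiv_eq]
    have hc : (fderiv ℝ (mixedPoint S) 0).comp (fderiv ℝ ψ 0) = ContinuousLinearMap.id ℝ Cot := by
      have hd : DifferentiableAt ℝ (mixedPoint S) (ψ 0) := by
        rw [hψ0]; exact (smoothNear_mixedPoint hS.smooth).differentiableAt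
      have := fderiv_comp (0 : Cot) hd hψ.differentiableAt
      rw [hψ0] at this
      rw [← this, show ContinuousLinearMap.id ℝ Cot = fderiv ℝ (fun x => x) 0 by simp]
      exact (show mixedPoint S ∘ ψ =ᶠ[𝓝 0] fun x => x from h2).fderiv_eq
    have hinj : Function.Injective (fderiv ℝ ψ 0) :=
      Function.LeftInverse.injective (g := fderiv ℝ (mixedPoint S) 0)
        fun u => DFunLike.congr_fun hc u
    exact ⟨hinj, (LinearMap.injective_iff_surjective
      (f := (fderiv ℝ ψ 0 : Cot →ₗ[ℝ] Cot))).1 hinj⟩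
  · filter_upwards [hdA, h2, hK] with w h3 h4 h5
    rw [h5, finalPoint, h3, primitiveForm, grad_symm]
    refine Prod.ext ?_ rfl
    exact congrArg Prod.snd h4

end Generating

/-! ### Jets of generating functions -/

section GeneratingJets

variable {l : ℕ} {A A' : Cot → ℝ} {S S' : Cot → Cot}

theorem JetEq.initialPoint (h : JetEq (l + 1) A A') (hA : SmoothNear A 0)
    (hA' : SmoothNear A' 0) : JetEq l (initialPoint A) (initialPoint A') := by
  have h1 := h.fderiv.clm (-(ContinuousLinearMap.fst ℝ _ _).comp grad) hA.fderiv hA'.fderiv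
  exact (JetEq.refl l (fun w : Cot => w.1)).prodMk h1 (smoothNear_id 0).fst (smoothNear_id 0).fst
    (hA.fderiv.clm grad).fst.neg (hA'.fderiv.clm grad).fst.neg

theorem JetEq.finalPoint (h : JetEq (l + 1) A A') (hA : SmoothNear A 0)
    (hA' : SmoothNear A' 0) : JetEq l (finalPoint A) (finalPoint A') := by
  have h1 := h.fderiv.clm ((ContinuousLinearMap.snd ℝ _ _).comp grad) hA.fderiv hA'.fderiv
  exact (JetEq.refl l (fun w : Cot => w.2)).prodMk h1 (smoothNear_id 0).snd (smoothNear_id 0).snd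
    (hA.fderiv.clm grad).snd (hA'.fderiv.clm grad).snd

theorem JetEq.mixedPoint (h : JetEq l S S') (hS : SmoothNear S 0) (hS' : SmoothNear S' 0) :
    JetEq l (mixedPoint S) (mixedPoint S') :=
  (JetEq.refl l (fun w : Cot => w.1)).prodMk (h.clm (ContinuousLinearMap.fst ℝ _ _) hS hS')
    (smoothNear_id 0).fst (smoothNear_id 0).fst hS.fst hS'.fst

theorem IsPotential.of_jetEq (h : JetEq 2 A A') (hA : IsPotential A) (hA' : SmoothNear A' 0) :
    IsPotential A' := by
  refine ⟨hA', h.eq.symm.trans hA.zero, ?_, ?_⟩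
  · rw [← (h.mono one_le_two).fderiv_eq (l := 0), hA.fderiv_zero]
  · rw [← (h.initialPoint hA.smooth hA').fderiv_eq (l := 0)]
    exact hA.bijective

/-- The `l`-jet of a symplectic germ is determined by the `(l+1)`-jet of its generating
function. -/
theorem IsGen.jetEq (hA : IsPotential A) (hA' : IsPotential A') (hS : IsGen A S)
    (hS' : IsGen A' S') (h : JetEq (l + 1) A A') : JetEq l S S' := by
  obtain ⟨κ, hκ, hκ0, h1, h2⟩ := hA.exists_inverse
  obtain ⟨κ', hκ', hκ0', -, h2'⟩ := hA'.exists_inverse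
  have hk : JetEq l κ κ' := (h.initialPoint hA.smooth hA'.smooth).inverse
    (smoothNear_initialPoint hA.smooth) (smoothNear_initialPoint hA'.smooth) hκ hκ' hκ0 hκ0' h1 h2
    h2'
  have e : S =ᶠ[𝓝 0] fun z => RetLag.finalPoint A (κ z) := by
    filter_upwards [(tendsto_zero_of_smooth hκ hκ0).eventually hS, h2] with z h3 h4
    rw [← h3, h4]
  have e' : S' =ᶠ[𝓝 0] fun z => RetLag.finalPoint A' (κ' z) := by
    filter_upwards [(tendsto_zero_of_smooth hκ' hκ0').eventually hS', h2'] with z h3 h4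
    rw [← h3, h4]
  exact (JetEq.of_eventuallyEq e).trans (((h.finalPoint hA.smooth hA'.smooth).comp hk
    (smoothNear_finalPoint hA.smooth) (smoothNear_finalPoint hA'.smooth) hκ hκ' hκ0 hκ0').trans
    (JetEq.of_eventuallyEq e').symm)

/-- The jet of a potential. -/
def IsPotential.toJet (hA : IsPotential A) (n : ℕ) : potentialJets n :=
  ⟨jets n A, A, hA.smooth, hA.zero, hA.fderiv_zero, rfl⟩

theorem IsPotential.jetEq_potential (hA : IsPotential A) (n : ℕ) :
    JetEq n A (potential (hA.toJet n)) :=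
  jets_eq_iff.1 (jets_potential (hA.toJet n)).symm

theorem IsPotential.isPotential_potential (hA : IsPotential A) {n : ℕ} (hn : 2 ≤ n) :
    IsPotential (potential (hA.toJet n)) :=
  hA.of_jetEq ((hA.jetEq_potential n).mono hn) (smoothNear_potential _ _)

open Classical in
/-- The `l`-jet of the symplectic germ generated by a polynomial potential. -/
def genJet (l : ℕ) (θ : potentialJets (l + 1)) : JetSpace l :=
  -- The value 0 is a dummy, since only potentials matter. The choice of germ is irrelevant because
  -- the jet depends on θ alone (`genJet_eq`).
  if h : IsPotential (potential θ) then jet l h.exists_isGen.choose else 0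

theorem genJet_eq {θ : potentialJets (l + 1)} (hθ : IsPotential (potential θ))
    (hA : IsPotential A) (hj : jets (l + 1) A = θ) (h : IsGen A S) : genJet l θ = jet l S := by
  rw [genJet, dif_pos hθ]
  refine jets_eq_iff.2 (hθ.exists_isGen.choose_spec.2.2.jetEq hθ hA h (jets_eq_iff.1 ?_))
  rw [jets_potential, hj]

theorem genJet_toJet (hl : 1 ≤ l) (hA : IsPotential A) (h : IsGen A S) :
    genJet l (hA.toJet (l + 1)) = jet l S :=
  genJet_eq (hA.isPotential_potential (by omega)) hA rfl h

theorem smoothNear_uncurry_potential {n : ℕ} (p : potentialJets n × Cot) :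
    SmoothNear (Function.uncurry (potential : potentialJets n → Cot → ℝ)) p :=
  ContDiff.smoothNear contDiff_potential p

theorem smoothNear_uncurry_initialPoint {n : ℕ} (θ : potentialJets n) :
    SmoothNear (Function.uncurry fun (θ : potentialJets n) w => initialPoint (potential θ) w)
      (θ, 0) :=
  (smoothNear_id _).snd.fst.prodMk
    (((smoothNear_uncurry_potential (θ, 0)).partial_fderiv.clm grad).fst.neg)

theorem smoothNear_uncurry_finalPoint {n : ℕ} (θ : potentialJets n) :
    SmoothNear (Function.uncurry fun (θ : potentialJets n) w => finalPoint (potential θ) w)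
      (θ, 0) :=
  (smoothNear_id _).snd.snd.prodMk
    (((smoothNear_uncurry_potential (θ, 0)).partial_fderiv.clm grad).snd)

theorem eventually_isPotential {n : ℕ} {θ : potentialJets n}
    (hθ : IsPotential (potential θ)) (hn : 1 ≤ n) : ∀ᶠ s in 𝓝 θ, IsPotential (potential s) := by
  have h := (smoothNear_uncurry_initialPoint θ).partial_fderiv.left.continuousAt
  filter_upwards [eventually_bijective h hθ.bijective] with s hs
  exact ⟨smoothNear_potential s 0, potential_zero s, fderiv_potential_zero hn s, hs⟩

/-- Near a given potential, the generated germs form a smooth family. -/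
theorem exists_smooth_family {n : ℕ} {θ : potentialJets n}
    (hθ : IsPotential (potential θ)) (hn : 1 ≤ n) : ∃ S : potentialJets n → Cot → Cot,
      SmoothNear (Function.uncurry S) (θ, 0) ∧ ∀ᶠ s in 𝓝 θ,
        IsPotential (potential s) ∧ IsGen (potential s) (S s) ∧ IsSymplecticGerm (S s) := by
  obtain ⟨g, hg, hg0, h1, -⟩ := (smoothNear_uncurry_initialPoint θ).exists_inverse_param
    (Filter.Eventually.of_forall fun s => initialPoint_zero (fderiv_potential_zero hn s))
    hθ.bijective
  have hS : SmoothNear (Function.uncurry fun s z => finalPoint (potential s) (g s z)) (θ, 0) :=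
    (smoothNear_uncurry_finalPoint θ).comp_of_eq (f := fun p : potentialJets n × Cot =>
      (p.1, Function.uncurry g p)) ((smoothNear_id _).fst.prodMk hg)
      (by simp [Function.uncurry, hg0.self_of_nhds])
  refine ⟨fun s z => finalPoint (potential s) (g s z), hS, ?_⟩
  filter_upwards [eventually_isPotential hθ hn, hg0, h1.curry_nhds, hS.eventually_right]
    with s h3 h4 h5 h6
  have hG : IsGen (potential s) (fun z => finalPoint (potential s) (g s z)) := by
    filter_upwards [h5] with w hw
    rw [hw]
  refine ⟨h3, hG, hG.isSymplecticGerm h3 h6 ?_⟩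
  simp only [h4, finalPoint_zero h3.fderiv_zero]

theorem smoothNear_genJet {θ : potentialJets (l + 1)} (hθ : IsPotential (potential θ)) :
    SmoothNear (genJet l) θ := by
  obtain ⟨S, hS, h⟩ := exists_smooth_family hθ (by omega)
  refine (hS.jets (n := l)).congr ?_
  filter_upwards [h] with s hs
  exact genJet_eq hs.1 hs.1 (jets_potential s) hs.2.1

/-- The jet of the generating function is a smooth function of the jet of the symplectic germ. -/
theorem exists_smooth_potentialJet (hl : 1 ≤ l) {S₀ : Cot → Cot} (hS₀ : IsSymplecticGerm S₀)
    (hb : Function.Bijective (fderiv ℝ (mixedPoint S₀) 0)) :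
    ∃ ρ : JetSpace l → Jets (l + 1) Cot ℝ, SmoothNear ρ (jet l S₀) ∧
      ∀ᶠ j in 𝓝 (jet l S₀), ∀ A S, IsPotential A → IsSymplecticGerm S → IsGen A S →
        jet l S = j → ρ j = jets (l + 1) A := by
  -- The form -p dq + P dQ can be written down for any local diffeomorphism, so the Taylor
  -- polynomial may replace the germ although it need not be symplectic. Subtracting the constant
  -- term makes every member of the family fix the origin.
  let T : JetSpace l → Cot → Cot := fun j z => taylorPoly j z - taylorPoly j 0
  have hT : ∀ p, SmoothNear (Function.uncurry T) p := by
    intro p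
    refine SmoothNear.sub (ContDiff.smoothNear contDiff_taylorPoly p) ?_
    exact (ContDiff.smoothNear (contDiff_taylorPoly (n := l) (E := Cot) (F := Cot)) _).comp
      ((smoothNear_id p).fst.prodMk (smoothNear_const 0 p))
  have hT0 : ∀ j, T j 0 = 0 := fun j => sub_self _
  have hTs : ∀ j, SmoothNear (T j) 0 := fun j =>
    (smoothNear_taylorPoly j 0).sub (smoothNear_const _ 0)
  have hTj : ∀ S, IsSymplecticGerm S → JetEq l (T (jet l S)) S := by
    intro S hS
    have h1 : JetEq l (taylorPoly (jet l S)) S := jetEq_taylorPoly hS.smooth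
    have h2 : T (jet l S) = taylorPoly (jet l S) := by
      funext z
      simp only [T, h1.eq, hS.zero, sub_zero]
    rwa [h2]
  let j₀ := jet l S₀
  have hb' : Function.Bijective (fderiv ℝ (mixedPoint (T j₀)) 0) := by
    rw [(((hTj S₀ hS₀).mono hl).mixedPoint (hTs _) hS₀.smooth).fderiv_eq (l := 0)]
    exact hb
  have hX : SmoothNear (Function.uncurry fun j z => mixedPoint (T j) z) (j₀, 0) :=
    (smoothNear_id _).snd.fst.prodMk (hT _).fst
  obtain ⟨ψ, hψ, hψ0, h1, h2⟩ := hX.exists_inverse_param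
    (Filter.Eventually.of_forall fun j => by simp [mixedPoint, hT0]) hb'
  have hα : SmoothNear (Function.uncurry fun j => primitiveForm (T j) (ψ j)) (j₀, 0) :=
    SmoothNear.clm gradEquiv.symm.toContinuousLinearMap
      (hψ.snd.neg.prodMk (((hT (j₀, 0)).comp_of_eq (f := fun p : JetSpace l × Cot =>
        (p.1, Function.uncurry ψ p)) ((smoothNear_id _).fst.prodMk hψ)
        (by simp [Function.uncurry, hψ0.self_of_nhds])).snd))
  -- The (l+1)-jet of A consists of A(0) = 0 and the l-jet of dA. The components of dA are -p and P
  -- in the coordinates (q, Q), so the l-jet of the germ suffices.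
  let ρ : JetSpace l → Jets (l + 1) Cot ℝ := fun j m => match m with
    | ⟨0, _⟩ => 0
    | ⟨k + 1, _⟩ => (continuousMultilinearCurryRightEquiv' ℝ k Cot ℝ).symm
        (iteratedFDeriv ℝ k (primitiveForm (T j) (ψ j)) 0)
  refine ⟨ρ, ?_, ?_⟩
  · have : ∀ m : Fin (l + 1 + 1), ∀ᶠ j in 𝓝 j₀, ContDiffAt ℝ ∞ (fun j => ρ j m) j := by
      rintro ⟨_ | k, hk⟩
      · exact smoothNear_const _ _
      · exact (hα.iteratedFDeriv k).clm
          (continuousMultilinearCurryRightEquiv' ℝ k Cot ℝ).symm.toContinuousLinearEquiv.toContinuousLinearMap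
    filter_upwards [Filter.eventually_all.2 this] with s hs
    exact contDiffAt_pi.2 hs
  · filter_upwards [hψ0, h1.curry_nhds, h2.curry_nhds, hψ.eventually_right] with j h3 h4 h5 h6
    rintro A S hA hS hAS rfl
    have e1 : JetEq l (ψ (jet l S)) (initialPoint A) :=
      ((hTj S hS).mixedPoint (hTs _) hS.smooth).inverse (smoothNear_mixedPoint (hTs _))
        (smoothNear_mixedPoint hS.smooth) h6 (smoothNear_initialPoint hA.smooth) h3
        (initialPoint_zero hA.fderiv_zero) h4 h5 hAS.mixedPoint_initialPoint
    have e2 : JetEq l (fun w => T (jet l S) (ψ (jet l S) w)) (finalPoint A) :=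
      ((hTj S hS).comp e1 (hTs _) hS.smooth h6 (smoothNear_initialPoint hA.smooth) h3
        (initialPoint_zero hA.fderiv_zero)).trans (JetEq.of_eventuallyEq hAS)
    have s1 := smoothNear_initialPoint hA.smooth
    have s2 := smoothNear_finalPoint hA.smooth
    have s3 : SmoothNear (fun w => T (jet l S) (ψ (jet l S) w)) 0 := (hTs _).comp_of_eq h6 h3
    have e3 : JetEq l (primitiveForm (T (jet l S)) (ψ (jet l S))) (fderiv ℝ A) := by
      have a1 := (e1.clm (-ContinuousLinearMap.snd ℝ _ _) h6 s1).prodMk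
        (e2.clm (ContinuousLinearMap.snd ℝ _ _) s3 s2) (h6.clm _) (s1.clm _) (s3.clm _) (s2.clm _)
      have a2 := a1.clm gradEquiv.symm.toContinuousLinearMap
        ((h6.clm _).prodMk (s3.clm _)) ((s1.clm _).prodMk (s2.clm _))
      refine a2.trans (JetEq.of_eventuallyEq (Filter.Eventually.of_forall fun w => ?_))
      refine gradEquiv.injective ?_
      refine (gradEquiv.apply_symm_apply _).trans ?_
      refine Prod.ext ?_ rfl
      exact neg_neg _
    funext m
    obtain ⟨_ | k, hk⟩ := m
    · ext v
      simp only [ρ, jets]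
      rw [iteratedFDeriv_zero_apply, hA.zero]
      rfl
    · simp only [ρ, jets, iteratedFDeriv_succ_eq_comp_right, Function.comp_apply]
      rw [e3 k (by omega)]

end GeneratingJets

/-! ### Infinitesimal versality of the normal form -/

section Versality

/-- The base `ℝ³` of the fibration. -/
abbrev Base : Type := Fin 3 → ℝ

/-- The functions in the tangent space at `c · F_a(x, g(Q)) + b(Q)`, where `e = a + g₃`, to its
equivalence class; multiples of `q₃` are disregarded. -/
def InTangent (c g₁ g₂ e : Base → ℝ) (H : Cot → ℝ) : Prop :=
  ∃ (ξ₁ ξ₂ B : Cot → ℝ) (η₁ η₂ η₃ b : Base → ℝ),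
    (SmoothNear ξ₁ 0 ∧ SmoothNear ξ₂ 0 ∧ SmoothNear B 0 ∧ SmoothNear η₁ 0 ∧ SmoothNear η₂ 0 ∧
      SmoothNear η₃ 0 ∧ SmoothNear b 0) ∧
    ∀ᶠ w : Cot in 𝓝 0, H w = c w.2 * (w.1 0 * ξ₁ w * (2 * w.1 0 + w.1 1 + g₁ w.2) +
      w.1 1 * ξ₂ w * (w.1 0 + 2 * e w.2 * w.1 1 + g₂ w.2) +
      (η₁ w.2 * w.1 0 + η₂ w.2 * w.1 1 + η₃ w.2 * w.1 1 ^ 2)) + b w.2 + w.1 2 * B w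

variable {c g₁ g₂ e : Base → ℝ} {H H' : Cot → ℝ}

theorem SmoothNear.comp_snd {f : Base → ℝ} (hf : SmoothNear f 0) :
    SmoothNear (fun w : Cot => f w.2) 0 := hf.comp_of_eq (smoothNear_id 0).snd rfl

theorem smoothNear_coord (i : Fin 3) (w : Cot) : SmoothNear (fun w : Cot => w.1 i) w :=
  smoothNear_pi.1 (smoothNear_id w).fst i

theorem eventually_snd {p : Base → Prop} (h : ∀ᶠ Q in 𝓝 0, p Q) : ∀ᶠ w : Cot in 𝓝 0, p w.2 :=
  (continuous_snd.tendsto (0 : Cot)).eventually h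

theorem SmoothNear.pow {E : Type} [NormedAddCommGroup E] [NormedSpace ℝ E] {f : E → ℝ} {x : E}
    (hf : SmoothNear f x) (n : ℕ) : SmoothNear (fun z => f z ^ n) x :=
  hf.mono fun _ h => h.pow n

theorem InTangent.congr (h : InTangent c g₁ g₂ e H) (hH : H' =ᶠ[𝓝 0] H) :
    InTangent c g₁ g₂ e H' := by
  obtain ⟨ξ₁, ξ₂, B, η₁, η₂, η₃, b, hs, he⟩ := h
  refine ⟨ξ₁, ξ₂, B, η₁, η₂, η₃, b, hs, ?_⟩
  filter_upwards [he, hH] with w h1 h2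
  rw [h2, h1]

theorem InTangent.add (h : InTangent c g₁ g₂ e H) (h' : InTangent c g₁ g₂ e H') :
    InTangent c g₁ g₂ e (fun w => H w + H' w) := by
  obtain ⟨ξ₁, ξ₂, B, η₁, η₂, η₃, b, ⟨s1, s2, s3, s4, s5, s6, s7⟩, he⟩ := h
  obtain ⟨ξ₁', ξ₂', B', η₁', η₂', η₃', b', ⟨t1, t2, t3, t4, t5, t6, t7⟩, he'⟩ := h'
  refine ⟨_, _, _, _, _, _, _, ⟨s1.add t1, s2.add t2, s3.add t3, s4.add t4, s5.add t5, s6.add t6,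
    s7.add t7⟩, ?_⟩
  filter_upwards [he, he'] with w h1 h2
  rw [h1, h2]; ring

theorem InTangent.mul (h : InTangent c g₁ g₂ e H) {W : Base → ℝ} (hW : SmoothNear W 0) :
    InTangent c g₁ g₂ e (fun w => W w.2 * H w) := by
  obtain ⟨ξ₁, ξ₂, B, η₁, η₂, η₃, b, ⟨s1, s2, s3, s4, s5, s6, s7⟩, he⟩ := h
  have hW' := hW.comp_snd
  refine ⟨_, _, _, _, _, _, _, ⟨hW'.mul s1, hW'.mul s2, hW'.mul s3, hW.mul s4, hW.mul s5,
    hW.mul s6, hW.mul s7⟩, ?_⟩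
  filter_upwards [he] with w h1
  rw [h1]; ring

theorem InTangent.sum {ι : Type*} (s : Finset ι) {f : ι → Cot → ℝ}
    (h : ∀ i ∈ s, InTangent c g₁ g₂ e (f i)) :
    InTangent c g₁ g₂ e (fun w => ∑ i ∈ s, f i w) := by
  classical
  induction s using Finset.induction_on with
  | empty =>
    refine ⟨_, _, _, _, _, _, _, ⟨smoothNear_const 0 _, smoothNear_const 0 _, smoothNear_const 0 _,
      smoothNear_const 0 _, smoothNear_const 0 _, smoothNear_const 0 _, smoothNear_const 0 _⟩, ?_⟩
    filter_upwards with w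
    simp
  | insert a s ha ih =>
    simp only [Finset.sum_insert ha]
    exact (h a (by simp)).add (ih fun i hi => h i (by simp [hi]))

theorem inTangent_q₃ {B : Cot → ℝ} (hB : SmoothNear B 0) :
    InTangent c g₁ g₂ e (fun w => w.1 2 * B w) := by
  refine ⟨_, _, B, _, _, _, _, ⟨smoothNear_const 0 _, smoothNear_const 0 _, hB,
    smoothNear_const 0 _, smoothNear_const 0 _, smoothNear_const 0 _, smoothNear_const 0 _⟩, ?_⟩
  filter_upwards with w
  ring

theorem inTangent_base {b : Base → ℝ} (hb : SmoothNear b 0) :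
    InTangent c g₁ g₂ e (fun w => b w.2) := by
  refine ⟨_, _, _, _, _, _, b, ⟨smoothNear_const 0 _, smoothNear_const 0 _, smoothNear_const 0 _,
    smoothNear_const 0 _, smoothNear_const 0 _, smoothNear_const 0 _, hb⟩, ?_⟩
  filter_upwards with w
  ring

/-! ### Monomials in the tangent space of a normal form -/

section Unit

variable (hc : SmoothNear c 0) (hc0 : c 0 ≠ 0)
include hc hc0

theorem inTangent_of_mul (h : InTangent c g₁ g₂ e (fun w => c w.2 * H w)) :
    InTangent c g₁ g₂ e H := by
  refine (h.mul (hc.inv hc0)).congr ?_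
  filter_upwards [eventually_snd (hc.continuousAt.eventually_ne hc0)] with w hw
  field_simp

theorem inTangent_x₁ {ξ : Cot → ℝ} (hξ : SmoothNear ξ 0) :
    InTangent c g₁ g₂ e (fun w => w.1 0 * ξ w * (2 * w.1 0 + w.1 1 + g₁ w.2)) := by
  refine inTangent_of_mul hc hc0 ⟨ξ, _, _, _, _, _, _, ⟨hξ, smoothNear_const 0 _,
    smoothNear_const 0 _, smoothNear_const 0 _, smoothNear_const 0 _, smoothNear_const 0 _,
    smoothNear_const 0 _⟩, ?_⟩
  filter_upwards with w
  ring

theorem inTangent_x₂ {ξ : Cot → ℝ} (hξ : SmoothNear ξ 0) :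
    InTangent c g₁ g₂ e (fun w => w.1 1 * ξ w * (w.1 0 + 2 * e w.2 * w.1 1 + g₂ w.2)) := by
  refine inTangent_of_mul hc hc0 ⟨_, ξ, _, _, _, _, _, ⟨smoothNear_const 0 _, hξ,
    smoothNear_const 0 _, smoothNear_const 0 _, smoothNear_const 0 _, smoothNear_const 0 _,
    smoothNear_const 0 _⟩, ?_⟩
  filter_upwards with w
  ring

theorem inTangent_quadratic (r₁ r₂ r₃ : ℝ) :
    InTangent c g₁ g₂ e (fun w => r₁ * w.1 0 + r₂ * w.1 1 + r₃ * w.1 1 ^ 2) := by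
  refine inTangent_of_mul hc hc0 ⟨_, _, _, _, _, _, _, ⟨smoothNear_const 0 _, smoothNear_const 0 _,
    smoothNear_const 0 _, smoothNear_const r₁ _, smoothNear_const r₂ _, smoothNear_const r₃ _,
    smoothNear_const 0 _⟩, ?_⟩
  filter_upwards with w
  ring

variable (hg₁ : SmoothNear g₁ 0) (hg₂ : SmoothNear g₂ 0) (he : SmoothNear e 0)
  (he0 : 1 / 4 < e 0)
include hg₁ hg₂ he he0

/-- Multiplying 2x₁ + x₂ + g₁ and x₁ + 2e x₂ + g₂ by x₁^(i+1) x₂^(j+1) gives two linear equations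
for the two monomials of the next degree. Their determinant 4e - 1 is nonzero near 0, so Cramer's
rule reduces both to x₁^(i+1) x₂^(j+1). The induction starts from x₁x₂, which the field x₂∂/∂x₂
expresses through x₂² and x₂. -/
theorem inTangent_mixed (i j : ℕ) :
    InTangent c g₁ g₂ e (fun w => w.1 0 ^ (i + 1) * w.1 1 ^ (j + 1)) := by
  have hx := smoothNear_coord 0 (0 : Cot)
  have hy := smoothNear_coord 1 (0 : Cot)
  have h2 : SmoothNear (fun _ : Base => (2 : ℝ)) 0 := smoothNear_const 2 0
  have h4 : SmoothNear (fun _ : Base => (4 : ℝ)) 0 := smoothNear_const 4 0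
  have h1 : SmoothNear (fun _ : Base => (1 : ℝ)) 0 := smoothNear_const 1 0
  have hdet : SmoothNear (fun Q => 4 * e Q - 1) 0 := (h4.mul he).sub h1
  have hd0 : 4 * e 0 - 1 ≠ 0 := by linarith
  have hne : ∀ᶠ w : Cot in 𝓝 0, 4 * e w.2 - 1 ≠ 0 :=
    eventually_snd (hdet.continuousAt.eventually_ne hd0)
  have hd := hdet.inv hd0
  have base : InTangent c g₁ g₂ e (fun w => w.1 0 ^ (0 + 1) * w.1 1 ^ (0 + 1)) := by
    have a1 := inTangent_x₂ (g₁ := g₁) (g₂ := g₂) (e := e) hc hc0 (smoothNear_const 1 0)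
    have a2 := (inTangent_quadratic (g₁ := g₁) (g₂ := g₂) (e := e) hc hc0 0 0 1).mul
      (h2.mul he).neg
    have a3 := (inTangent_quadratic (g₁ := g₁) (g₂ := g₂) (e := e) hc hc0 0 1 0).mul hg₂.neg
    refine ((a1.add a2).add a3).congr (Filter.Eventually.of_forall fun w => ?_)
    ring
  have stepR : ∀ i j : ℕ, InTangent c g₁ g₂ e (fun w => w.1 0 ^ (i + 1) * w.1 1 ^ (j + 1)) →
      InTangent c g₁ g₂ e (fun w => w.1 0 ^ (i + 1 + 1) * w.1 1 ^ (j + 1)) := by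
    intro i j h
    have a1 := (inTangent_x₁ (g₁ := g₁) (g₂ := g₂) (e := e) hc hc0
      ((hx.pow i).mul (hy.pow (j + 1)))).mul ((h2.mul he).mul hd)
    have a2 := (inTangent_x₂ (g₁ := g₁) (g₂ := g₂) (e := e) hc hc0
      ((hx.pow (i + 1)).mul (hy.pow j))).mul hd.neg
    have a3 := h.mul (((h2.mul he).mul hg₁).sub hg₂ |>.mul hd).neg
    refine ((a1.add a2).add a3).congr ?_
    filter_upwards [hne] with w hw
    linear_combination (-(w.1 0 ^ (i + 1 + 1) * w.1 1 ^ (j + 1))) * inv_mul_cancel₀ hw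
  have stepL : ∀ i j : ℕ, InTangent c g₁ g₂ e (fun w => w.1 0 ^ (i + 1) * w.1 1 ^ (j + 1)) →
      InTangent c g₁ g₂ e (fun w => w.1 0 ^ (i + 1) * w.1 1 ^ (j + 1 + 1)) := by
    intro i j h
    have a1 := (inTangent_x₁ (g₁ := g₁) (g₂ := g₂) (e := e) hc hc0
      ((hx.pow i).mul (hy.pow (j + 1)))).mul hd.neg
    have a2 := (inTangent_x₂ (g₁ := g₁) (g₂ := g₂) (e := e) hc hc0
      ((hx.pow (i + 1)).mul (hy.pow j))).mul (h2.mul hd)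
    have a3 := h.mul ((h2.mul hg₂).sub hg₁ |>.mul hd).neg
    refine ((a1.add a2).add a3).congr ?_
    filter_upwards [hne] with w hw
    field_simp
    ring
  induction i with
  | zero =>
    induction j with
    | zero => exact base
    | succ j ih => exact stepL 0 j ih
  | succ i ih => exact stepR i j ih

/-- A pure power comes from x₁^(i+1) times the first derivative, with leading coefficient 2, or from
x₂^(j+1) times the second, with leading coefficient 2e ≠ 0. The rest is a mixed monomial and a lower
power. -/
theorem inTangent_monomial (i j : ℕ) :
    InTangent c g₁ g₂ e (fun w => w.1 0 ^ i * w.1 1 ^ j) := by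
  have hx := smoothNear_coord 0 (0 : Cot)
  have hy := smoothNear_coord 1 (0 : Cot)
  obtain _ | i := i
  · induction j with
    | zero => exact (inTangent_base (smoothNear_const 1 0)).congr (by simp)
    | succ j ih =>
      obtain _ | j := j
      · exact (inTangent_quadratic hc hc0 0 1 0).congr
          (Filter.Eventually.of_forall fun w => by ring)
      have he' : e 0 ≠ 0 := by linarith
      have hi := (he.inv he').mul (smoothNear_const (1 / 2 : ℝ) 0)
      have a1 := (inTangent_x₂ (g₁ := g₁) (g₂ := g₂) (e := e) hc hc0 (hy.pow j)).mul hi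
      have a2 := (inTangent_mixed hc hc0 hg₁ hg₂ he he0 0 j).mul hi.neg
      have a3 := ih.mul (hg₂.mul hi).neg
      refine ((a1.add a2).add a3).congr ?_
      filter_upwards [eventually_snd (he.continuousAt.eventually_ne he')] with w hw
      field_simp
      ring
  · obtain _ | j := j
    · induction i with
      | zero =>
        exact (inTangent_quadratic hc hc0 1 0 0).congr
          (Filter.Eventually.of_forall fun w => by ring)
      | succ i ih =>
        have hi : SmoothNear (fun _ : Base => (1 / 2 : ℝ)) 0 := smoothNear_const _ 0
        have a1 := (inTangent_x₁ (g₁ := g₁) (g₂ := g₂) (e := e) hc hc0 (hx.pow i)).mul hi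
        have a2 := (inTangent_mixed hc hc0 hg₁ hg₂ he he0 i 0).mul hi.neg
        have a3 := ih.mul (hg₁.mul hi).neg
        refine ((a1.add a2).add a3).congr (Filter.Eventually.of_forall fun w => ?_)
        ring
    · exact inTangent_mixed hc hc0 hg₁ hg₂ he he0 i j

/-- In coordinates this is a finite sum of monomials in q with coefficients depending on Q. The
tangent space is a module over functions of Q, and anything divisible by q₃ is in it. As only
polynomials occur, no preparation theorem is needed. -/
theorem inTangent_multilinear {m : ℕ} (p : ContinuousMultilinearMap ℝ (fun _ : Fin m => Cot) ℝ) :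
    InTangent c g₁ g₂ e (fun w => p fun _ => w) := by
  let coord : Fin 3 ⊕ Fin 3 → Cot → ℝ := Sum.elim (fun i w => w.1 i) (fun i w => w.2 i)
  let basis : Fin 3 ⊕ Fin 3 → Cot := Sum.elim (fun i => (Pi.single i 1, 0))
    (fun i => (0, Pi.single i 1))
  have hw : ∀ w : Cot, w = ∑ k, coord k w • basis k := by
    intro w
    simp only [coord, basis, Fintype.sum_sum_type, Sum.elim_inl, Sum.elim_inr]
    refine Prod.ext (funext fun j => ?_) (funext fun j => ?_) <;>
      simp [Fin.sum_univ_three, Pi.single_apply] <;> fin_cases j <;> simp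
  have hp : ∀ w : Cot, (p fun _ => w) =
      ∑ r : Fin m → Fin 3 ⊕ Fin 3, (p fun i => basis (r i)) * ∏ i, coord (r i) w := by
    intro w
    conv_lhs => rw [hw w]
    rw [p.map_sum]
    refine Finset.sum_congr rfl fun r _ => ?_
    rw [p.map_smul_univ, smul_eq_mul, mul_comm]
  simp only [hp]
  refine InTangent.sum _ fun r _ => ?_
  suffices h : ∃ (i j k : ℕ) (W : Base → ℝ), SmoothNear W 0 ∧
      ∀ w : Cot, ∏ i, coord (r i) w = w.1 0 ^ i * w.1 1 ^ j * w.1 2 ^ k * W w.2 by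
    obtain ⟨i, j, k, W, hW, h⟩ := h
    simp only [h]
    have hW' := hW.mul (smoothNear_const (p fun i => basis (r i)) 0)
    obtain _ | k := k
    · refine ((inTangent_monomial hc hc0 hg₁ hg₂ he he0 i j).mul hW').congr
        (Filter.Eventually.of_forall fun w => ?_)
      ring
    · refine (inTangent_q₃ ((((smoothNear_coord 0 0).pow i).mul ((smoothNear_coord 1 0).pow j)).mul
        (((smoothNear_coord 2 0).pow k).mul hW'.comp_snd))).congr
        (Filter.Eventually.of_forall fun w => ?_)
      ring
  have : ∃ (i j k : ℕ) (W : Base → ℝ), SmoothNear W 0 ∧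
      ∀ w : Cot, (∏ i, coord (r i)) w = w.1 0 ^ i * w.1 1 ^ j * w.1 2 ^ k * W w.2 := by
    refine Finset.prod_induction (fun i => coord (r i)) (fun f : Cot → ℝ =>
      ∃ (i j k : ℕ) (W : Base → ℝ), SmoothNear W 0 ∧
        ∀ w : Cot, f w = w.1 0 ^ i * w.1 1 ^ j * w.1 2 ^ k * W w.2) ?_ ?_ ?_
    · rintro f f' ⟨i, j, k, W, hW, h⟩ ⟨i', j', k', W', hW', h'⟩
      refine ⟨i + i', j + j', k + k', _, hW.mul hW', fun w => ?_⟩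
      rw [Pi.mul_apply, h, h']
      ring
    · exact ⟨0, 0, 0, _, smoothNear_const 1 0, fun w => by simp⟩
    · intro i _
      rcases r i with k | k
      · fin_cases k
        · exact ⟨1, 0, 0, _, smoothNear_const 1 0, fun w => by simp [coord]⟩
        · exact ⟨0, 1, 0, _, smoothNear_const 1 0, fun w => by simp [coord]⟩
        · exact ⟨0, 0, 1, _, smoothNear_const 1 0, fun w => by simp [coord]⟩
      · exact ⟨0, 0, 0, _, smoothNear_pi.1 (smoothNear_id (0 : Base)) k, fun w => by simp [coord]⟩
  simpa only [Finset.prod_apply] using this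

theorem inTangent_potential {n : ℕ} (θ : potentialJets n) : InTangent c g₁ g₂ e (potential θ) := by
  have h : InTangent c g₁ g₂ e (fun w => ∑ m : Fin (n + 1),
      ((m : ℕ).factorial : ℝ)⁻¹ * (θ : Jets n Cot ℝ) m fun _ => w) :=
    InTangent.sum _ fun m _ => (inTangent_multilinear hc hc0 hg₁ hg₂ he he0 _).mul
      (smoothNear_const _ 0)
  exact h

end Unit

end Versality

/-! ### Openness of the normal forms -/

section Openness

/-- The expansion along the j-th axis says that the derivative at 0 sends the j-th unit vector to `β
j`. It is therefore onto, and a submersion is open. -/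
theorem map_nhds_eq_of_expansion {V : Type} [NormedAddCommGroup V] [NormedSpace ℝ V]
    [CompleteSpace V] {d : ℕ} (β : Module.Basis (Fin d) ℝ V) {Ψ : (Fin d → ℝ) → V}
    (hΨ : SmoothNear Ψ 0)
    (h : ∀ j, ∃ R : ℝ → V, ContinuousAt R 0 ∧
      ∀ s, Ψ (s • Pi.single j 1) = Ψ 0 + s • β j + s ^ 2 • R s) :
    Filter.map Ψ (𝓝 0) = 𝓝 (Ψ 0) := by
  refine (hΨ.contDiffAt.hasStrictFDerivAt (by simp)).map_nhds_eq_of_surj ?_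
  have key : ∀ j, fderiv ℝ Ψ 0 (Pi.single j 1) = β j := by
    intro j
    obtain ⟨R, hR, hj⟩ := h j
    have h1 : HasDerivAt (fun s : ℝ => Ψ (s • Pi.single j 1)) (fderiv ℝ Ψ 0 (Pi.single j 1)) 0 := by
      have hs : HasDerivAt (fun s : ℝ => s • (Pi.single j 1 : Fin d → ℝ)) (Pi.single j 1) 0 := by
        simpa using (hasDerivAt_id (0 : ℝ)).smul_const (Pi.single j 1 : Fin d → ℝ)
      have hd : HasFDerivAt Ψ (fderiv ℝ Ψ 0) ((0 : ℝ) • (Pi.single j 1 : Fin d → ℝ)) := by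
        rw [zero_smul]; exact hΨ.differentiableAt.hasFDerivAt
      exact hd.comp_hasDerivAt (0 : ℝ) hs
    have h2 : HasDerivAt (fun s : ℝ => Ψ (s • Pi.single j 1)) (β j) 0 := by
      rw [hasDerivAt_iff_tendsto_slope_zero]
      have ht : Filter.Tendsto (fun s : ℝ => β j + s • R s) (𝓝[≠] 0) (𝓝 (β j)) := by
        have hc : ContinuousAt (fun s : ℝ => β j + s • R s) 0 :=
          continuousAt_const.add (continuousAt_id.smul hR)
        have := hc.tendsto
        simp only [zero_smul, add_zero] at this
        exact this.mono_left nhdsWithin_le_nhds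
      refine ht.congr' ?_
      filter_upwards [self_mem_nhdsWithin] with s hs
      have hs' : s ≠ 0 := hs
      rw [zero_add, hj, zero_smul, add_assoc, add_sub_cancel_left, smul_add, smul_smul, smul_smul,
        inv_mul_cancel₀ hs', one_smul, pow_two, ← mul_assoc, inv_mul_cancel₀ hs', one_mul]
    exact h1.unique h2
  rw [eq_top_iff, ← β.span_eq, Submodule.span_le]
  rintro _ ⟨j, rfl⟩
  exact ⟨Pi.single j 1, key j⟩

/-- This is used to turn smooth maps into the space of all jets into smooth maps into
`potentialJets`, where surjectivity of a derivative can be asked for. -/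
theorem exists_projection {V : Type} [NormedAddCommGroup V] [NormedSpace ℝ V]
    [FiniteDimensional ℝ V] (p : Submodule ℝ V) :
    ∃ f : V → p, ContDiff ℝ ∞ f ∧ (∀ x : p, f x = x) ∧ (∀ x y, f (x + y) = f x + f y) ∧
      ∀ (r : ℝ) x, f (r • x) = r • f x := by
  obtain ⟨f, hf⟩ := Submodule.ClosedComplemented.of_finiteDimensional p
  exact ⟨f, f.contDiff, hf, map_add f, map_smul f⟩

/-- The data of a function `c(Q) F_a(x φ, g(Q)) + b(Q) + q₃ B(q, Q)`, where `e = a + g₃`. -/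
structure NormalData where
  (c b e g₁ g₂ : Base → ℝ)
  (φ₁ φ₂ B : Cot → ℝ)

namespace NormalData

/-- The function determined by the data. -/
def fn (D : NormalData) (w : Cot) : ℝ :=
  D.c w.2 * ((w.1 0 * D.φ₁ w) ^ 2 + (w.1 0 * D.φ₁ w) * (w.1 1 * D.φ₂ w) +
    D.e w.2 * (w.1 1 * D.φ₂ w) ^ 2 + D.g₁ w.2 * (w.1 0 * D.φ₁ w) +
    D.g₂ w.2 * (w.1 1 * D.φ₂ w)) + D.b w.2 + w.1 2 * D.B w

/-- The unfolding map `Q ↦ (g₁, g₂, e)`. -/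
def unfolding (D : NormalData) (Q : Base) : Base := ![D.g₁ Q, D.g₂ Q, D.e Q]

/-- The data consists of smooth germs. -/
structure Smooth (D : NormalData) : Prop where
  c : SmoothNear D.c 0
  b : SmoothNear D.b 0
  e : SmoothNear D.e 0
  g₁ : SmoothNear D.g₁ 0
  g₂ : SmoothNear D.g₂ 0
  φ₁ : SmoothNear D.φ₁ 0
  φ₂ : SmoothNear D.φ₂ 0
  B : SmoothNear D.B 0

/-- The data defines a function equivalent to some `F_a` with `a > 1/4`. -/
structure Good (D : NormalData) : Prop where
  smooth : D.Smooth
  c_ne : D.c 0 ≠ 0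
  e_gt : 1 / 4 < D.e 0
  g₁_zero : D.g₁ 0 = 0
  g₂_zero : D.g₂ 0 = 0
  φ₁_pos : 0 < D.φ₁ 0
  φ₂_pos : 0 < D.φ₂ 0
  bijective : Function.Bijective (fderiv ℝ D.unfolding 0)

theorem Smooth.unfolding {D : NormalData} (h : D.Smooth) : SmoothNear D.unfolding 0 := by
  refine smoothNear_pi.2 fun i => ?_
  fin_cases i
  exacts [h.g₁, h.g₂, h.e]

end NormalData

theorem fderiv_of_coord {α β B : Cot → ℝ} {b : Base → ℝ} {Q : Base} (hα : SmoothNear α (0, Q))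
    (hβ : SmoothNear β (0, Q)) (hB : SmoothNear B (0, Q)) (hb : SmoothNear b Q) (v : Cot) :
    fderiv ℝ (fun w : Cot => w.1 0 * α w + w.1 1 * β w + b w.2 + w.1 2 * B w) (0, Q) v =
      v.1 0 * α (0, Q) + v.1 1 * β (0, Q) + fderiv ℝ b Q v.2 + v.1 2 * B (0, Q) := by
  have hc : ∀ i : Fin 3, HasFDerivAt (fun w : Cot => w.1 i)
      ((ContinuousLinearMap.proj (R := ℝ) (φ := fun _ : Fin 3 => ℝ) i).comp
        (ContinuousLinearMap.fst ℝ Base Base)) (0, Q) :=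
    fun i => ((ContinuousLinearMap.proj (R := ℝ) (φ := fun _ : Fin 3 => ℝ) i).comp
      (ContinuousLinearMap.fst ℝ Base Base)).hasFDerivAt
  have h1 := (hc 0).mul hα.differentiableAt.hasFDerivAt
  have h2 := (hc 1).mul hβ.differentiableAt.hasFDerivAt
  have h3 := (hc 2).mul hB.differentiableAt.hasFDerivAt
  have h4 : HasFDerivAt (fun w : Cot => b w.2) ((fderiv ℝ b Q).comp
      (ContinuousLinearMap.snd ℝ Base Base)) (0, Q) :=
    HasFDerivAt.comp ((0, Q) : Cot) (g := b) (f := Prod.snd) hb.differentiableAt.hasFDerivAt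
      hasFDerivAt_snd
  have h5 := ((h1.add h2).add h4).add h3
  rw [show fderiv ℝ (fun w : Cot => w.1 0 * α w + w.1 1 * β w + b w.2 + w.1 2 * B w) (0, Q) = _ from
    h5.fderiv]
  simp
  ring

theorem fderiv_zero_of_coord {α β B : Cot → ℝ} {b : Base → ℝ} (hα : SmoothNear α 0)
    (hβ : SmoothNear β 0) (hB : SmoothNear B 0) (hb : SmoothNear b 0) (v : Cot) :
    fderiv ℝ (fun w : Cot => w.1 0 * α w + w.1 1 * β w + b w.2 + w.1 2 * B w) 0 v =
      v.1 0 * α 0 + v.1 1 * β 0 + fderiv ℝ b 0 v.2 + v.1 2 * B 0 :=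
  fderiv_of_coord hα hβ hB hb v

/-- A function of the form above that vanishes to second order. -/
theorem zero_of_fderiv_coord {α β B : Cot → ℝ} {b : Base → ℝ} (hα : SmoothNear α 0)
    (hβ : SmoothNear β 0) (hB : SmoothNear B 0) (hb : SmoothNear b 0) {H : Cot → ℝ} (h0 : H 0 = 0)
    (h1 : fderiv ℝ H 0 = 0)
    (hH : H =ᶠ[𝓝 0] fun w : Cot => w.1 0 * α w + w.1 1 * β w + b w.2 + w.1 2 * B w) :
    α 0 = 0 ∧ β 0 = 0 ∧ B 0 = 0 ∧ b 0 = 0 ∧ fderiv ℝ b 0 = 0 := by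
  have h := fderiv_zero_of_coord hα hβ hB hb
  rw [← hH.fderiv_eq, h1] at h
  refine ⟨?_, ?_, ?_, ?_, ?_⟩
  · simpa using (h (Pi.single 0 1, 0)).symm
  · simpa using (h (Pi.single 1 1, 0)).symm
  · simpa using (h (Pi.single 2 1, 0)).symm
  · have := hH.self_of_nhds
    rw [h0] at this
    simpa using this.symm
  · ext v : 1
    simpa using (h (0, v)).symm

/-- A family of functions that is affine in the parameters. -/
def affineFamily {E : Type} {d : ℕ} (f : E → ℝ) (v : Fin d → E → ℝ) (t : Fin d → ℝ) (x : E) : ℝ :=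
  f x + ∑ j, t j * v j x

section AffineFamily

variable {E : Type} {d : ℕ} {f : E → ℝ} {v : Fin d → E → ℝ}

theorem affineFamily_zero (x : E) : affineFamily f v 0 x = f x := by simp [affineFamily]

theorem affineFamily_single (s : ℝ) (j : Fin d) (x : E) :
    affineFamily f v (s • Pi.single j 1) x = f x + s * v j x := by
  simp [affineFamily, Pi.single_apply]

theorem affineFamily_eq_zero {x : E} (hf : f x = 0) (hv : ∀ j, v j x = 0) (t : Fin d → ℝ) :
    affineFamily f v t x = 0 := by simp [affineFamily, hf, hv]

variable [NormedAddCommGroup E] [NormedSpace ℝ E]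

theorem smoothNear_affineFamily {x : E} (hf : SmoothNear f x) (hv : ∀ j, SmoothNear (v j) x)
    (t : Fin d → ℝ) :
    SmoothNear (Function.uncurry (affineFamily f v)) (t, x) := by
  have h2 : ∀ {g : E → ℝ}, SmoothNear g x →
      SmoothNear (fun p : (Fin d → ℝ) × E => g p.2) (t, x) :=
    fun hg => hg.comp_of_eq (smoothNear_id _).snd rfl
  exact (h2 hf).add (SmoothNear.sum fun j _ =>
    (smoothNear_pi.1 (smoothNear_id (t, x)).fst j).mul (h2 (hv j)))

theorem SmoothNear.affineFamily {x : E} (hf : SmoothNear f x) (hv : ∀ j, SmoothNear (v j) x)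
    (t : Fin d → ℝ) : SmoothNear (affineFamily f v t) x :=
  hf.add (SmoothNear.sum fun j _ => (smoothNear_const (t j) x).mul (hv j))

theorem fderiv_affineFamily_eq_zero {x : E} (hf : SmoothNear f x) (hv : ∀ j, SmoothNear (v j) x)
    (hf0 : fderiv ℝ f x = 0) (hv0 : ∀ j, fderiv ℝ (v j) x = 0) (t : Fin d → ℝ) :
    fderiv ℝ (RetLag.affineFamily f v t) x = 0 := by
  have h : HasFDerivAt (RetLag.affineFamily f v t)
      (fderiv ℝ f x + ∑ j, t j • fderiv ℝ (v j) x) x := by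
    refine hf.differentiableAt.hasFDerivAt.add (HasFDerivAt.fun_sum fun j _ => ?_)
    exact (hv j).differentiableAt.hasFDerivAt.const_mul (t j)
  rw [h.fderiv]
  simp [hf0, hv0]

end AffineFamily

/-- The normal forms fill a neighbourhood of the jet of a normal form. -/
theorem NormalData.eventually_exists_good {D : NormalData} (hD : D.Good)
    (hφ₁ : D.φ₁ = fun _ => 1) (hφ₂ : D.φ₂ = fun _ => 1) (hP : IsPotential D.fn) {n : ℕ}
    (hn : 1 ≤ n) :
    ∀ᶠ θ : potentialJets n in 𝓝 (hP.toJet n), ∃ D' : NormalData, D'.Good ∧ IsPotential D'.fn ∧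
      jets n D'.fn = (θ : Jets n Cot ℝ) := by
  have sD := hD.smooth
  let β := Module.finBasis ℝ (potentialJets n)
  have hT : ∀ j, InTangent D.c D.g₁ D.g₂ D.e (potential (β j)) := fun j =>
    inTangent_potential sD.c hD.c_ne sD.g₁ sD.g₂ sD.e hD.e_gt _
  choose ξ₁ ξ₂ B η₁ η₂ η₃ b hs he using hT
  choose s1 s2 s3 s4 s5 s6 s7 using hs
  -- There is one parameter for each basis vector of the jet space; the j-th one deforms the data
  -- along a solution of the infinitesimal equation for `β j`. The factor c can stay fixed.
  let N : (Fin (Module.finrank ℝ (potentialJets n)) → ℝ) → NormalData := fun t =>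
    { c := D.c
      b := affineFamily D.b b t
      e := affineFamily D.e η₃ t
      g₁ := affineFamily D.g₁ η₁ t
      g₂ := affineFamily D.g₂ η₂ t
      φ₁ := affineFamily D.φ₁ ξ₁ t
      φ₂ := affineFamily D.φ₂ ξ₂ t
      B := affineFamily D.B B t }
  have sN : ∀ t, (N t).Smooth := fun t => ⟨sD.c, sD.b.affineFamily s7 t, sD.e.affineFamily s6 t,
    sD.g₁.affineFamily s4 t, sD.g₂.affineFamily s5 t, sD.φ₁.affineFamily s1 t,
    sD.φ₂.affineFamily s2 t, sD.B.affineFamily s3 t⟩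
  have hN0 : N 0 = D := by
    simp only [N]
    congr 1 <;> exact funext fun x => affineFamily_zero x
  have hx : ∀ (i : Fin 3) (w : Cot), SmoothNear (fun w : Cot => w.1 i) w := smoothNear_coord
  have form : ∀ t, (N t).fn = fun w => w.1 0 * ((N t).c w.2 * (w.1 0 * (N t).φ₁ w ^ 2 +
      w.1 1 * (N t).φ₁ w * (N t).φ₂ w + (N t).g₁ w.2 * (N t).φ₁ w)) +
      w.1 1 * ((N t).c w.2 * ((N t).e w.2 * w.1 1 * (N t).φ₂ w ^ 2 + (N t).g₂ w.2 * (N t).φ₂ w)) +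
      (N t).b w.2 + w.1 2 * (N t).B w := by
    intro t
    funext w
    simp only [NormalData.fn]
    ring
  have sα : ∀ t, SmoothNear (fun w : Cot => (N t).c w.2 * (w.1 0 * (N t).φ₁ w ^ 2 +
      w.1 1 * (N t).φ₁ w * (N t).φ₂ w + (N t).g₁ w.2 * (N t).φ₁ w)) 0 := fun t =>
    (sN t).c.comp_snd.mul ((((hx 0 0).mul ((sN t).φ₁.pow 2)).add
      (((hx 1 0).mul (sN t).φ₁).mul (sN t).φ₂)).add ((sN t).g₁.comp_snd.mul (sN t).φ₁))
  have sβ : ∀ t, SmoothNear (fun w : Cot => (N t).c w.2 * ((N t).e w.2 * w.1 1 * (N t).φ₂ w ^ 2 +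
      (N t).g₂ w.2 * (N t).φ₂ w)) 0 := fun t =>
    (sN t).c.comp_snd.mul ((((sN t).e.comp_snd.mul (hx 1 0)).mul ((sN t).φ₂.pow 2)).add
      ((sN t).g₂.comp_snd.mul (sN t).φ₂))
  have zD := zero_of_fderiv_coord (sα 0) (sβ 0) (sN 0).B (sN 0).b (H := D.fn) hP.zero
    hP.fderiv_zero (by rw [← form 0, hN0])
  rw [hN0] at zD
  -- The potential of `β j` vanishes to second order, which forces these conditions and so keeps the
  -- deformed data normalised at 0. Nothing forces η₃(0) = 0: the modulus e(0) moves with t, hence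
  -- the union over all a.
  have zj : ∀ j, η₁ j 0 = 0 ∧ η₂ j 0 = 0 ∧ B j 0 = 0 ∧ b j 0 = 0 ∧ fderiv ℝ (b j) 0 = 0 := by
    intro j
    have sα' : SmoothNear (fun w : Cot => D.c w.2 * (ξ₁ j w * (2 * w.1 0 + w.1 1 + D.g₁ w.2) +
        η₁ j w.2)) 0 :=
      sD.c.comp_snd.mul (((s1 j).mul ((((smoothNear_const 2 0).mul (hx 0 0)).add (hx 1 0)).add
        sD.g₁.comp_snd)).add (s4 j).comp_snd)
    have sβ' : SmoothNear (fun w : Cot => D.c w.2 * (ξ₂ j w * (w.1 0 + 2 * D.e w.2 * w.1 1 +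
        D.g₂ w.2) + η₂ j w.2 + η₃ j w.2 * w.1 1)) 0 :=
      sD.c.comp_snd.mul ((((s2 j).mul (((hx 0 0).add (((smoothNear_const 2 0).mul
        sD.e.comp_snd).mul (hx 1 0))).add sD.g₂.comp_snd)).add (s5 j).comp_snd).add
        ((s6 j).comp_snd.mul (hx 1 0)))
    have := zero_of_fderiv_coord sα' sβ' (s3 j) (s7 j) (H := potential (β j)) (potential_zero _)
      (fderiv_potential_zero hn _) (by
        filter_upwards [he j] with w hw
        rw [hw]
        ring)
    simpa [hD.g₁_zero, hD.g₂_zero, hD.c_ne] using this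
  have jointly : ∀ {f : Cot → ℝ} {v : Fin (Module.finrank ℝ (potentialJets n)) → Cot → ℝ} t,
      SmoothNear f 0 → (∀ j, SmoothNear (v j) 0) →
      SmoothNear (fun p : (Fin (Module.finrank ℝ (potentialJets n)) → ℝ) × Cot =>
        affineFamily f v p.1 p.2) (t, 0) := fun t hf hv => smoothNear_affineFamily hf hv t
  have jointly' : ∀ {f : Base → ℝ} {v : Fin (Module.finrank ℝ (potentialJets n)) → Base → ℝ} t,
      SmoothNear f 0 → (∀ j, SmoothNear (v j) 0) →
      SmoothNear (fun p : (Fin (Module.finrank ℝ (potentialJets n)) → ℝ) × Cot =>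
        affineFamily f v p.1 p.2.2) (t, 0) := fun t hf hv =>
    (smoothNear_affineFamily hf hv t).comp_of_eq (f := fun p :
      (Fin (Module.finrank ℝ (potentialJets n)) → ℝ) × Cot => (p.1, p.2.2))
      ((smoothNear_id _).fst.prodMk (smoothNear_id _).snd.snd) rfl
  have hxp : ∀ (i : Fin 3) (t : Fin (Module.finrank ℝ (potentialJets n)) → ℝ),
      SmoothNear (fun p : (Fin (Module.finrank ℝ (potentialJets n)) → ℝ) × Cot => p.2.1 i) (t, 0) :=
    fun i t => smoothNear_pi.1 (smoothNear_id _).snd.fst i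
  have hG : SmoothNear (Function.uncurry fun t => (N t).fn) (0, 0) := by
    have hcp : SmoothNear (fun p : (Fin (Module.finrank ℝ (potentialJets n)) → ℝ) × Cot =>
      D.c p.2.2) (0, 0) := sD.c.comp_of_eq (smoothNear_id _).snd.snd rfl
    have u1 := (hxp 0 0).mul (jointly 0 sD.φ₁ s1)
    have u2 := (hxp 1 0).mul (jointly 0 sD.φ₂ s2)
    exact ((hcp.mul (((((u1.pow 2).add (u1.mul u2)).add ((jointly' 0 sD.e s6).mul (u2.pow 2))).add
      ((jointly' 0 sD.g₁ s4).mul u1)).add ((jointly' 0 sD.g₂ s5).mul u2))).add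
      (jointly' 0 sD.b s7)).add ((hxp 2 0).mul (jointly 0 sD.B s3))
  have sfn : ∀ t, SmoothNear (N t).fn 0 := fun t => by
    rw [form t]
    exact ((((hx 0 0).mul (sα t)).add ((hx 1 0).mul (sβ t))).add (sN t).b.comp_snd).add
      ((hx 2 0).mul (sN t).B)
  have hgood : ∀ᶠ t in 𝓝 0, (N t).Good := by
    have c1 := (smoothNear_affineFamily sD.e s6 0).left.continuousAt
    have c2 := (smoothNear_affineFamily sD.φ₁ s1 0).left.continuousAt
    have c3 := (smoothNear_affineFamily sD.φ₂ s2 0).left.continuousAt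
    have c4 : SmoothNear (Function.uncurry fun t => (N t).unfolding) (0, 0) := by
      refine smoothNear_pi.2 fun i => ?_
      fin_cases i
      exacts [smoothNear_affineFamily sD.g₁ s4 0, smoothNear_affineFamily sD.g₂ s5 0,
        smoothNear_affineFamily sD.e s6 0]
    have c5 := c4.partial_fderiv.left.continuousAt
    have v1 : 1 / 4 < affineFamily D.e η₃ 0 0 := hD.e_gt.trans_eq (affineFamily_zero _).symm
    have v2 : 0 < affineFamily D.φ₁ ξ₁ 0 0 := hD.φ₁_pos.trans_eq (affineFamily_zero _).symm
    have v3 : 0 < affineFamily D.φ₂ ξ₂ 0 0 := hD.φ₂_pos.trans_eq (affineFamily_zero _).symm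
    filter_upwards [c1.eventually_const_lt v1, c2.eventually_const_lt v2,
      c3.eventually_const_lt v3,
      eventually_bijective c5 (by rw [hN0]; exact hD.bijective)] with t h1 h2 h3 h4
    exact ⟨sN t, hD.c_ne, h1, affineFamily_eq_zero hD.g₁_zero (fun j => (zj j).1) t,
      affineFamily_eq_zero hD.g₂_zero (fun j => (zj j).2.1) t, h2, h3, h4⟩
  have hpot : ∀ᶠ t in 𝓝 0, IsPotential (N t).fn := by
    have c : SmoothNear (Function.uncurry fun t w => initialPoint (N t).fn w) (0, 0) :=
      (smoothNear_id _).snd.fst.prodMk (hG.partial_fderiv.clm grad).fst.neg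
    filter_upwards [eventually_bijective c.partial_fderiv.left.continuousAt
      (by rw [hN0]; exact hP.bijective)] with t ht
    refine ⟨sfn t, ?_, ?_, ht⟩
    · have : (N t).b 0 = 0 := affineFamily_eq_zero zD.2.2.2.1 (fun j => (zj j).2.2.2.1) t
      simp [NormalData.fn, this]
    · refine ContinuousLinearMap.ext fun v => ?_
      have h1 : (N t).b = affineFamily D.b b t := rfl
      have h2 : (N t).g₁ 0 = 0 := affineFamily_eq_zero hD.g₁_zero (fun j => (zj j).1) t
      have h3 : (N t).g₂ 0 = 0 := affineFamily_eq_zero hD.g₂_zero (fun j => (zj j).2.1) t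
      have h4 : (N t).B 0 = 0 := affineFamily_eq_zero zD.2.2.1 (fun j => (zj j).2.2.1) t
      rw [form t, fderiv_zero_of_coord (sα t) (sβ t) (sN t).B (sN t).b, h1,
        fderiv_affineFamily_eq_zero sD.b s7 zD.2.2.2.2 (fun j => (zj j).2.2.2.2)]
      simp [h2, h3, h4]
  obtain ⟨π, hπ, hπ1, hπ2, hπ3⟩ := exists_projection (V := Jets n Cot ℝ) (potentialJets n)
  let Ψ := fun t => π (jets n (N t).fn)
  have hΨ : SmoothNear Ψ 0 := (ContDiff.smoothNear hπ _).comp hG.jets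
  have hΨ0 : Ψ 0 = hP.toJet n := by
    have : jets n (N 0).fn = (hP.toJet n : Jets n Cot ℝ) := by rw [hN0]; rfl
    simp only [Ψ, this, hπ1]
  have hmap := map_nhds_eq_of_expansion β hΨ fun j => by
    -- In powers of s, the term of order one is the tangent vector `E`, which uses φ₁ = φ₂ = 1 in D.
    -- `R` collects the rest, divided by s².
    let R : ℝ → Cot → ℝ := fun s w => D.c w.2 * ((w.1 0 * ξ₁ j w) ^ 2 +
      (w.1 0 * ξ₁ j w) * (w.1 1 * ξ₂ j w) + (w.1 1) ^ 2 * (D.e w.2 * ξ₂ j w ^ 2 +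
      2 * (η₃ j w.2 * ξ₂ j w) + s * (η₃ j w.2 * ξ₂ j w ^ 2)) + w.1 0 * (η₁ j w.2 * ξ₁ j w) +
      w.1 1 * (η₂ j w.2 * ξ₂ j w))
    let E : Cot → ℝ := fun w =>
      D.c w.2 * (w.1 0 * ξ₁ j w * (2 * w.1 0 + w.1 1 + D.g₁ w.2) +
      w.1 1 * ξ₂ j w * (w.1 0 + 2 * D.e w.2 * w.1 1 + D.g₂ w.2) +
      (η₁ j w.2 * w.1 0 + η₂ j w.2 * w.1 1 + η₃ j w.2 * w.1 1 ^ 2)) + b j w.2 + w.1 2 * B j w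
    have hE : E =ᶠ[𝓝 0] potential (β j) := by
      filter_upwards [he j] with w hw
      rw [hw]
    have sE : SmoothNear E 0 := (smoothNear_potential (β j) 0).congr hE
    have sR : ∀ s, SmoothNear (Function.uncurry R) (s, 0) := by
      intro s
      have k1 : ∀ {f : Cot → ℝ}, SmoothNear f 0 → SmoothNear (fun p : ℝ × Cot => f p.2) (s, 0) :=
        fun hf => hf.comp_of_eq (smoothNear_id _).snd rfl
      have x0 := k1 (hx 0 0)
      have x1 := k1 (hx 1 0)
      have a1 := k1 (s1 j)
      have a2 := k1 (s2 j)
      have a4 := k1 (s4 j).comp_snd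
      have a5 := k1 (s5 j).comp_snd
      have a6 := k1 (s6 j).comp_snd
      exact (k1 sD.c.comp_snd).mul ((((((x0.mul a1).pow 2).add ((x0.mul a1).mul (x1.mul a2))).add
        ((x1.pow 2).mul ((((k1 sD.e.comp_snd).mul (a2.pow 2)).add
        ((smoothNear_const 2 _).mul (a6.mul a2))).add ((smoothNear_id _).fst.mul
        (a6.mul (a2.pow 2)))))).add (x0.mul (a4.mul a1))).add (x1.mul (a5.mul a2)))
    have sRs : ∀ s, SmoothNear (R s) 0 := fun s =>
      (sR s).comp_of_eq (f := fun w : Cot => (s, w))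
        ((smoothNear_const s 0).prodMk (smoothNear_id 0)) rfl
    refine ⟨fun s => π (jets n (R s)), ((ContDiff.smoothNear hπ _).comp (sR 0).jets).continuousAt,
      fun s => ?_⟩
    have hexp : (N (s • Pi.single j 1)).fn = fun w => ((N 0).fn w + s • E w) + (s ^ 2) • R s w := by
      funext w
      rw [hN0]
      simp only [NormalData.fn, N, affineFamily_single, hφ₁, hφ₂, E, R, smul_eq_mul]
      ring
    have hjE : jets n E = (β j : Jets n Cot ℝ) :=
      (jets_eq_iff.2 (JetEq.of_eventuallyEq hE)).trans (jets_potential _)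
    have sE' : SmoothNear (fun w => s • E w) 0 := (smoothNear_const s 0).mul sE
    have sR' : SmoothNear (fun w => s ^ 2 • R s w) 0 := (smoothNear_const (s ^ 2) 0).mul (sRs s)
    simp only [Ψ]
    rw [hexp, jets_add ((sfn 0).add sE') sR', jets_add (sfn 0) sE',
      jets_smul s sE, jets_smul (s ^ 2) (sRs s), hπ2, hπ2, hπ3, hπ3, hjE, hπ1]
  rw [← hΨ0, ← hmap, Filter.eventually_map]
  filter_upwards [hgood, hpot] with t h1 h2
  refine ⟨N t, h1, h2, ?_⟩
  have : π (jets n (N t).fn) = h2.toJet n := hπ1 (h2.toJet n)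
  simp only [Ψ, this]
  rfl

end Openness

/-! ### Generating families from generating functions -/

section GeneratingFamily

/-- The inclusion of the parameter space of a family without `y`-variables as `{q₃ = 0}`. -/
def embed : Par 0 →L[ℝ] Cot :=
  (ContinuousLinearMap.pi ![
    (ContinuousLinearMap.proj (R := ℝ) (φ := fun _ : Fin 2 => ℝ) 0).comp
      (ContinuousLinearMap.fst ℝ _ _),
    (ContinuousLinearMap.proj (R := ℝ) (φ := fun _ : Fin 2 => ℝ) 1).comp
      (ContinuousLinearMap.fst ℝ _ _), 0]).prod
    ((ContinuousLinearMap.snd ℝ _ _).comp (ContinuousLinearMap.snd ℝ _ _))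

theorem embed_fst_castSucc (z : Par 0) (i : Fin 2) : (embed z).1 i.castSucc = z.1 i := by
  fin_cases i <;> rfl

theorem embed_fst_two (z : Par 0) : (embed z).1 2 = 0 := rfl

theorem embed_snd (z : Par 0) : (embed z).2 = z.2.2 := rfl

theorem embed_eq {z : Par 0} {w : Cot} (h1 : ∀ i : Fin 2, z.1 i = w.1 i.castSucc)
    (h2 : w.1 2 = 0) (h3 : z.2.2 = w.2) : embed z = w := by
  refine Prod.ext (funext fun i => ?_) h3
  fin_cases i
  exacts [h1 0, h1 1, h2.symm]

variable {A : Cot → ℝ} {S : Cot → Cot}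

theorem fderiv_comp_embed {z : Par 0} (hA : DifferentiableAt ℝ A (embed z)) (v : Par 0) :
    fderiv ℝ (fun z => A (embed z)) z v = fderiv ℝ A (embed z) (embed v) := by
  rw [show fderiv ℝ (fun z => A (embed z)) z = _ from
    (hA.hasFDerivAt.comp z embed.hasFDerivAt).fderiv]
  rfl

theorem dx_comp_embed {z : Par 0} (hA : DifferentiableAt ℝ A (embed z)) (i : Fin 2) :
    dx (fun z => A (embed z)) i z = (grad (fderiv ℝ A (embed z))).1 i.castSucc := by
  rw [dx, fderiv_comp_embed hA, grad_fst]
  congr 1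
  refine embed_eq (fun j => ?_) ?_ rfl
  · simp [Pi.single_apply]
  · fin_cases i <;> simp

theorem dq_comp_embed {z : Par 0} (hA : DifferentiableAt ℝ A (embed z)) (m : Fin 3) :
    dq (fun z => A (embed z)) m z = (grad (fderiv ℝ A (embed z))).2 m := by
  rw [dq, fderiv_comp_embed hA, grad_snd, show embed (0, 0, Pi.single m 1) = (0, Pi.single m 1) from
    embed_eq (fun _ => rfl) rfl rfl]

theorem tendsto_embed : Filter.Tendsto embed (𝓝 0) (𝓝 0) := by
  simpa using embed.continuous.tendsto 0

/-- Up to sign, x and ∂F/∂x are components of `initialPoint A` on q₃ = 0. A preimage under its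
bijective derivative of a vector without q₃-component is tangent to q₃ = 0, which gives
surjectivity. -/
theorem IsPotential.nondegenerate (hA : IsPotential A) :
    Nondegenerate (fun z => A (embed z)) := by
  have hev : (fun z : Par 0 => (((z.1, fun i => dx (fun z => A (embed z)) i z,
      fun j => dy (fun z => A (embed z)) j z)) :
      (Fin 2 → ℝ) × (Fin 2 → ℝ) × (Fin 0 → ℝ))) =ᶠ[𝓝 0]
      fun z => (z.1, fun i : Fin 2 => (grad (fderiv ℝ A (embed z))).1 i.castSucc, 0) := by
    filter_upwards [tendsto_embed.eventually hA.smooth.eventually_differentiableAt] with z hz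
    refine Prod.ext rfl (Prod.ext (funext fun i => dx_comp_embed hz i) (Subsingleton.elim _ _))
  unfold Nondegenerate
  rw [hev.fderiv_eq]
  have h0 : embed 0 = 0 := map_zero _
  have hd : HasFDerivAt (fun z : Par 0 => grad (fderiv ℝ A (embed z)))
      (grad.comp ((fderiv ℝ (fderiv ℝ A) 0).comp embed)) 0 := by
    refine grad.hasFDerivAt.comp (0 : Par 0) (HasFDerivAt.comp (0 : Par 0) ?_ embed.hasFDerivAt)
    rw [h0]
    exact hA.smooth.fderiv.differentiableAt.hasFDerivAt
  have hd2 : HasFDerivAt (fun z : Par 0 =>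
      fun i : Fin 2 => (grad (fderiv ℝ A (embed z))).1 i.castSucc)
      (ContinuousLinearMap.pi fun i : Fin 2 =>
        (ContinuousLinearMap.proj (R := ℝ) (φ := fun _ : Fin 3 => ℝ) i.castSucc).comp
          ((ContinuousLinearMap.fst ℝ _ _).comp
            (grad.comp ((fderiv ℝ (fderiv ℝ A) 0).comp embed)))) 0 :=
    hasFDerivAt_pi.2 fun i => (ContinuousLinearMap.proj (R := ℝ) (φ := fun _ : Fin 3 => ℝ)
      i.castSucc).hasFDerivAt.comp (0 : Par 0) hd.fst
  have hd3 := (hasFDerivAt_fst (𝕜 := ℝ) (p := (0 : Par 0))).prodMk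
    (hd2.prodMk (hasFDerivAt_const (0 : Fin 0 → ℝ) (0 : Par 0)))
  rw [show fderiv ℝ (fun z : Par 0 => ((z.1, fun i : Fin 2 =>
    (grad (fderiv ℝ A (embed z))).1 i.castSucc, 0) :
      (Fin 2 → ℝ) × (Fin 2 → ℝ) × (Fin 0 → ℝ))) 0 = _ from hd3.fderiv]
  rintro ⟨a, b, c⟩
  obtain ⟨u, hu⟩ := hA.bijective.2 (![a 0, a 1, 0], ![-b 0, -b 1, 0])
  rw [fderiv_initialPoint hA.smooth] at hu
  have h1 : ∀ i, u.1 i = (![a 0, a 1, 0] : Fin 3 → ℝ) i := fun i => congrFun (congrArg Prod.fst hu) i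
  have h2 : ∀ i, -(grad (fderiv ℝ (fderiv ℝ A) 0 u)).1 i = (![-b 0, -b 1, 0] : Fin 3 → ℝ) i :=
    fun i => congrFun (congrArg Prod.snd hu) i
  refine ⟨(a, 0, u.2), ?_⟩
  have he : embed (a, 0, u.2) = u := by
    refine embed_eq (fun i => ?_) (h1 2) rfl
    fin_cases i
    exacts [(h1 0).symm, (h1 1).symm]
  refine Prod.ext rfl (Prod.ext (funext fun i => ?_) (Subsingleton.elim _ _))
  change (grad (fderiv ℝ (fderiv ℝ A) 0 (embed (a, 0, u.2)))).1 i.castSucc = b i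
  rw [he]
  fin_cases i
  · exact neg_injective (h2 0)
  · exact neg_injective (h2 1)

theorem initialPoint_embed_mem {z : Par 0} (hA : DifferentiableAt ℝ A (embed z))
    (σ : Finset (Fin 2)) :
    initialPoint A (embed z) ∈ L0 σ ↔ (∀ i ∈ σ, z.1 i = 0) ∧
      ∀ i ∉ σ, dx (fun z => A (embed z)) i z = 0 ∧ 0 ≤ z.1 i := by
  simp only [initialPoint, L0, Set.mem_ofPred_eq, embed_fst_castSucc, dx_comp_embed hA, embed_fst_two,
    Pi.neg_apply, neg_eq_zero, and_true]

/-- On q₃ = 0 the equation p_i = 0 of L⁰_σ reads ∂F/∂x_i = 0, and the image point is (Q, ∂F/∂Q). The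
coordinate p₃ is unrestricted on L⁰_σ, so ∂A/∂q₃ plays no role. -/
theorem IsGen.isGeneratingFamily (hA : IsPotential A) (hS : IsSymplecticGerm S)
    (h : IsGen A S) : IsGeneratingFamily (fun z => A (embed z)) S := by
  obtain ⟨κ, hκ, hκ0, -, hκ2⟩ := hA.exists_inverse
  obtain ⟨T, -, hT, -⟩ := hS.exists_inverse
  have tκ := tendsto_zero_of_smooth hκ hκ0
  refine ⟨hA.smooth.comp_of_eq (ContDiff.smoothNear embed.contDiff 0) (map_zero _), ?_, ?_,
    hA.nondegenerate, fun σ => ?_⟩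
  · simp only [map_zero, hA.zero]
  · refine ContinuousLinearMap.ext fun v => ?_
    rw [fderiv_comp_embed (by rw [map_zero]; exact hA.smooth.differentiableAt), map_zero,
      hA.fderiv_zero]
    rfl
  -- The third condition makes S injective on the points used, so a critical point lying over S z
  -- comes from z itself.
  refine ⟨{w | DifferentiableAt ℝ A (embed w) ∧ S (initialPoint A (embed w)) =
    finalPoint A (embed w) ∧ T (S (initialPoint A (embed w))) = initialPoint A (embed w)},
    ((tendsto_embed.eventually hA.smooth.eventually_differentiableAt).and
      ((tendsto_embed.eventually h).and
      ((hA.tendsto_initialPoint.comp tendsto_embed).eventually hT))), fun U hU hUU => ?_⟩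
  have val : ∀ w ∈ U, (((w.2.2, fun m => dq (fun z => A (embed z)) m w)) : Cot) =
      S (initialPoint A (embed w)) := by
    intro w hw
    obtain ⟨w1, w2, w3⟩ := hUU hw
    rw [w2]
    exact Prod.ext rfl (funext fun m => dq_comp_embed w1 m)
  have tU : Filter.Tendsto (fun z : Cot => (((fun i : Fin 2 => z.1 i.castSucc), (0, (κ z).2)) :
      Par 0)) (𝓝 0) (𝓝 0) := by
    refine tendsto_zero_of_smooth ((smoothNear_pi.2 fun i => smoothNear_coord _ _).prodMk
      ((smoothNear_const 0 0).prodMk hκ.snd)) ?_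
    simp only [hκ0]
    rfl
  filter_upwards [hT, hκ2, tU.eventually hU] with z h1 h2 h3
  constructor
  · rintro ⟨w, ⟨hw, hw1, hw2, -⟩, hwz⟩
    obtain ⟨w1, w2, w3⟩ := hUU hw
    have : z = initialPoint A (embed w) := by
      rw [← h1, ← hwz, ← w3]
      exact congrArg T (val w hw)
    rw [this, initialPoint_embed_mem w1]
    exact ⟨hw1, hw2⟩
  · intro hz
    have he : embed ((fun i : Fin 2 => z.1 i.castSucc), (0, (κ z).2)) = κ z := by
      have e1 : (initialPoint A (κ z)).1 = z.1 := by rw [h2]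
      change (κ z).1 = z.1 at e1
      exact embed_eq (fun i => by rw [e1]) (by rw [e1]; exact hz.2.2) rfl
    have hi := hz
    rw [← h2, ← he, initialPoint_embed_mem (hUU h3).1] at hi
    refine ⟨_, ⟨h3, hi.1, hi.2, fun j => j.elim0⟩, ?_⟩
    change (((((fun i : Fin 2 => z.1 i.castSucc), (0, (κ z).2)) : Par 0).2.2, fun m =>
      dq (fun z => A (embed z)) m ((fun i : Fin 2 => z.1 i.castSucc), (0, (κ z).2))) : Cot) = S z
    rw [val _ h3, he, h2]

/-- Reticular 𝒫-𝒞-equivalence with a given action on the parameters `q`. -/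
def PCEquivOver {k : ℕ} (F G : Par k → ℝ) (g : Base → Base) (a b : Base → ℝ) : Prop :=
  ∃ (φ₁ : Par k → Fin 2 → ℝ) (φ₂ : Par k → Fin k → ℝ) (Φ : Par k → Par k),
    SmoothGerm φ₁ ∧ SmoothGerm φ₂ ∧ SmoothGerm g ∧ SmoothGerm a ∧ SmoothGerm b ∧
    (∀ i, 0 < φ₁ 0 i) ∧ φ₂ 0 = 0 ∧ g 0 = 0 ∧ a 0 ≠ 0 ∧
    (∀ z, Φ z = (fun i => z.1 i * φ₁ z i, φ₂ z, g z.2.2)) ∧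
    Function.Bijective (fderiv ℝ Φ 0) ∧
    ∀ᶠ z in 𝓝 (0 : Par k), (∀ i, 0 ≤ z.1 i) → G z = a z.2.2 * F (Φ z) + b z.2.2

theorem pcEquiv_iff {k : ℕ} {F G : Par k → ℝ} : PCEquiv F G ↔ ∃ g a b, PCEquivOver F G g a b := by
  constructor
  · rintro ⟨φ₁, φ₂, φ₃, a, b, Φ, h⟩
    exact ⟨φ₃, a, b, φ₁, φ₂, Φ, h⟩
  · rintro ⟨φ₃, a, b, φ₁, φ₂, Φ, h⟩
    exact ⟨φ₁, φ₂, φ₃, a, b, Φ, h⟩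

/-- The term q₃B disappears on q₃ = 0, and splitting e into the constant e(0) and a function
vanishing at 0 separates the modulus from the change of the third parameter. -/
theorem NormalData.Good.pcEquivOver {D : NormalData} (hD : D.Good) :
    PCEquivOver (Fa (D.e 0)) (fun z => D.fn (embed z)) (fun Q => D.unfolding Q - ![0, 0, D.e 0])
      D.c D.b := by
  have sD := hD.smooth
  have se : SmoothNear embed 0 := ContDiff.smoothNear embed.contDiff 0
  have s1 : SmoothNear (fun z => D.φ₁ (embed z)) 0 := sD.φ₁.comp_of_eq se (map_zero _)
  have s2 : SmoothNear (fun z => D.φ₂ (embed z)) 0 := sD.φ₂.comp_of_eq se (map_zero _)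
  have sφ : SmoothNear (fun z : Par 0 => (![D.φ₁ (embed z), D.φ₂ (embed z)] : Fin 2 → ℝ)) 0 := by
    refine smoothNear_pi.2 fun i => ?_
    fin_cases i
    exacts [s1, s2]
  have sg : SmoothNear (fun Q => D.unfolding Q - ![0, 0, D.e 0]) 0 :=
    sD.unfolding.sub (smoothNear_const _ _)
  let Φ : Par 0 → Par 0 := fun z => (fun i => z.1 i *
    (![D.φ₁ (embed z), D.φ₂ (embed z)] : Fin 2 → ℝ) i, 0, D.unfolding z.2.2 - ![0, 0, D.e 0])
  refine ⟨fun z => ![D.φ₁ (embed z), D.φ₂ (embed z)], fun _ => 0, Φ, sφ, smoothNear_const _ _, sg, sD.c, sD.b,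
    ?_, rfl, ?_, hD.c_ne, fun _ => rfl, ?_, ?_⟩
  · simp [Fin.forall_fin_two, hD.φ₁_pos, hD.φ₂_pos]
  · funext i
    fin_cases i <;> simp [NormalData.unfolding, hD.g₁_zero, hD.g₂_zero]
  · have hd1 : ∀ i, HasFDerivAt (fun z : Par 0 => z.1 i)
        ((ContinuousLinearMap.proj (R := ℝ) (φ := fun _ : Fin 2 => ℝ) i).comp
        (ContinuousLinearMap.fst ℝ _ _)) 0 := fun i => by
      exact ((ContinuousLinearMap.proj (R := ℝ) (φ := fun _ : Fin 2 => ℝ) i).comp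
        (ContinuousLinearMap.fst ℝ _ ((Fin 0 → ℝ) × (Fin 3 → ℝ)))).hasFDerivAt
    have hd2 := fun i => (hd1 i).mul (smoothNear_pi.1 sφ i).differentiableAt.hasFDerivAt
    have hd3 : HasFDerivAt (fun z : Par 0 => D.unfolding z.2.2 - ![0, 0, D.e 0])
        ((fderiv ℝ D.unfolding 0).comp ((ContinuousLinearMap.snd ℝ _ _).comp
          (ContinuousLinearMap.snd ℝ _ _))) 0 :=
      (HasFDerivAt.comp (0 : Par 0) (g := D.unfolding)
        sD.unfolding.differentiableAt.hasFDerivAt ((ContinuousLinearMap.snd ℝ _ _).comp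
          (ContinuousLinearMap.snd ℝ _ _)).hasFDerivAt).sub_const _
    have hd4 := (hasFDerivAt_pi.2 hd2).prodMk
      ((hasFDerivAt_const (0 : Fin 0 → ℝ) (0 : Par 0)).prodMk hd3)
    rw [show fderiv ℝ Φ 0 = _ from hd4.fderiv]
    have hinj : ∀ {L : Par 0 →L[ℝ] Par 0}, Function.Injective L → Function.Bijective L :=
      fun {L} h => ⟨h, (LinearMap.injective_iff_surjective (f := (L : Par 0 →ₗ[ℝ] Par 0))).1 h⟩
    refine hinj ((injective_iff_map_eq_zero _).2 fun v hv => ?_)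
    have e1 : ∀ i, _ = (0 : ℝ) := fun i => congrFun (congrArg Prod.fst hv) i
    have e2 : fderiv ℝ D.unfolding 0 v.2.2 = 0 := congrArg (fun p => p.2.2) hv
    have e3 : v.2.2 = 0 := hD.bijective.1 (e2.trans (map_zero _).symm)
    refine Prod.ext (funext fun i => ?_) (Prod.ext (Subsingleton.elim _ _) e3)
    have e4 := e1 i
    simp at e4
    fin_cases i
    · simpa [hD.φ₁_pos.ne'] using e4
    · simpa [hD.φ₂_pos.ne'] using e4
  · refine Filter.Eventually.of_forall fun z _ => ?_
    simp only [Fa, NormalData.fn, Φ, NormalData.unfolding, show (embed z).1 0 = z.1 0 from rfl,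
      show (embed z).1 1 = z.1 1 from rfl, embed_fst_two, embed_snd]
    simp
    left
    ring

end GeneratingFamily

/-! ### Critical sets of generating families -/

section CriticalSet

variable {k : ℕ} {F : Par k → ℝ} {S T : Cot → Cot} {σ : Finset (Fin 2)}

/-- The set of points that parametrises `lagSet F σ`. -/
def critSet (F : Par k → ℝ) (σ : Finset (Fin 2)) : Set (Par k) :=
  {z | (∀ i ∈ σ, z.1 i = 0) ∧ (∀ i ∉ σ, dx F i z = 0 ∧ 0 ≤ z.1 i) ∧ ∀ j, dy F j z = 0}

/-- The map `(x, y, q) ↦ (q, ∂F/∂q)`. -/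
def lift (F : Par k → ℝ) (z : Par k) : Cot := (z.2.2, fun m => dq F m z)

theorem mem_lagSet {U : Set (Par k)} {c : Cot} :
    c ∈ lagSet F σ U ↔ ∃ z, (z ∈ U ∧ z ∈ critSet F σ) ∧ lift F z = c := Iff.rfl

theorem fderiv_apply_eq (F : Par k → ℝ) (z v : Par k) :
    fderiv ℝ F z v = ∑ i, v.1 i * dx F i z + ∑ j, v.2.1 j * dy F j z + ∑ m, v.2.2 m * dq F m z := by
  have single : ∀ {n : ℕ} (L : (Fin n → ℝ) →L[ℝ] ℝ) (u : Fin n → ℝ),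
      L u = ∑ i, u i * L (Pi.single i 1) := by
    intro n L u
    have : u = ∑ i, u i • (Pi.single i 1 : Fin n → ℝ) := by
      simp only [← Pi.single_smul', smul_eq_mul, mul_one, Finset.univ_sum_single]
    conv_lhs => rw [this]
    simp only [map_sum, map_smul, smul_eq_mul]
  have h1 : ∀ u : Fin 2 → ℝ, fderiv ℝ F z (u, 0, 0) = ∑ i, u i * dx F i z :=
    single ((fderiv ℝ F z).comp (ContinuousLinearMap.inl ℝ _ _))
  have h2 : ∀ u : Fin k → ℝ, fderiv ℝ F z (0, u, 0) = ∑ i, u i * dy F i z :=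
    single ((fderiv ℝ F z).comp ((ContinuousLinearMap.inr ℝ _ _).comp
      (ContinuousLinearMap.inl ℝ _ _)))
  have h3 : ∀ u : Fin 3 → ℝ, fderiv ℝ F z (0, 0, u) = ∑ i, u i * dq F i z :=
    single ((fderiv ℝ F z).comp ((ContinuousLinearMap.inr ℝ _ _).comp
      (ContinuousLinearMap.inr ℝ _ _)))
  rw [← h1, ← h2, ← h3, ← map_add, ← map_add]
  simp

theorem fderiv_apply_base (F : Par k → ℝ) (z : Par k) (u : Base) :
    fderiv ℝ F z (0, 0, u) = ∑ m, u m * (lift F z).2 m := by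
  rw [fderiv_apply_eq]
  simp [lift]

/-- A tangent vector along the fibre and along the face `x_σ = 0`. -/
def IsVertical (σ : Finset (Fin 2)) (v : Par k) : Prop := (∀ i ∈ σ, v.1 i = 0) ∧ v.2.2 = 0

/-- In this form, without partial derivatives, criticality can be carried along by the derivative of
an equivalence, which preserves vertical vectors. -/
theorem mem_critSet_iff {z : Par k} : z ∈ critSet F σ ↔
    (∀ i ∈ σ, z.1 i = 0) ∧ (∀ i, 0 ≤ z.1 i) ∧ ∀ v, IsVertical σ v → fderiv ℝ F z v = 0 := by
  constructor
  · rintro ⟨h1, h2, h3⟩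
    refine ⟨h1, fun i => ?_, fun v hv => ?_⟩
    · by_cases hi : i ∈ σ
      exacts [(h1 i hi).ge, (h2 i hi).2]
    · rw [fderiv_apply_eq, hv.2]
      have : ∀ i, v.1 i * dx F i z = 0 := fun i => by
        by_cases hi : i ∈ σ
        · rw [hv.1 i hi, zero_mul]
        · rw [(h2 i hi).1, mul_zero]
      simp [this, h3]
  · rintro ⟨h1, h2, h3⟩
    refine ⟨h1, fun i hi => ⟨h3 _ ⟨fun j hj => ?_, rfl⟩, h2 i⟩, fun j => h3 _ ⟨fun _ _ => rfl, rfl⟩⟩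
    exact Pi.single_eq_of_ne (fun e => hi (by rwa [← e])) _

theorem smoothNear_lift {z : Par k} (hF : SmoothNear F z) : SmoothNear (lift F) z :=
  (smoothNear_id z).snd.snd.prodMk (smoothNear_pi.2 fun _ => hF.fderiv.clm_apply
    (smoothNear_const _ z))

namespace IsGeneratingFamily

theorem smooth (h : IsGeneratingFamily F S) : SmoothNear F 0 := h.1

theorem tendsto_lift (h : IsGeneratingFamily F S) : Filter.Tendsto (lift F) (𝓝 0) (𝓝 0) := by
  refine tendsto_zero_of_smooth (smoothNear_lift h.smooth) ?_
  refine Prod.ext rfl (funext fun m => ?_)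
  change fderiv ℝ F 0 _ = 0
  rw [h.2.2.1]
  rfl

theorem mem_of_critSet (h : IsGeneratingFamily F S) (hT : Filter.Tendsto T (𝓝 0) (𝓝 0))
    (hTS : ∀ᶠ z in 𝓝 0, S (T z) = z) (σ : Finset (Fin 2)) :
    ∀ᶠ z in 𝓝 0, z ∈ critSet F σ → T (lift F z) ∈ L0 σ := by
  obtain ⟨U, hU, hUU⟩ := h.2.2.2.2 σ
  filter_upwards [h.tendsto_lift.eventually (hT.eventually (hUU U hU subset_rfl)),
    h.tendsto_lift.eventually hTS, hU] with z h1 h2 h3 hz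
  rw [← h1, h2]
  exact mem_lagSet.2 ⟨z, ⟨h3, hz⟩, rfl⟩

theorem exists_critSet (h : IsGeneratingFamily F S) (σ : Finset (Fin 2)) {U : Set (Par k)}
    (hU : U ∈ 𝓝 0) : ∀ᶠ ζ in 𝓝 0, ζ ∈ L0 σ → ∃ z ∈ U, z ∈ critSet F σ ∧ lift F z = S ζ := by
  obtain ⟨U₀, hU₀, hUU⟩ := h.2.2.2.2 σ
  filter_upwards [hUU (U ∩ U₀) (Filter.inter_mem hU hU₀) Set.inter_subset_right] with ζ h1 hζ
  obtain ⟨z, ⟨hz, hz'⟩, e⟩ := mem_lagSet.1 (h1.2 hζ)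
  exact ⟨z, hz.1, hz', e⟩

theorem exists_critSet_of_critSet {k' : ℕ} {F' : Par k' → ℝ} (hS : IsSymplecticGerm S)
    (h : IsGeneratingFamily F S) (h' : IsGeneratingFamily F' S) (σ : Finset (Fin 2))
    {U : Set (Par k')} (hU : U ∈ 𝓝 0) :
    ∀ᶠ z in 𝓝 0, z ∈ critSet F σ → ∃ w ∈ U, w ∈ critSet F' σ ∧ lift F' w = lift F z := by
  obtain ⟨T, hT, -, hTS⟩ := hS.exists_inverse
  filter_upwards [h.mem_of_critSet hT.tendsto hTS σ, h.tendsto_lift.eventually hTS,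
    h.tendsto_lift.eventually (hT.tendsto.eventually (h'.exists_critSet σ hU))] with z h1 h2 h3 hz
  simpa only [h2] using h3 (h1 hz)

end IsGeneratingFamily

end CriticalSet

/-! ### Critical values -/

section CriticalValue

theorem dx_Fa (a : ℝ) (z : Par 0) :
    dx (Fa a) 0 z = 2 * z.1 0 + z.1 1 + z.2.2 0 ∧
    dx (Fa a) 1 z = z.1 0 + 2 * (a + z.2.2 2) * z.1 1 + z.2.2 1 ∧
    dq (Fa a) 0 z = z.1 0 ∧ dq (Fa a) 1 z = z.1 1 ∧ dq (Fa a) 2 z = z.1 1 ^ 2 := by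
  have hx : ∀ i, HasFDerivAt (fun z : Par 0 => z.1 i)
      ((ContinuousLinearMap.proj (R := ℝ) (φ := fun _ : Fin 2 => ℝ) i).comp
      (ContinuousLinearMap.fst ℝ _ _)) z := fun i => by
    exact ((ContinuousLinearMap.proj (R := ℝ) (φ := fun _ : Fin 2 => ℝ) i).comp
      (ContinuousLinearMap.fst ℝ _ ((Fin 0 → ℝ) × (Fin 3 → ℝ)))).hasFDerivAt
  have hq : ∀ i, HasFDerivAt (fun z : Par 0 => z.2.2 i)
      ((ContinuousLinearMap.proj (R := ℝ) (φ := fun _ : Fin 3 => ℝ) i).comp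
      ((ContinuousLinearMap.snd ℝ _ _).comp (ContinuousLinearMap.snd ℝ _ _))) z := fun i => by
    exact ((ContinuousLinearMap.proj (R := ℝ) (φ := fun _ : Fin 3 => ℝ) i).comp
      ((ContinuousLinearMap.snd ℝ (Fin 0 → ℝ) (Fin 3 → ℝ)).comp
        (ContinuousLinearMap.snd ℝ (Fin 2 → ℝ) _))).hasFDerivAt
  have h := (((((hx 0).pow 2).add ((hx 0).mul (hx 1))).add (((hx 1).pow 2).const_mul a)).add
    ((hq 0).mul (hx 0))).add ((hq 1).mul (hx 1)) |>.add ((hq 2).mul ((hx 1).pow 2))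
  simp only [dx, dq]
  rw [show fderiv ℝ (Fa a) z = _ from h.fderiv]
  refine ⟨?_, ?_, ?_, ?_, ?_⟩ <;> simp
  ring

/-- The relations satisfied by the points of the Lagrangian set of `F_a`. -/
theorem lift_Fa_relations {a : ℝ} {σ : Finset (Fin 2)} {z : Par 0} (hz : z ∈ critSet (Fa a) σ)
    {c : Cot} (hc : lift (Fa a) z = c) :
    (∀ i ∈ σ, c.2 i.castSucc = 0) ∧ (0 ∉ σ → 2 * c.2 0 + c.2 1 + c.1 0 = 0) ∧
      (1 ∉ σ → c.2 0 + 2 * (a + c.1 2) * c.2 1 + c.1 1 = 0) ∧ c.2 2 = c.2 1 ^ 2 := by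
  subst hc
  obtain ⟨h1, h2, h3, h4, h5⟩ := dx_Fa a z
  have e0 : (lift (Fa a) z).2 0 = z.1 0 := h3
  have e1 : (lift (Fa a) z).2 1 = z.1 1 := h4
  have e2 : (lift (Fa a) z).2 2 = z.1 1 ^ 2 := h5
  refine ⟨fun i hi => ?_, fun h => ?_, fun h => ?_, by rw [e1, e2]⟩
  · have := hz.1 i hi
    fin_cases i
    exacts [e0.trans this, e1.trans this]
  · rw [e0, e1, ← (hz.2.1 0 h).1, h1]; rfl
  · rw [e0, e1, ← (hz.2.1 1 h).1, h2]; rfl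

/-- The functions x, ∂F/∂x, ∂F/∂y have a surjective derivative at 0, so a linear projection onto its
kernel completes them to coordinates. In these, each critical set is a cone cut out by linear
equations and the inequalities x_i ≥ 0. -/
theorem Nondegenerate.exists_chart {k : ℕ} {F : Par k → ℝ} (hF : SmoothNear F 0)
    (hF1 : fderiv ℝ F 0 = 0) (hN : Nondegenerate F) :
    ∃ (K : Type) (_ : NormedAddCommGroup K) (_ : NormedSpace ℝ K)
      (Ξ : Par k → ((Fin 2 → ℝ) × (Fin 2 → ℝ) × (Fin k → ℝ)) × K)
      (Λ : ((Fin 2 → ℝ) × (Fin 2 → ℝ) × (Fin k → ℝ)) × K → Par k),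
      SmoothNear Ξ 0 ∧ Ξ 0 = 0 ∧ SmoothNear Λ 0 ∧ Λ 0 = 0 ∧ (∀ᶠ z in 𝓝 0, Λ (Ξ z) = z) ∧
      (∀ᶠ y in 𝓝 0, Ξ (Λ y) = y) ∧
      ∀ z, (Ξ z).1 = (z.1, fun i => dx F i z, fun j => dy F j z) := by
  let N : Par k → (Fin 2 → ℝ) × (Fin 2 → ℝ) × (Fin k → ℝ) :=
    fun z => (z.1, fun i => dx F i z, fun j => dy F j z)
  have hNs : SmoothNear N 0 := (smoothNear_id _).fst.prodMk
    ((smoothNear_pi.2 fun _ => hF.fderiv.clm_apply (smoothNear_const _ _)).prodMk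
      (smoothNear_pi.2 fun _ => hF.fderiv.clm_apply (smoothNear_const _ _)))
  let K := LinearMap.ker (fderiv ℝ N 0).toLinearMap
  obtain ⟨π, hπ⟩ := Submodule.ClosedComplemented.of_finiteDimensional K
  let Ξ : Par k → ((Fin 2 → ℝ) × (Fin 2 → ℝ) × (Fin k → ℝ)) × K := fun z => (N z, π z)
  have hΞ : SmoothNear Ξ 0 := hNs.prodMk (ContDiff.smoothNear π.contDiff 0)
  have hΞ0 : Ξ 0 = 0 := by
    refine Prod.ext (Prod.ext rfl (Prod.ext (funext fun i => ?_) (funext fun i => ?_)))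
      (map_zero π)
    · change fderiv ℝ F 0 _ = 0
      rw [hF1]; rfl
    · change fderiv ℝ F 0 _ = 0
      rw [hF1]; rfl
  have hd : fderiv ℝ Ξ 0 = (fderiv ℝ N 0).prod π :=
    (hNs.differentiableAt.hasFDerivAt.prodMk π.hasFDerivAt).fderiv
  have hb : Function.Bijective (fderiv ℝ Ξ 0) := by
    rw [hd]
    constructor
    · refine (injective_iff_map_eq_zero _).2 fun v hv => ?_
      have h1 : fderiv ℝ N 0 v = 0 := congrArg Prod.fst hv
      have h2 : π v = 0 := congrArg Prod.snd hv
      have h3 := hπ ⟨v, h1⟩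
      rw [h2] at h3
      exact (congrArg Subtype.val h3).symm
    · rintro ⟨y, κ⟩
      obtain ⟨v, hv⟩ := hN y
      change fderiv ℝ N 0 v = y at hv
      refine ⟨v - (π v : Par k) + κ, Prod.ext ?_ ?_⟩
      · change fderiv ℝ N 0 _ = y
        have e1 : fderiv ℝ N 0 (π v : Par k) = 0 := (π v).2
        have e2 : fderiv ℝ N 0 (κ : Par k) = 0 := κ.2
        rw [map_add, map_sub, hv, e1, e2, sub_zero, add_zero]
      · change π _ = κ
        rw [map_add, map_sub, hπ, hπ, sub_self, zero_add]
  obtain ⟨Λ, h1, h2, h3, h4⟩ := hΞ.exists_inverse hb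
  rw [hΞ0] at h1 h2 h4
  exact ⟨K, inferInstance, inferInstance, Ξ, Λ, hΞ, hΞ0, h1, h2, h3, h4, fun _ => rfl⟩

/-- On its critical sets, a generating family of the map generated by `F_a` takes the value
`(q₁p₁ + q₂p₂) / 2`. -/
theorem IsGeneratingFamily.critical_value {k : ℕ} {F : Par k → ℝ} {S : Cot → Cot} {a : ℝ}
    (hS : IsSymplecticGerm S) (h : IsGeneratingFamily F S) (ha : IsGeneratingFamily (Fa a) S)
    (σ : Finset (Fin 2)) :
    ∀ᶠ z in 𝓝 0, z ∈ critSet F σ →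
      F z = ((lift F z).1 0 * (lift F z).2 0 + (lift F z).1 1 * (lift F z).2 1) / 2 := by
  obtain ⟨K, _, _, Ξ, Λ, hΞ, hΞ0, hΛ, hΛ0, h1, h2, h3⟩ :=
    Nondegenerate.exists_chart h.smooth h.2.2.1 h.2.2.2.1
  have tΛ := tendsto_zero_of_smooth hΛ hΛ0
  have tΞ := tendsto_zero_of_smooth hΞ hΞ0
  obtain ⟨ε, hε, hball⟩ := Metric.eventually_nhds_iff_ball.1 ((hΛ.eventually.and h2).and
    ((tΛ.eventually h.smooth.eventually).and
    (tΛ.eventually (h.exists_critSet_of_critSet hS ha σ Filter.univ_mem))))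
  filter_upwards [h1, tΞ.eventually (Metric.ball_mem_nhds 0 hε)] with z hz1 hz2 hz
  have hmem : ∀ t ∈ Set.Icc (0 : ℝ) 1, t • Ξ z ∈ Metric.ball (0 : (_ × _) × K) ε := by
    intro t ht
    rw [mem_ball_zero_iff]
    rw [dist_zero_right] at hz2
    rw [norm_smul, Real.norm_of_nonneg ht.1]
    exact (mul_le_of_le_one_left (norm_nonneg _) ht.2).trans_lt hz2
  -- The segment from 0 to z, in coordinates where the critical set is a cone, stays critical.
  let γ : ℝ → Par k := fun t => Λ (t • Ξ z)
  have hγN : ∀ t ∈ Set.Icc (0 : ℝ) 1, ((γ t).1, (fun i => dx F i (γ t)), fun j => dy F j (γ t)) =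
      t • (z.1, (fun i => dx F i z), fun j => dy F j z) := by
    intro t ht
    rw [← h3, ← h3, (hball _ (hmem t ht)).1.2]
    rfl
  have hγx : ∀ t ∈ Set.Icc (0 : ℝ) 1, (γ t).1 = t • z.1 := fun t ht =>
    congrArg Prod.fst (hγN t ht)
  have hcrit : ∀ t ∈ Set.Icc (0 : ℝ) 1, γ t ∈ critSet F σ := by
    intro t ht
    have e1 := hγx t ht
    have e2 : ∀ i, dx F i (γ t) = t * dx F i z := fun i =>
      congrFun (congrArg (fun p => p.2.1) (hγN t ht)) i
    have e3 : ∀ i, dy F i (γ t) = t * dy F i z := fun i =>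
      congrFun (congrArg (fun p => p.2.2) (hγN t ht)) i
    refine ⟨fun i hi => ?_, fun i hi => ⟨?_, ?_⟩, fun j => ?_⟩
    · rw [e1, Pi.smul_apply, hz.1 i hi, smul_zero]
    · rw [e2, (hz.2.1 i hi).1, mul_zero]
    · rw [e1]; exact mul_nonneg ht.1 (hz.2.1 i hi).2
    · rw [e3, hz.2.2, mul_zero]
  have hrel : ∀ t ∈ Set.Icc (0 : ℝ) 1, (∀ i ∈ σ, (lift F (γ t)).2 i.castSucc = 0) ∧
      (0 ∉ σ → 2 * (lift F (γ t)).2 0 + (lift F (γ t)).2 1 + (lift F (γ t)).1 0 = 0) ∧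
      (1 ∉ σ → (lift F (γ t)).2 0 + 2 * (a + (lift F (γ t)).1 2) * (lift F (γ t)).2 1 +
        (lift F (γ t)).1 1 = 0) ∧ (lift F (γ t)).2 2 = (lift F (γ t)).2 1 ^ 2 := by
    intro t ht
    obtain ⟨w, -, hw, hw'⟩ := (hball _ (hmem t ht)).2.2 (hcrit t ht)
    exact lift_Fa_relations hw hw'
  have hγd : ∀ t ∈ Set.Icc (0 : ℝ) 1, DifferentiableAt ℝ γ t := by
    intro t ht
    have e1 := (hball _ (hmem t ht)).1.1.differentiableAt
    exact DifferentiableAt.comp t (g := Λ) (f := fun t : ℝ => t • Ξ z) e1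
      ((differentiableAt_id).smul_const (Ξ z))
  have hFd : ∀ t ∈ Set.Icc (0 : ℝ) 1, SmoothNear F (γ t) := fun t ht => (hball _ (hmem t ht)).2.1
  have hcd : ∀ t ∈ Set.Icc (0 : ℝ) 1, DifferentiableAt ℝ (fun t => lift F (γ t)) t := fun t ht =>
    DifferentiableAt.comp t (smoothNear_lift (hFd t ht)).differentiableAt (hγd t ht)
  have hq : ∀ t ∈ Set.Icc (0 : ℝ) 1, ∀ i,
      DifferentiableAt ℝ (fun t => (lift F (γ t)).1 i) t := fun t ht i =>
    differentiableAt_pi.1 (hcd t ht).fst i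
  have hp : ∀ t ∈ Set.Icc (0 : ℝ) 1, ∀ i,
      DifferentiableAt ℝ (fun t => (lift F (γ t)).2 i) t := fun t ht i =>
    differentiableAt_pi.1 (hcd t ht).snd i
  -- Along γ one has dF = Σ p_m dq_m. The points of γ also lie on the Lagrangian set of F_a, whose
  -- equations show that (q₁p₁ + q₂p₂)/2 has the same derivative. So f is constant, with f(0) = 0.
  let f : ℝ → ℝ := fun t => F (γ t) - ((lift F (γ t)).1 0 * (lift F (γ t)).2 0 +
    (lift F (γ t)).1 1 * (lift F (γ t)).2 1) / 2
  have hfd : ∀ t ∈ Set.Icc (0 : ℝ) 1, DifferentiableAt ℝ f t := fun t ht =>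
    (DifferentiableAt.comp t (hFd t ht).differentiableAt (hγd t ht)).sub
      ((((hq t ht 0).mul (hp t ht 0)).add ((hq t ht 1).mul (hp t ht 1))).div_const 2)
  have hf' : ∀ t ∈ Set.Ioo (0 : ℝ) 1, HasDerivAt f 0 t := by
    intro t ht
    have ht' := Set.Ioo_subset_Icc_self ht
    have hnear : ∀ᶠ s in 𝓝 t, s ∈ Set.Icc (0 : ℝ) 1 := Icc_mem_nhds ht.1 ht.2
    have dq' := fun i => (hq t ht' i).hasDerivAt
    have dp' := fun i => (hp t ht' i).hasDerivAt
    set q' := fun i => deriv (fun t => (lift F (γ t)).1 i) t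
    set p' := fun i => deriv (fun t => (lift F (γ t)).2 i) t
    set q := (lift F (γ t)).1 with hqd
    set p := (lift F (γ t)).2 with hpd
    obtain ⟨r1, r2, r3, r4⟩ := hrel t ht'
    -- For each i, either p_i or the i-th critical equation of F_a vanishes identically near t. This
    -- combination vanishes in both cases, so no distinction by σ remains.
    have z0 : p 0 * (2 * p' 0 + p' 1 + q' 0) - p' 0 * (2 * p 0 + p 1 + q 0) = 0 := by
      by_cases hσ : 0 ∈ σ
      · have e1 : p 0 = 0 := r1 0 hσ
        have e2 : p' 0 = 0 := by
          refine (dp' 0).unique ((hasDerivAt_const t (0 : ℝ)).congr_of_eventuallyEq ?_)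
          filter_upwards [hnear] with s hs using (hrel s hs).1 0 hσ
        rw [e1, e2]; ring
      · have e1 := r2 hσ
        have e2 : 2 * p' 0 + p' 1 + q' 0 = 0 := by
          refine ((((dp' 0).const_mul 2).add (dp' 1)).add (dq' 0)).unique
            ((hasDerivAt_const t (0 : ℝ)).congr_of_eventuallyEq ?_)
          filter_upwards [hnear] with s hs using (hrel s hs).2.1 hσ
        rw [e1, e2]; ring
    have z1 : p 1 * (p' 0 + (2 * q' 2 * p 1 + 2 * (a + q 2) * p' 1) + q' 1) -
        p' 1 * (p 0 + 2 * (a + q 2) * p 1 + q 1) = 0 := by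
      by_cases hσ : 1 ∈ σ
      · have e1 : p 1 = 0 := r1 1 hσ
        have e2 : p' 1 = 0 := by
          refine (dp' 1).unique ((hasDerivAt_const t (0 : ℝ)).congr_of_eventuallyEq ?_)
          filter_upwards [hnear] with s hs using (hrel s hs).1 1 hσ
        rw [e1, e2]; ring
      · have e1 := r3 hσ
        have e2 : p' 0 + (2 * q' 2 * p 1 + 2 * (a + q 2) * p' 1) + q' 1 = 0 := by
          refine (((dp' 0).add ((((dq' 2).const_add a).const_mul 2).mul (dp' 1))).add
            (dq' 1)).unique ((hasDerivAt_const t (0 : ℝ)).congr_of_eventuallyEq ?_)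
          filter_upwards [hnear] with s hs using (hrel s hs).2.2.1 hσ
        rw [e1, e2]; ring
    -- Removing the q-part of the velocity of γ leaves a vertical vector, which dF kills at a
    -- critical point.
    have hFt : HasDerivAt (fun t => F (γ t)) (∑ m, q' m * p m) t := by
      have e1 := (hFd t ht').differentiableAt.hasFDerivAt.comp_hasDerivAt t (hγd t ht').hasDerivAt
      have e2 : ∀ i ∈ σ, (deriv γ t).1 i = 0 := by
        intro i hi
        have e3 := hasDerivAt_pi.1 (hγd t ht').hasDerivAt.fst i
        refine e3.unique ((hasDerivAt_const t (0 : ℝ)).congr_of_eventuallyEq ?_)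
        filter_upwards [hnear] with s hs using (hcrit s hs).1 i hi
      have e4 : ∀ i, (deriv γ t).2.2 i = q' i := fun i =>
        (hasDerivAt_pi.1 (hγd t ht').hasDerivAt.snd.snd i).unique (dq' i)
      have e5 := (mem_critSet_iff.1 (hcrit t ht')).2.2 (deriv γ t - (0, 0, (deriv γ t).2.2))
        ⟨fun i hi => by simpa using e2 i hi, by simp⟩
      rw [map_sub, sub_eq_zero, fderiv_apply_base] at e5
      simp only [e4] at e5
      rwa [e5] at e1
    have hft := hFt.sub ((((dq' 0).mul (dp' 0)).add ((dq' 1).mul (dp' 1))).div_const 2)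
    refine hft.congr_deriv ?_
    simp only [Fin.sum_univ_three]
    rw [show p 2 = p 1 ^ 2 from r4]
    linear_combination (z0 + z1) / 2
  obtain ⟨c, hc, hc'⟩ := exists_hasDerivAt_eq_slope f (fun _ => 0) zero_lt_one
    (fun t ht => (hfd t ht).continuousAt.continuousWithinAt) hf'
  have e0 : f 0 = 0 := by
    have : γ 0 = 0 := by simp only [γ, zero_smul, hΛ0]
    simp only [f, this, h.2.1]
    simp [lift]
  have e1 : f 1 = 0 := by
    rw [e0] at hc'
    simpa using hc'.symm
  have e2 : γ 1 = z := by simp only [γ, one_smul, hz1]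
  simp only [f, e2] at e1
  exact sub_eq_zero.1 e1

end CriticalValue

/-! ### Equivalent generating families -/

section Transport

variable {k : ℕ} {F G : Par k → ℝ} {g : Base → Base} {a b : Base → ℝ}

/-- The effect of an equivalence on Lagrangian points, where `t` is the value of the family. -/
def transport (g : Base → Base) (a b : Base → ℝ) (Q : Base) (t : ℝ) (p : Base) : Cot :=
  (Q, fun m => fderiv ℝ a Q (Pi.single m 1) * t +
    a Q * ∑ j, fderiv ℝ g Q (Pi.single m 1) j * p j + fderiv ℝ b Q (Pi.single m 1))

/-- An equivalence is an identity on the corner only. Unique differentiability allows it to be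
differentiated at boundary points as well. -/
theorem uniqueDiffOn_corner : UniqueDiffOn ℝ {z : Par k | ∀ i, 0 ≤ z.1 i} := by
  have : {z : Par k | ∀ i, 0 ≤ z.1 i} =
      (Set.pi Set.univ fun _ : Fin 2 => Set.Ici (0 : ℝ)) ×ˢ Set.univ := by
    ext z
    simp [Pi.le_def]
  rw [this]
  exact (UniqueDiffOn.univ_pi fun _ => uniqueDiffOn_Ici 0).prod uniqueDiffOn_univ

theorem hasFDerivAt_params (z : Par k) : HasFDerivAt (fun z : Par k => z.2.2)
    ((ContinuousLinearMap.snd ℝ _ _).comp (ContinuousLinearMap.snd ℝ _ _)) z := by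
  exact ((ContinuousLinearMap.snd ℝ (Fin k → ℝ) (Fin 3 → ℝ)).comp
    (ContinuousLinearMap.snd ℝ (Fin 2 → ℝ) ((Fin k → ℝ) × (Fin 3 → ℝ)))).hasFDerivAt

theorem PCEquivOver.bijective (h : PCEquivOver F G g a b) : Function.Bijective (fderiv ℝ g 0) := by
  obtain ⟨φ₁, φ₂, Φ, h1, h2, h3, -, -, h4, h5, h6, -, h7, h8, -⟩ := h
  have hs : SmoothNear Φ 0 := by
    rw [show Φ = _ from funext h7]
    exact (smoothNear_pi.2 fun i => (smoothNear_pi.1 (smoothNear_id _).fst i).mul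
      (smoothNear_pi.1 h1 i)).prodMk (SmoothNear.prodMk h2
        (SmoothNear.comp_of_eq h3 (smoothNear_id _).snd.snd rfl))
  have hd : ∀ v, (fderiv ℝ Φ 0 v).2.2 = fderiv ℝ g 0 v.2.2 := by
    intro v
    have e1 := hs.differentiableAt.hasFDerivAt.snd.snd
    have e2 : HasFDerivAt (fun z : Par k => g z.2.2) ((fderiv ℝ g 0).comp
        ((ContinuousLinearMap.snd ℝ _ _).comp (ContinuousLinearMap.snd ℝ _ _))) 0 :=
      HasFDerivAt.comp (0 : Par k) (g := g) (SmoothNear.differentiableAt h3).hasFDerivAt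
        (hasFDerivAt_params 0)
    have e3 : (fun z : Par k => (Φ z).2.2) = fun z => g z.2.2 := funext fun z => by rw [h7]
    rw [e3] at e1
    exact DFunLike.congr_fun (e1.unique e2) v
  have hsurj : Function.Surjective (fderiv ℝ g 0) := by
    intro y
    obtain ⟨v, hv⟩ := h8.2 (0, 0, y)
    exact ⟨v.2.2, by rw [← hd, hv]⟩
  exact ⟨(LinearMap.injective_iff_surjective (f := (fderiv ℝ g 0 : Base →ₗ[ℝ] Base))).2 hsurj,
    hsurj⟩

/-- The identity G = a · F ∘ Φ + b is differentiated. At points of the face x_σ = 0, DΦ preserves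
the vertical vectors, so critical points correspond. At such a point dF sees only the q-part of DΦ,
that is Dg, so ∂G/∂q depends on F through its value and its Lagrangian point alone. -/
theorem PCEquivOver.exists_map (h : PCEquivOver F G g a b) (hF : SmoothNear F 0)
    (hG : SmoothNear G 0) :
    ∃ Φ : Par k → Par k, SmoothNear Φ 0 ∧ Φ 0 = 0 ∧ Function.Bijective (fderiv ℝ Φ 0) ∧
      (∀ z, (Φ z).2.2 = g z.2.2) ∧ ∀ σ, ∀ᶠ z in 𝓝 0, (z ∈ critSet G σ ↔ Φ z ∈ critSet F σ) ∧
        (z ∈ critSet G σ → lift G z = transport g a b z.2.2 (F (Φ z)) (lift F (Φ z)).2) := by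
  have hgb := h.bijective
  obtain ⟨φ₁, φ₂, Φ, h1, h2, h3, ha, hb, h4, h5, h6, ha0, h7, h8, h9⟩ := h
  have hs : SmoothNear Φ 0 := by
    rw [show Φ = _ from funext h7]
    exact (smoothNear_pi.2 fun i => (smoothNear_pi.1 (smoothNear_id _).fst i).mul
      (smoothNear_pi.1 h1 i)).prodMk (SmoothNear.prodMk h2
        (SmoothNear.comp_of_eq h3 (smoothNear_id _).snd.snd rfl))
  have hΦ0 : Φ 0 = 0 := by
    rw [h7]
    exact Prod.ext (funext fun i => zero_mul _) (Prod.ext h5 h6)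
  have tΦ := tendsto_zero_of_smooth hs hΦ0
  have tq : Filter.Tendsto (fun z : Par k => z.2.2) (𝓝 0) (𝓝 0) :=
    tendsto_zero_of_smooth (smoothNear_id _).snd.snd rfl
  refine ⟨Φ, hs, hΦ0, h8, fun z => by rw [h7], fun σ => ?_⟩
  have hpos : ∀ᶠ z in 𝓝 (0 : Par k), ∀ i, 0 < φ₁ z i := Filter.eventually_all.2 fun i =>
    (smoothNear_pi.1 h1 i).continuousAt.eventually_const_lt (h4 i)
  have ha1 := ((SmoothNear.continuousAt ha).eventually_ne ha0)
  filter_upwards [hpos, h9.eventually_nhds, hG.eventually_differentiableAt,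
    tΦ.eventually hF.eventually_differentiableAt, hs.eventually_differentiableAt,
    tq.eventually (SmoothNear.eventually_differentiableAt h3),
    tq.eventually (SmoothNear.eventually_differentiableAt ha),
    tq.eventually (SmoothNear.eventually_differentiableAt hb),
    SmoothNear.eventually_differentiableAt h1, tq.eventually ha1,
    eventually_bijective hs.fderiv.continuousAt h8,
    tq.eventually (eventually_bijective (SmoothNear.fderiv h3).continuousAt hgb)]
    with z k1 k2 k3 k4 k5 k6 k7 k8 k9 k10 k11 k12
  have hq := hasFDerivAt_params z
  have hx : ∀ i, 0 ≤ (Φ z).1 i ↔ 0 ≤ z.1 i := fun i => by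
    rw [h7]
    exact mul_nonneg_iff_of_pos_right (k1 i)
  have hx0 : ∀ i, (Φ z).1 i = 0 ↔ z.1 i = 0 := fun i => by
    rw [h7]
    exact mul_eq_zero_iff_right (k1 i).ne'
  have hDq : ∀ v, (fderiv ℝ Φ z v).2.2 = fderiv ℝ g z.2.2 v.2.2 := by
    intro v
    have e1 := k5.hasFDerivAt.snd.snd
    have e2 := HasFDerivAt.comp z (g := g) k6.hasFDerivAt hq
    have e3 : (fun z : Par k => (Φ z).2.2) = g ∘ fun z => z.2.2 := funext fun z => by rw [h7]; rfl
    rw [e3] at e1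
    exact DFunLike.congr_fun (e1.unique e2) v
  have hDx : ∀ i, z.1 i = 0 → ∀ v, (fderiv ℝ Φ z v).1 i = v.1 i * φ₁ z i := by
    intro i hi v
    have e1 := hasFDerivAt_pi'.1 k5.hasFDerivAt.fst i
    have e2 : HasFDerivAt (fun z : Par k => z.1 i)
        ((ContinuousLinearMap.proj (R := ℝ) (φ := fun _ : Fin 2 => ℝ) i).comp
        (ContinuousLinearMap.fst ℝ _ _)) z := by
      exact ((ContinuousLinearMap.proj (R := ℝ) (φ := fun _ : Fin 2 => ℝ) i).comp
        (ContinuousLinearMap.fst ℝ _ ((Fin k → ℝ) × (Fin 3 → ℝ)))).hasFDerivAt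
    have e3 := e2.mul (hasFDerivAt_pi'.1 k9.hasFDerivAt i)
    have e4 : (fun z : Par k => (Φ z).1 i) = fun z => z.1 i * φ₁ z i :=
      funext fun z => by rw [h7]
    rw [e4] at e1
    refine (DFunLike.congr_fun (e1.unique e3) v).trans ?_
    simp [hi, mul_comm]
  have hD : (∀ i, 0 ≤ z.1 i) → ∀ v, fderiv ℝ G z v = fderiv ℝ a z.2.2 v.2.2 * F (Φ z) +
      a z.2.2 * fderiv ℝ F (Φ z) (fderiv ℝ Φ z v) + fderiv ℝ b z.2.2 v.2.2 := by
    intro hz v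
    have e1 : HasFDerivAt (fun z : Par k => a z.2.2 * F (Φ z) + b z.2.2) _ z :=
      ((HasFDerivAt.comp z (g := a) k7.hasFDerivAt hq).mul
        (HasFDerivAt.comp z k4.hasFDerivAt k5.hasFDerivAt)).add
        (HasFDerivAt.comp z (g := b) k8.hasFDerivAt hq)
    have e2 := (uniqueDiffOn_corner (k := k)) z hz
    have e3 : G =ᶠ[𝓝[{z : Par k | ∀ i, 0 ≤ z.1 i}] z] fun z => a z.2.2 * F (Φ z) + b z.2.2 := by
      filter_upwards [nhdsWithin_le_nhds k2, self_mem_nhdsWithin] with w w1 w2 using w1 w2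
    have e4 := e3.fderivWithin_eq (𝕜 := ℝ) (k2.self_of_nhds hz)
    rw [k3.fderivWithin e2, e1.differentiableAt.fderivWithin e2, e1.fderiv] at e4
    rw [e4]
    simp
    ring
  have hDv : (∀ i ∈ σ, z.1 i = 0) → ∀ v, IsVertical σ (fderiv ℝ Φ z v) ↔ IsVertical σ v := by
    intro c1 v
    refine and_congr (forall₂_congr fun i hi => ?_) ?_
    · rw [hDx i (c1 i hi), mul_eq_zero_iff_right (k1 i).ne']
    · rw [hDq, map_eq_zero_iff _ k12.1]
  have hiff : z ∈ critSet G σ ↔ Φ z ∈ critSet F σ := by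
    rw [mem_critSet_iff, mem_critSet_iff]
    simp only [hx, hx0]
    refine and_congr_right fun c1 => and_congr_right fun c2 => ?_
    constructor
    · intro c v hv
      obtain ⟨v, rfl⟩ := k11.2 v
      have hv' := (hDv c1 v).1 hv
      have := c v hv'
      rw [hD c2, hv'.2] at this
      simpa [k10] using this
    · intro c v hv
      rw [hD c2, hv.2, c _ ((hDv c1 v).2 hv)]
      simp
  refine ⟨hiff, fun hz => Prod.ext rfl (funext fun m => ?_)⟩
  have c1 := (mem_critSet_iff.1 hz).1
  have c2 := (mem_critSet_iff.1 hz).2.1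
  have c3 := (mem_critSet_iff.1 (hiff.1 hz)).2.2
  change fderiv ℝ G z (0, 0, Pi.single m 1) = _
  have e := c3 (fderiv ℝ Φ z (0, 0, Pi.single m 1) -
    (0, 0, fderiv ℝ g z.2.2 (Pi.single m 1))) ⟨fun i hi => by
      simp [hDx i (c1 i hi)], by simp [hDq]⟩
  rw [map_sub, sub_eq_zero, fderiv_apply_base] at e
  rw [hD c2, e]
  rfl

end Transport

/-- Equivalent generating families, with the same action on the parameters, generate the same
Lagrangian sets. -/
theorem eventually_mem_L0_of_pcEquivOver {k k' : ℕ} {F G : Par k → ℝ} {F' G' : Par k' → ℝ}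
    {S R R' T' : Cot → Cot} {α : ℝ} {g : Base → Base} {a b : Base → ℝ} (hS : IsSymplecticGerm S)
    (hα : IsGeneratingFamily (Fa α) S) (hF : IsGeneratingFamily F S)
    (hF' : IsGeneratingFamily F' S) (hG : IsGeneratingFamily G R)
    (hG' : IsGeneratingFamily G' R') (h : PCEquivOver F G g a b) (h' : PCEquivOver F' G' g a b)
    (hT' : Filter.Tendsto T' (𝓝 0) (𝓝 0)) (hRT : ∀ᶠ z in 𝓝 0, R' (T' z) = z)
    (σ : Finset (Fin 2)) : ∀ᶠ ζ in 𝓝 0, ζ ∈ L0 σ → T' (R ζ) ∈ L0 σ := by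
  obtain ⟨Φ, sΦ, Φ0, -, Φq, hΦ⟩ := h.exists_map hF.smooth hG.smooth
  obtain ⟨Φ', sΦ', Φ0', bΦ', Φq', hΦ'⟩ := h'.exists_map hF'.smooth hG'.smooth
  obtain ⟨χ, sχ, χ0, -, hχ⟩ := sΦ'.exists_inverse bΦ'
  rw [Φ0'] at sχ χ0 hχ
  have sg : SmoothNear g 0 := h.choose_spec.choose_spec.choose_spec.2.2.1
  have g0 : g 0 = 0 := h.choose_spec.choose_spec.choose_spec.2.2.2.2.2.2.2.1
  obtain ⟨γ, -, -, hγ, -⟩ := sg.exists_inverse h.bijective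
  have tΦ := tendsto_zero_of_smooth sΦ Φ0
  have tχ := tendsto_zero_of_smooth sχ χ0
  have tq : ∀ {n}, Filter.Tendsto (fun z : Par n => z.2.2) (𝓝 0) (𝓝 0) := fun {_} =>
    tendsto_zero_of_smooth (smoothNear_id _).snd.snd rfl
  have hW : ∀ᶠ w in 𝓝 0, Φ' (χ w) = w ∧ γ (g (χ w).2.2) = (χ w).2.2 ∧
      (w ∈ critSet F' σ → F' w = ((lift F' w).1 0 * (lift F' w).2 0 +
        (lift F' w).1 1 * (lift F' w).2 1) / 2) ∧
      ((χ w ∈ critSet G' σ ↔ Φ' (χ w) ∈ critSet F' σ) ∧ (χ w ∈ critSet G' σ → lift G' (χ w) =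
        transport g a b (χ w).2.2 (F' (Φ' (χ w))) (lift F' (Φ' (χ w))).2)) ∧
      (χ w ∈ critSet G' σ → T' (lift G' (χ w)) ∈ L0 σ) :=
    hχ.and ((tχ.eventually (tq.eventually hγ)).and ((hF'.critical_value hS hα σ).and
      ((tχ.eventually (hΦ' σ)).and (tχ.eventually (hG'.mem_of_critSet hT' hRT σ)))))
  have hZ : ∀ᶠ z in 𝓝 0, γ (g z.2.2) = z.2.2 ∧
      (Φ z ∈ critSet F σ → F (Φ z) = ((lift F (Φ z)).1 0 * (lift F (Φ z)).2 0 +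
        (lift F (Φ z)).1 1 * (lift F (Φ z)).2 1) / 2) ∧
      ((z ∈ critSet G σ ↔ Φ z ∈ critSet F σ) ∧ (z ∈ critSet G σ → lift G z =
        transport g a b z.2.2 (F (Φ z)) (lift F (Φ z)).2)) ∧
      (Φ z ∈ critSet F σ → ∃ w ∈ {w | _}, w ∈ critSet F' σ ∧ lift F' w = lift F (Φ z)) :=
    (tq.eventually hγ).and ((tΦ.eventually (hF.critical_value hS hα σ)).and ((hΦ σ).and
      (tΦ.eventually (hF.exists_critSet_of_critSet hS hF' σ hW))))
  -- The point R ζ lifts to a critical z of G, and Φ z is critical for F. Some critical w of F' has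
  -- the same Lagrangian point as Φ z, and χ w is critical for G'. By the formula for critical
  -- values F(Φ z) = F'(w), so `transport` yields the same point for z and for χ w.
  filter_upwards [hG.exists_critSet σ hZ] with ζ h1 hζ
  obtain ⟨z, ⟨z1, z2, ⟨z3, z4⟩, z5⟩, z6, z7⟩ := h1 hζ
  obtain ⟨w, ⟨w1, w2, w3, ⟨w4, w5⟩, w6⟩, w7, w8⟩ := z5 (z3.1 z6)
  have hcG : χ w ∈ critSet G' σ := w4.2 (w1.symm ▸ w7)
  have hval : F' w = F (Φ z) := by rw [w3 w7, z2 (z3.1 z6), w8]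
  have hq : (χ w).2.2 = z.2.2 := by
    have e : w.2.2 = (Φ z).2.2 := congrArg Prod.fst w8
    rw [Φq, ← w1, Φq'] at e
    rw [← w2, e, z1]
  have := w6 hcG
  rwa [w5 hcG, w1, hval, w8, hq, ← z4 z6, z7] at this

/-! ### Reduction to normal forms -/

section NormalForm

/-- The data of `c(Q) F_a(q₁, q₂, g(Q)) + b(Q) + q₃ c(Q) g₃(Q)`. -/
def NormalData.ofEquiv (a : ℝ) (g : Base → Base) (c b : Base → ℝ) : NormalData where
  c := c
  b := b
  e := fun Q => a + g Q 2
  g₁ := fun Q => g Q 0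
  g₂ := fun Q => g Q 1
  φ₁ := fun _ => 1
  φ₂ := fun _ => 1
  B := fun w => c w.2 * g w.2 2

variable {a : ℝ} {g : Base → Base} {c b : Base → ℝ}

theorem NormalData.unfolding_ofEquiv (Q : Base) :
    (NormalData.ofEquiv a g c b).unfolding Q = g Q + ![0, 0, a] := by
  funext i
  fin_cases i <;> simp [NormalData.unfolding, NormalData.ofEquiv, add_comm]

theorem NormalData.good_ofEquiv (ha : 1 / 4 < a) (hg : SmoothNear g 0) (hc : SmoothNear c 0)
    (hb : SmoothNear b 0) (hg0 : g 0 = 0) (hc0 : c 0 ≠ 0)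
    (hbij : Function.Bijective (fderiv ℝ g 0)) : (NormalData.ofEquiv a g c b).Good where
  smooth :=
    { c := hc
      b := hb
      e := (smoothNear_const a 0).add (smoothNear_pi.1 hg 2)
      g₁ := smoothNear_pi.1 hg 0
      g₂ := smoothNear_pi.1 hg 1
      φ₁ := smoothNear_const 1 0
      φ₂ := smoothNear_const 1 0
      B := hc.comp_snd.mul (smoothNear_pi.1 hg 2).comp_snd }
  c_ne := hc0
  e_gt := by simpa [NormalData.ofEquiv, hg0] using ha
  g₁_zero := by simp [NormalData.ofEquiv, hg0]
  g₂_zero := by simp [NormalData.ofEquiv, hg0]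
  φ₁_pos := one_pos
  φ₂_pos := one_pos
  bijective := by
    rw [funext (NormalData.unfolding_ofEquiv (a := a) (g := g) (c := c) (b := b)),
      fderiv_add_const]
    exact hbij

/-- The choice B = c g₃ makes -∂A/∂q equal to -c(Q) g(Q) in all three components along q = 0. The
mixed Hessian is then, up to sign, c(0) Dg(0), which is invertible. -/
theorem NormalData.isPotential_ofEquiv (hg : SmoothNear g 0) (hc : SmoothNear c 0)
    (hb : SmoothNear b 0) (hg0 : g 0 = 0) (hc0 : c 0 ≠ 0) (hb0 : b 0 = 0)
    (hb1 : fderiv ℝ b 0 = 0) (hbij : Function.Bijective (fderiv ℝ g 0)) :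
    IsPotential (NormalData.ofEquiv a g c b).fn := by
  set A := (NormalData.ofEquiv a g c b).fn with hA
  have form : A = fun w => w.1 0 * (c w.2 * (w.1 0 + w.1 1 + g w.2 0)) +
      w.1 1 * (c w.2 * ((a + g w.2 2) * w.1 1 + g w.2 1)) + b w.2 + w.1 2 * (c w.2 * g w.2 2) := by
    funext w
    simp only [hA, NormalData.fn, NormalData.ofEquiv]
    ring
  have hg' := smoothNear_pi.1 hg
  have hx : ∀ (i : Fin 3) (w : Cot), SmoothNear (fun w : Cot => w.1 i) w := smoothNear_coord
  have sα : SmoothNear (fun w : Cot => c w.2 * (w.1 0 + w.1 1 + g w.2 0)) 0 :=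
    hc.comp_snd.mul (((hx 0 0).add (hx 1 0)).add (hg' 0).comp_snd)
  have sβ : SmoothNear (fun w : Cot => c w.2 * ((a + g w.2 2) * w.1 1 + g w.2 1)) 0 :=
    hc.comp_snd.mul ((((smoothNear_const a 0).add (hg' 2).comp_snd).mul (hx 1 0)).add
      (hg' 1).comp_snd)
  have sB : SmoothNear (fun w : Cot => c w.2 * g w.2 2) 0 := hc.comp_snd.mul (hg' 2).comp_snd
  have sA : SmoothNear A 0 := by
    rw [form]
    exact ((((hx 0 0).mul sα).add ((hx 1 0).mul sβ)).add hb.comp_snd).add ((hx 2 0).mul sB)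
  refine ⟨sA, by simp [form, hb0], ?_, ?_⟩
  · refine ContinuousLinearMap.ext fun v => ?_
    rw [form, fderiv_zero_of_coord sα sβ sB hb, hb1]
    simp [hg0]
  · have hinr : Filter.Tendsto (fun Q : Base => ((0, Q) : Cot)) (𝓝 0) (𝓝 0) :=
      tendsto_zero_of_smooth ((smoothNear_const 0 0).prodMk (smoothNear_id 0)) rfl
    have hslice : (fun Q : Base => initialPoint A (0, Q)) =ᶠ[𝓝 0]
        fun Q => ((0, -(c Q • g Q)) : Cot) := by
      filter_upwards [hinr.eventually sα.eventually, hinr.eventually sβ.eventually,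
        hinr.eventually sB.eventually, hb.eventually] with Q h1 h2 h3 h4
      refine Prod.ext rfl (congrArg Neg.neg (funext fun i => ?_))
      rw [grad_fst, form, fderiv_of_coord h1 h2 h3 h4]
      fin_cases i <;> simp
    have hd : ∀ u : Base, fderiv ℝ (initialPoint A) 0 (0, u) = (0, -(c 0 • fderiv ℝ g 0 u)) := by
      intro u
      have e1 : HasFDerivAt (fun Q : Base => initialPoint A (0, Q))
          ((fderiv ℝ (initialPoint A) 0).comp (ContinuousLinearMap.inr ℝ Base Base)) 0 :=
        HasFDerivAt.comp (0 : Base) (g := initialPoint A)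
          (f := ContinuousLinearMap.inr ℝ Base Base)
          (smoothNear_initialPoint sA).differentiableAt.hasFDerivAt
          (ContinuousLinearMap.inr ℝ Base Base).hasFDerivAt
      have e2 := (hasFDerivAt_const (0 : Base) (0 : Base)).prodMk
        (hc.differentiableAt.hasFDerivAt.smul hg.differentiableAt.hasFDerivAt).neg
      have e3 := DFunLike.congr_fun (e1.unique (e2.congr_of_eventuallyEq hslice)) u
      refine e3.trans (Prod.ext rfl ?_)
      simp [hg0]
    have hinj : Function.Injective (fderiv ℝ (initialPoint A) 0) := by
      refine (injective_iff_map_eq_zero _).2 fun u hu => ?_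
      have h1 : u.1 = 0 := by
        have := congrArg Prod.fst hu
        rwa [fderiv_initialPoint sA] at this
      have h2 : u = (0, u.2) := Prod.ext h1 rfl
      rw [h2, hd] at hu
      have h3 : c 0 • fderiv ℝ g 0 u.2 = 0 := neg_eq_zero.1 (congrArg Prod.snd hu)
      have h4 : u.2 = 0 := hbij.1 (((smul_eq_zero.1 h3).resolve_left hc0).trans (map_zero _).symm)
      exact Prod.ext h1 h4
    exact ⟨hinj, (LinearMap.injective_iff_surjective
      (f := (fderiv ℝ (initialPoint A) 0 : Cot →ₗ[ℝ] Cot))).1 hinj⟩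

/-- Both families vanish to second order at 0, so the identity between them and its transport
formula at the origin leave no affine part in b. -/
theorem PCEquivOver.offset_eq_zero {k : ℕ} {F G : Par k → ℝ} {S R : Cot → Cot}
    (h : PCEquivOver F G g c b) (hF : IsGeneratingFamily F S) (hG : IsGeneratingFamily G R) :
    b 0 = 0 ∧ fderiv ℝ b 0 = 0 := by
  obtain ⟨Φ, -, hΦ0, -, -, hΦ⟩ := h.exists_map hF.smooth hG.smooth
  have lift0 : ∀ {F : Par k → ℝ}, fderiv ℝ F 0 = 0 → lift F 0 = 0 := fun h =>
    Prod.ext rfl (funext fun m => by simp [lift, dq, h])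
  constructor
  · obtain ⟨φ₁, φ₂, Φ, -, -, -, -, -, -, h5, h6, -, h7, -, h9⟩ := h
    have e := h9.self_of_nhds fun _ => le_rfl
    have : Φ 0 = 0 := by
      rw [h7]
      exact Prod.ext (funext fun i => zero_mul _) (Prod.ext h5 h6)
    rw [hG.2.1, this, hF.2.1] at e
    simpa using e.symm
  · have h0 : (0 : Par k) ∈ critSet G ∅ :=
      mem_critSet_iff.2 ⟨fun _ _ => rfl, fun _ => le_rfl, fun v _ => by rw [hG.2.2.1]; rfl⟩
    have e := (hΦ ∅).self_of_nhds.2 h0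
    rw [hΦ0, hF.2.1, lift0 hG.2.2.1, lift0 hF.2.2.1] at e
    refine ContinuousLinearMap.ext fun u => ?_
    have e' : ∀ m, fderiv ℝ b 0 (Pi.single m 1) = 0 := fun m => by
      have := congrFun (congrArg Prod.snd e) m
      simpa [transport] using this.symm
    have : u = ∑ i, u i • (Pi.single i 1 : Fin 3 → ℝ) := by
      simp only [← Pi.single_smul', smul_eq_mul, mul_one, Finset.univ_sum_single]
    rw [this]
    simp only [map_sum, map_smul, e', smul_zero, Finset.sum_const_zero, zero_apply]

/-- Every germ whose generating family is equivalent to one of `F_a` is, up to a reticular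
diffeomorphism, generated by a normal form. -/
theorem exists_normalData {S R : Cot → Cot} {k : ℕ} {F G : Par k → ℝ} (ha : 1 / 4 < a)
    (hS : IsSymplecticGerm S) (hα : IsGeneratingFamily (Fa a) S) (hF : IsGeneratingFamily F S)
    (hG : IsGeneratingFamily G R) (hR : IsSymplecticGerm R) (h : PCEquiv F G) :
    ∃ D : NormalData, D.Good ∧ (D.φ₁ = fun _ => 1) ∧ (D.φ₂ = fun _ => 1) ∧ IsPotential D.fn ∧
      ∀ S₀, IsSymplecticGerm S₀ → IsGen D.fn S₀ →
        ∃ ψ, IsReticularDiffeo ψ ∧ ∀ᶠ z in 𝓝 0, R z = S₀ (ψ z) := by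
  -- F and F_a generate the same map. The same g, c, b are applied to F_a, which gives the normal
  -- form; its Lagrangian sets are then those of G.
  obtain ⟨g, c, b, h⟩ := pcEquiv_iff.1 h
  obtain ⟨hb0, hb1⟩ := h.offset_eq_zero hF hG
  have hbij := h.bijective
  have h' := h
  obtain ⟨φ₁, φ₂, Φ, -, -, hg, hc, hb, -, -, hg0, hc0, -⟩ := h'
  have hD : (NormalData.ofEquiv a g c b).Good :=
    NormalData.good_ofEquiv ha hg hc hb hg0 hc0 hbij
  have hP : IsPotential (NormalData.ofEquiv a g c b).fn :=
    NormalData.isPotential_ofEquiv hg hc hb hg0 hc0 hb0 hb1 hbij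
  refine ⟨_, hD, rfl, rfl, hP, fun S₀ hS₀ hgen => ?_⟩
  have hov := hD.pcEquivOver
  have e1 : (NormalData.ofEquiv a g c b).e 0 = a := by simp [NormalData.ofEquiv, hg0]
  rw [e1, funext fun Q => show (NormalData.ofEquiv a g c b).unfolding Q - ![0, 0, a] = g Q by
    rw [NormalData.unfolding_ofEquiv, add_sub_cancel_right]] at hov
  have hgf := hgen.isGeneratingFamily hP hS₀
  obtain ⟨T, hT, -, hTS⟩ := hS₀.exists_inverse
  obtain ⟨V, hV, hVR, hRV⟩ := hR.exists_inverse
  refine ⟨fun z => T (R z), ⟨hT.comp hR, fun σ => ?_⟩, ?_⟩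
  · filter_upwards [(hR.tendsto.eventually (hT.tendsto.eventually
      (eventually_mem_L0_of_pcEquivOver hS hα hα hF hgf hG hov h hV.tendsto hRV σ))),
      eventually_mem_L0_of_pcEquivOver hS hα hF hα hG hgf h hov hT.tendsto hTS σ, hVR,
      hR.tendsto.eventually hTS] with z h1 h2 h3 h4
    refine ⟨fun hz => ?_, h2⟩
    have := h1 hz
    rwa [h4, h3] at this
  · filter_upwards [hR.tendsto.eventually hTS] with z hz
    rw [hz]

end NormalForm

/-! ### Caustic-equivalence classes in terms of generating functions -/

section CausticClass

variable {S T R φ ψ Θ : Cot → Cot}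

theorem IsReticularDiffeo.comp (hφ : IsReticularDiffeo φ) (hψ : IsReticularDiffeo ψ) :
    IsReticularDiffeo (fun z => φ (ψ z)) := by
  refine ⟨hφ.1.comp hψ.1, fun σ => ?_⟩
  filter_upwards [hψ.1.tendsto.eventually (hφ.2 σ), hψ.2 σ] with z h1 h2
  rw [h1, h2]

theorem IsReticularDiffeo.exists_inverse (hφ : IsReticularDiffeo φ) :
    ∃ ψ, IsReticularDiffeo ψ ∧ (∀ᶠ z in 𝓝 0, ψ (φ z) = z) ∧ ∀ᶠ z in 𝓝 0, φ (ψ z) = z := by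
  obtain ⟨ψ, hψ, h1, h2⟩ := hφ.1.exists_inverse
  refine ⟨ψ, ⟨hψ, fun σ => ?_⟩, h1, h2⟩
  filter_upwards [h2, hψ.tendsto.eventually (hφ.2 σ)] with z h3 h4
  rw [← h4, h3]

theorem mem_L0_univ {z : Cot} : z ∈ L0 Finset.univ ↔ z.1 = 0 := by
  simp only [L0, Finset.mem_univ, not_true_eq_false, Set.mem_ofPred_eq, forall_const,
    funext_iff, Fin.forall_fin_succ, Pi.zero_apply, IsEmpty.forall_iff]
  tauto

theorem fderiv_along_fibre {f : Cot → Base} {c : Base} (hf : SmoothNear f 0)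
    (h : ∀ᶠ p in 𝓝 (0 : Base), f (0, p) = c) (v : Base) : fderiv ℝ f 0 (0, v) = 0 := by
  have e1 : HasFDerivAt (fun p : Base => f (0, p))
      ((fderiv ℝ f 0).comp (ContinuousLinearMap.inr ℝ Base Base)) 0 :=
    HasFDerivAt.comp (0 : Base) (g := f) (f := ContinuousLinearMap.inr ℝ Base Base)
      hf.differentiableAt.hasFDerivAt (ContinuousLinearMap.inr ℝ Base Base).hasFDerivAt
  exact DFunLike.congr_fun (e1.unique ((hasFDerivAt_const c (0 : Base)).congr_of_eventuallyEq h)) v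

theorem tendsto_fibre : Filter.Tendsto (fun p : Base => ((0, p) : Cot)) (𝓝 0) (𝓝 0) :=
  tendsto_zero_of_smooth ((smoothNear_const 0 0).prodMk (smoothNear_id 0)) rfl

theorem fderiv_fst_apply {z : Cot} (hS : DifferentiableAt ℝ S z) (v : Cot) :
    fderiv ℝ (fun z => (S z).1) z v = (fderiv ℝ S z v).1 := by
  rw [show fderiv ℝ (fun z => (S z).1) z = _ from hS.hasFDerivAt.fst.fderiv]
  rfl

/-- For σ = I₂ the set L⁰_σ is the whole fibre over 0, so a reticular diffeomorphism preserves that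
fibre. -/
theorem IsReticularDiffeo.fderiv_fst (hφ : IsReticularDiffeo φ) {v : Cot} (hv : v.1 = 0) :
    (fderiv ℝ φ 0 v).1 = 0 := by
  rw [← fderiv_fst_apply hφ.1.smooth.differentiableAt, show v = (0, v.2) from Prod.ext hv rfl]
  refine fderiv_along_fibre hφ.1.smooth.fst (c := 0) ?_ _
  filter_upwards [tendsto_fibre.eventually (hφ.2 Finset.univ)] with p hp
  exact mem_L0_univ.1 (hp.2 (mem_L0_univ.2 rfl))

theorem IsLagrangianDiffeo.fst_eq_zero (hΘ : IsLagrangianDiffeo Θ) {v : Cot}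
    (hv : (fderiv ℝ Θ 0 v).1 = 0) : v.1 = 0 := by
  obtain ⟨hs, g, hg⟩ := hΘ
  have h0 : ∀ u : Base, (fderiv ℝ Θ 0 (0, u)).1 = 0 := by
    intro u
    rw [← fderiv_fst_apply hs.smooth.differentiableAt]
    refine fderiv_along_fibre hs.smooth.fst (c := g 0) ?_ _
    filter_upwards [tendsto_fibre.eventually hg] with p hp using hp
  let M : Base →L[ℝ] Base := (ContinuousLinearMap.fst ℝ Base Base).comp
    ((fderiv ℝ Θ 0).comp (ContinuousLinearMap.inl ℝ Base Base))
  have hM : ∀ v : Cot, (fderiv ℝ Θ 0 v).1 = M v.1 := by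
    intro v
    have : v = (v.1, 0) + (0, v.2) := by simp
    conv_lhs => rw [this, map_add, Prod.fst_add, h0, add_zero]
    rfl
  have hsurj : Function.Surjective M := by
    intro y
    obtain ⟨v, hv⟩ := hs.bijective.2 (y, 0)
    exact ⟨v.1, by rw [← hM, hv]⟩
  have hinj := (LinearMap.injective_iff_surjective (f := (M : Base →ₗ[ℝ] Base))).2 hsurj
  exact hinj (((hM v).symm.trans hv).trans (map_zero M).symm)

theorem fderiv_mixedPoint {z : Cot} (hS : DifferentiableAt ℝ S z) (v : Cot) :
    fderiv ℝ (mixedPoint S) z v = (v.1, (fderiv ℝ S z v).1) := by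
  rw [show fderiv ℝ (mixedPoint S) z = _ from
    ((hasFDerivAt_fst (𝕜 := ℝ) (p := z)).prodMk hS.hasFDerivAt.fst).fderiv]
  rfl

/-- The hypothesis says that no nonzero vertical vector has a vertical image. This condition
survives composition with maps preserving the fibre over 0 on either side. -/
theorem bijective_mixedPoint (hS : DifferentiableAt ℝ S 0)
    (h : ∀ v : Cot, v.1 = 0 → (fderiv ℝ S 0 v).1 = 0 → v = 0) :
    Function.Bijective (fderiv ℝ (mixedPoint S) 0) := by
  have hinj : Function.Injective (fderiv ℝ (mixedPoint S) 0) := by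
    refine (injective_iff_map_eq_zero _).2 fun v hv => ?_
    rw [fderiv_mixedPoint hS] at hv
    exact h v (congrArg Prod.fst hv) (congrArg Prod.snd hv)
  exact ⟨hinj, (LinearMap.injective_iff_surjective
    (f := (fderiv ℝ (mixedPoint S) 0 : Cot →ₗ[ℝ] Cot))).1 hinj⟩

theorem IsGen.bijective_mixedPoint {A : Cot → ℝ} (hA : IsPotential A) (hS : IsSymplecticGerm S)
    (h : IsGen A S) : Function.Bijective (fderiv ℝ (mixedPoint S) 0) := by
  have e1 : HasFDerivAt (mixedPoint S) (fderiv ℝ (mixedPoint S) 0) (initialPoint A 0) := by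
    rw [initialPoint_zero hA.fderiv_zero]
    exact (smoothNear_mixedPoint hS.smooth).differentiableAt.hasFDerivAt
  have e2 := e1.comp (0 : Cot) (smoothNear_initialPoint hA.smooth).differentiableAt.hasFDerivAt
  have e3 := e2.unique ((hasFDerivAt_id (0 : Cot)).congr_of_eventuallyEq h.mixedPoint_initialPoint)
  have hsurj : Function.Surjective (fderiv ℝ (mixedPoint S) 0) := fun v =>
    ⟨_, DFunLike.congr_fun e3 v⟩
  exact ⟨(LinearMap.injective_iff_surjective
    (f := (fderiv ℝ (mixedPoint S) 0 : Cot →ₗ[ℝ] Cot))).2 hsurj, hsurj⟩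

/-- Lagrangian equivalence preserves the existence of a generating function. -/
theorem LagrangianEquiv.bijective_mixedPoint (hS : IsSymplecticGerm S) (hT : IsSymplecticGerm T)
    (h : LagrangianEquiv S T) (hb : Function.Bijective (fderiv ℝ (mixedPoint S) 0)) :
    Function.Bijective (fderiv ℝ (mixedPoint T) 0) := by
  obtain ⟨η, Θ, hη, hΘ, h⟩ := h
  obtain ⟨χ, hχ, -, hηχ⟩ := hη.exists_inverse
  refine RetLag.bijective_mixedPoint hT.smooth.differentiableAt fun v hv hv' => ?_
  have hev : T =ᶠ[𝓝 0] fun z => Θ (S (χ z)) := by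
    filter_upwards [hηχ, hχ.1.tendsto.eventually h] with z h1 h2
    rw [← h2, h1]
  have hd : HasFDerivAt (fun z => Θ (S (χ z)))
      ((fderiv ℝ Θ 0).comp ((fderiv ℝ S 0).comp (fderiv ℝ χ 0))) 0 := by
    have e1 : HasFDerivAt S (fderiv ℝ S 0) (χ 0) := by
      rw [hχ.1.zero]; exact hS.smooth.differentiableAt.hasFDerivAt
    have e2 : HasFDerivAt Θ (fderiv ℝ Θ 0) (S (χ 0)) := by
      rw [hχ.1.zero, hS.zero]; exact hΘ.1.smooth.differentiableAt.hasFDerivAt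
    exact HasFDerivAt.comp (0 : Cot) (g := Θ) e2
      (e1.comp (0 : Cot) hχ.1.smooth.differentiableAt.hasFDerivAt)
  rw [hev.fderiv_eq, hd.fderiv] at hv'
  have h1 : (fderiv ℝ S 0 (fderiv ℝ χ 0 v)).1 = 0 := hΘ.fst_eq_zero hv'
  have h2 : fderiv ℝ χ 0 v = 0 := by
    refine hb.1 ?_
    rw [fderiv_mixedPoint hS.smooth.differentiableAt, hχ.fderiv_fst hv, h1, map_zero]
    rfl
  exact hχ.1.bijective.1 (h2.trans (map_zero _).symm)

theorem exists_normalData_of_mem_causticClass {a : ℝ} (ha : 1 / 4 < a) (hS : IsSymplecticGerm S)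
    (hα : IsGeneratingFamily (Fa a) S) (hT : T ∈ causticClass S) :
    ∃ (D : NormalData) (S₀ : Cot → Cot), D.Good ∧ (D.φ₁ = fun _ => 1) ∧ (D.φ₂ = fun _ => 1) ∧
      IsPotential D.fn ∧ IsSymplecticGerm S₀ ∧ IsGen D.fn S₀ ∧ LagrangianEquiv S₀ T := by
  obtain ⟨R, hR, ⟨k, F, G, hF, hG, hFG⟩, hT, φ, Θ, hφ, hΘ, h⟩ := hT
  obtain ⟨D, hD, h1, h2, hP, hψ⟩ := exists_normalData ha hS hα hF hG hR hFG
  obtain ⟨S₀, sS₀, hS₀, hgen⟩ := hP.exists_isGen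
  have hsym := hgen.isSymplecticGerm hP sS₀ hS₀
  obtain ⟨ψ, hψ, hRψ⟩ := hψ S₀ hsym hgen
  obtain ⟨χ, hχ, -, hψχ⟩ := hψ.exists_inverse
  refine ⟨D, S₀, hD, h1, h2, hP, hsym, hgen, _, Θ, hφ.comp hχ, hΘ, ?_⟩
  filter_upwards [hχ.1.tendsto.eventually h, hχ.1.tendsto.eventually hRψ, hψχ] with z h3 h4 h5
  rw [h3, h4, h5]

theorem NormalData.Good.mem_causticClass {D : NormalData} (hD : D.Good) (hP : IsPotential D.fn)
    (hS : IsGeneratingFamily (Fa (D.e 0)) S) (hR : IsSymplecticGerm R) (hgen : IsGen D.fn R)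
    (hT : T ∈ lagrangianClass R) : T ∈ causticClass S :=
  ⟨R, hR, ⟨0, _, _, hS, hgen.isGeneratingFamily hP hR, pcEquiv_iff.2 ⟨_, _, _, hD.pcEquivOver⟩⟩, hT⟩

/-! ### The set of potentials whose jets lie in the weak class -/

variable {l : ℕ} {S' : ℝ → Cot → Cot}

theorem mem_weakCausticClass {j : JetSpace l} : j ∈ weakCausticClass l S' ↔
    ∃ a, 1 / 4 < a ∧ ∃ T ∈ causticClass (S' a), jet l T = j := by
  simp [weakCausticClass]

/-- The potentials whose germs have jets in the weak caustic-equivalence class. -/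
def potentialClass (l : ℕ) (S' : ℝ → Cot → Cot) : Set (potentialJets (l + 1)) :=
  {θ | IsPotential (potential θ) ∧ genJet l θ ∈ weakCausticClass l S'}

/-- No germ of the class is missed: a normal form has a generating function by construction, and
Lagrangian equivalence preserves the transversality that yields one. -/
theorem genJet_image_potentialClass (hl : 1 ≤ l) (hS' : ∀ a : ℝ, 1 / 4 < a →
      IsSymplecticGerm (S' a) ∧ IsGeneratingFamily (Fa a) (S' a)) :
    genJet l '' potentialClass l S' = weakCausticClass l S' := by
  refine Set.Subset.antisymm ?_ fun j hj => ?_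
  · rintro _ ⟨θ, hθ, rfl⟩
    exact hθ.2
  obtain ⟨a, ha, T, hT, rfl⟩ := mem_weakCausticClass.1 hj
  obtain ⟨D, S₀, -, -, -, hP, hS₀, hgen, hL⟩ :=
    exists_normalData_of_mem_causticClass ha (hS' a ha).1 (hS' a ha).2 hT
  have hTs : IsSymplecticGerm T := hT.choose_spec.2.2.1
  obtain ⟨A, hA, hAT⟩ := hTs.exists_isGen
    (hL.bijective_mixedPoint hS₀ hTs (hgen.bijective_mixedPoint hP hS₀))
  have := genJet_toJet hl hA hAT
  exact ⟨hA.toJet (l + 1), ⟨hA.isPotential_potential (by omega), this ▸ hj⟩, this⟩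

/-- A germ of the class is Θ ∘ S₀ ∘ η⁻¹ with S₀ generated by a normal form. Undoing the fixed Θ and
η on nearby germs gives germs whose jets are close to that of S₀. Their potentials have the jets of
normal forms, possibly with another modulus a, and applying Θ and η again returns to the class. -/
theorem isOpen_potentialClass (hl : 1 ≤ l) (hS' : ∀ a : ℝ, 1 / 4 < a →
      IsSymplecticGerm (S' a) ∧ IsGeneratingFamily (Fa a) (S' a)) :
    IsOpen (potentialClass l S') := by
  refine isOpen_iff_mem_nhds.2 fun θ ⟨hθ, hj⟩ => ?_
  obtain ⟨a, ha, T, hT, hTj⟩ := mem_weakCausticClass.1 hj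
  obtain ⟨D, S₀, hD, hφ₁, hφ₂, hP, hS₀, hgen, η, Θ, hη, hΘ, hL⟩ :=
    exists_normalData_of_mem_causticClass ha (hS' a ha).1 (hS' a ha).2 hT
  have hTs : IsSymplecticGerm T := hT.choose_spec.2.2.1
  obtain ⟨χ, hχ, hχη, hηχ⟩ := hη.exists_inverse
  obtain ⟨Ξ, hΞ, hΞΘ, hΘΞ⟩ := hΘ.1.exists_inverse
  obtain ⟨S, hS, hfam⟩ := exists_smooth_family hθ (by omega : 1 ≤ l + 1)
  have hSθ := hfam.self_of_nhds
  -- the family of germs that has to be compared with `S₀`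
  let V : potentialJets (l + 1) → Cot → Cot := fun s z => Ξ (S s (η z))
  have hV : SmoothNear (Function.uncurry V) (θ, 0) :=
    hΞ.smooth.comp_of_eq (hS.comp_of_eq (f := fun p : potentialJets (l + 1) × Cot => (p.1, η p.2))
      ((smoothNear_id _).fst.prodMk (hη.1.smooth.comp_of_eq (smoothNear_id _).snd rfl))
      (by simp [hη.1.zero])) (by simp [hη.1.zero, hSθ.2.2.zero])
  have hVsym : ∀ᶠ s in 𝓝 θ, IsSymplecticGerm (V s) := by
    filter_upwards [hfam] with s hs using hΞ.comp (hs.2.2.comp hη.1)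
  have hTS : JetEq l T (S θ) := by
    refine jets_eq_iff.1 (hTj.trans ?_)
    exact genJet_eq hθ hθ (jets_potential θ) hSθ.2.1
  have hVj : jet l (V θ) = jet l S₀ := by
    refine jets_eq_iff.2 ?_
    have e1 : JetEq l (V θ) (fun z => Ξ (T (η z))) :=
      (JetEq.refl l Ξ).comp (hTS.symm.comp (JetEq.refl l η) hSθ.2.2.smooth hTs.smooth
        hη.1.smooth hη.1.smooth hη.1.zero hη.1.zero) hΞ.smooth hΞ.smooth
        (hSθ.2.2.comp hη.1).smooth (hTs.comp hη.1).smooth (hSθ.2.2.comp hη.1).zero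
        (hTs.comp hη.1).zero
    refine e1.trans (JetEq.of_eventuallyEq ?_)
    filter_upwards [hL, hS₀.tendsto.eventually hΞΘ] with z h1 h2
    rw [h1, h2]
  have hb₀ := hgen.bijective_mixedPoint hP hS₀
  have hbθ : Function.Bijective (fderiv ℝ (mixedPoint (V θ)) 0) := by
    have sV := hVsym.self_of_nhds.smooth
    rw [(((jets_eq_iff.1 hVj).mono hl).mixedPoint sV hS₀.smooth).fderiv_eq (l := 0)]
    exact hb₀
  have hb : ∀ᶠ s in 𝓝 θ, Function.Bijective (fderiv ℝ (mixedPoint (V s)) 0) := by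
    have hX : SmoothNear (Function.uncurry fun s z => mixedPoint (V s) z) (θ, 0) :=
      (smoothNear_id _).snd.fst.prodMk hV.fst
    exact eventually_bijective hX.partial_fderiv.left.continuousAt hbθ
  obtain ⟨ρ, hρ, hρA⟩ := exists_smooth_potentialJet hl hS₀ hb₀
  have hρ₀ : ρ (jet l S₀) = jets (l + 1) D.fn := hρA.self_of_nhds _ _ hP hS₀ hgen rfl
  have hjets : Filter.Tendsto (fun s => jet l (V s)) (𝓝 θ) (𝓝 (jet l S₀)) := by
    have := (hV.jets (n := l)).continuousAt.tendsto
    rwa [show jets l (V θ) = jet l S₀ from hVj] at this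
  have hopen := NormalData.eventually_exists_good hD hφ₁ hφ₂ hP (n := l + 1) (by omega)
  -- `ρ` takes values in all jets, so the neighbourhood in `potentialJets` is restated in the
  -- ambient space.
  rw [nhds_subtype_eq_comap, Filter.eventually_comap] at hopen
  have hopen' := (hρ.continuousAt.tendsto.comp hjets).eventually
    (p := fun j : Jets (l + 1) Cot ℝ => ∀ θ' : potentialJets (l + 1), θ'.1 = j →
      ∃ D' : NormalData, D'.Good ∧ IsPotential D'.fn ∧
        jets (l + 1) D'.fn = θ'.1)
    (by rw [hρ₀]; exact hopen)
  filter_upwards [hfam, hVsym, hb, hjets.eventually hρA, hopen'] with s ⟨hs1, hs2, hs3⟩ h1 h2 h3 h4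
  refine ⟨hs1, ?_⟩
  obtain ⟨A, hA, hAV⟩ := h1.exists_isGen h2
  obtain ⟨D', hD', hP', hDA⟩ := h4 (hA.toJet (l + 1)) (h3 A _ hA h1 hAV rfl).symm
  obtain ⟨R, sR, hR0, hR⟩ := hP'.exists_isGen
  have hRs := hR.isSymplecticGerm hP' sR hR0
  -- `R` and `V s` agree only to order l, which is enough because membership depends on l-jets only.
  have hRV : JetEq l R (V s) := hR.jetEq hP' hA hAV (jets_eq_iff.1 hDA)
  have hTs' := hΘ.1.comp (hRs.comp hχ.1)
  refine mem_weakCausticClass.2 ⟨D'.e 0, hD'.e_gt, fun z => Θ (R (χ z)),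
    hD'.mem_causticClass hP' (hS' _ hD'.e_gt).2 hRs hR ⟨hTs', η, Θ, hη, hΘ, ?_⟩, ?_⟩
  · filter_upwards [hχη] with z hz
    rw [hz]
  · rw [genJet_eq hs1 hs1 (jets_potential s) hs2]
    refine jets_eq_iff.2 ?_
    have e1 : JetEq l (fun z => Θ (R (χ z))) (fun z => Θ (V s (χ z))) :=
      (JetEq.refl l Θ).comp (hRV.comp (JetEq.refl l χ) hRs.smooth h1.smooth hχ.1.smooth
        hχ.1.smooth hχ.1.zero hχ.1.zero) hΘ.1.smooth hΘ.1.smooth (hRs.comp hχ.1).smooth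
        (h1.comp hχ.1).smooth (hRs.comp hχ.1).zero (h1.comp hχ.1).zero
    refine e1.trans (JetEq.of_eventuallyEq ?_)
    filter_upwards [hηχ, hs3.tendsto.eventually hΘΞ] with z h5 h6
    simp only [V, h5, h6]

end CausticClass

/-! ### The immersed manifold -/

section Immersion

variable {l : ℕ}

/-- `genJet` has local smooth left inverses. -/
theorem exists_leftInverse_genJet (hl : 1 ≤ l) {θ : potentialJets (l + 1)}
    (hθ : IsPotential (potential θ)) :
    ∃ ρ : JetSpace l → potentialJets (l + 1), SmoothNear ρ (genJet l θ) ∧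
      (∀ᶠ s in 𝓝 θ, ρ (genJet l s) = s) ∧
      ∀ s, IsPotential (potential s) → genJet l s = genJet l θ → s = θ := by
  obtain ⟨S, -, hS⟩ := exists_smooth_family hθ (by omega : 1 ≤ l + 1)
  have hSθ := hS.self_of_nhds
  have hj : ∀ {s S}, IsPotential (potential s) → IsGen (potential s) S → genJet l s = jet l S :=
    fun hs h => genJet_eq hs hs (jets_potential _) h
  obtain ⟨ρ, hρ, hρA⟩ := exists_smooth_potentialJet hl hSθ.2.2
    (hSθ.2.1.bijective_mixedPoint hθ hSθ.2.2)
  rw [← hj hθ hSθ.2.1] at hρ hρA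
  obtain ⟨π, hπ, hπ1, -, -⟩ := exists_projection (V := Jets (l + 1) Cot ℝ) (potentialJets (l + 1))
  have left : ∀ s, IsPotential (potential s) → (∀ A S, IsPotential A → IsSymplecticGerm S →
      IsGen A S → jet l S = genJet l s → ρ (genJet l s) = jets (l + 1) A) →
      π (ρ (genJet l s)) = s := by
    intro s hs h
    obtain ⟨R, sR, hR0, hR⟩ := hs.exists_isGen
    rw [h _ R hs (hR.isSymplecticGerm hs sR hR0) hR (hj hs hR).symm, jets_potential, hπ1]
  refine ⟨fun j => π (ρ j), (ContDiff.smoothNear hπ _).comp hρ, ?_, fun s hs h => ?_⟩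
  · filter_upwards [hS, (smoothNear_genJet hθ).continuousAt.eventually hρA] with s h1 h2
    exact left s h1.1 h2
  · have h1 := hρA.self_of_nhds
    rw [← left θ hθ h1, ← h, left s hs (by rwa [h])]

/-- The injective image of an open set under a smooth map with local smooth left inverses. -/
theorem isImmersedManifoldIn_image_euclidean {d : ℕ} {W : Type} [NormedAddCommGroup W]
    [NormedSpace ℝ W] {f : EuclideanSpace ℝ (Fin d) → W} {Ω : Set (EuclideanSpace ℝ (Fin d))}
    (hΩ : IsOpen Ω) (hf : ∀ x ∈ Ω, ContDiffAt ℝ ∞ f x) (hinj : Set.InjOn f Ω)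
    (hleft : ∀ x ∈ Ω, ∃ ρ : W → EuclideanSpace ℝ (Fin d), ContDiffAt ℝ ∞ ρ (f x) ∧
      ∀ᶠ y in 𝓝 x, ρ (f y) = y) {N : Set W} (hN : f '' Ω ⊆ N) :
    IsImmersedManifoldIn (f '' Ω) N := by
  let M : TopologicalSpace.Opens (EuclideanSpace ℝ (Fin d)) := ⟨Ω, hΩ⟩
  have hF : ContMDiff (𝓡 d) 𝓘(ℝ, W) ∞ (fun x : M => f x) := fun x =>
    contMDiffAt_subtype_iff.2 (hf x x.2).contMDiffAt
  refine ⟨hN, d, M, inferInstance, inferInstance, fun x => f x, inferInstance, inferInstance,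
    inferInstance, hF, fun x y hxy => Subtype.ext (hinj x.2 y.2 hxy), fun x => ?_, ?_⟩
  · obtain ⟨ρ, hρ, hρ1⟩ := hleft x x.2
    classical
    -- The left inverse must take values in the open submanifold. Points outside are sent to x,
    -- which is harmless because only a neighbourhood of x is used.
    let r : EuclideanSpace ℝ (Fin d) → M := fun y => if h : y ∈ M then ⟨y, h⟩ else x
    have hr : ∀ y : M, r y = y := fun y => dif_pos y.2
    have hrs : ContMDiffAt (𝓡 d) (𝓡 d) ∞ r (x : EuclideanSpace ℝ (Fin d)) := by
      rw [← contMDiffAt_subtype_iff]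
      simp only [hr]
      exact contMDiffAt_id
    have hK : ContMDiffAt 𝓘(ℝ, W) (𝓡 d) ∞ (fun j => r (ρ j)) (f x) := by
      refine ContMDiffAt.comp (f x) (g := r) ?_ hρ.contMDiffAt
      rwa [show ρ (f x) = x from hρ1.self_of_nhds]
    have hid : ((fun j => r (ρ j)) ∘ fun y : M => f y) =ᶠ[𝓝 x] id := by
      filter_upwards [(continuous_subtype_val.tendsto x).eventually hρ1] with y hy
      simp only [Function.comp_apply, hy, hr, id]
    have hc := mfderiv_comp x (I := 𝓡 d) (I' := 𝓘(ℝ, W)) (I'' := 𝓡 d)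
      (hK.mdifferentiableAt (by simp)) ((hF x).mdifferentiableAt (by simp))
    have hid' := hid.mfderiv_eq (I := 𝓡 d) (I' := 𝓡 d)
    rw [mfderiv_id] at hid'
    have hc' := hc.symm.trans hid'
    exact Function.LeftInverse.injective fun v => DFunLike.congr_fun hc' v
  · ext j
    constructor
    · rintro ⟨x, rfl⟩
      exact ⟨x, x.2, rfl⟩
    · rintro ⟨x, hx, rfl⟩
      exact ⟨⟨x, hx⟩, rfl⟩

theorem isImmersedManifoldIn_image {V W : Type} [NormedAddCommGroup V] [NormedSpace ℝ V]
    [FiniteDimensional ℝ V] [NormedAddCommGroup W] [NormedSpace ℝ W] {f : V → W} {Ω : Set V}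
    (hΩ : IsOpen Ω) (hf : ∀ x ∈ Ω, ContDiffAt ℝ ∞ f x) (hinj : Set.InjOn f Ω)
    (hleft : ∀ x ∈ Ω, ∃ ρ : W → V, ContDiffAt ℝ ∞ ρ (f x) ∧ ∀ᶠ y in 𝓝 x, ρ (f y) = y)
    {N : Set W} (hN : f '' Ω ⊆ N) : IsImmersedManifoldIn (f '' Ω) N := by
  let e : EuclideanSpace ℝ (Fin (Module.finrank ℝ V)) ≃L[ℝ] V := (toEuclidean (E := V)).symm
  have himage : f '' Ω = (fun x => f (e x)) '' (e ⁻¹' Ω) := by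
    rw [show (fun x => f (e x)) = f ∘ e from rfl, Set.image_comp,
      Set.image_preimage_eq _ e.surjective]
  rw [himage] at hN ⊢
  refine isImmersedManifoldIn_image_euclidean (hΩ.preimage e.continuous)
    (fun x hx => (hf _ hx).comp x e.contDiff.contDiffAt)
    (fun x hx y hy h => e.injective (hinj hx hy h)) (fun x hx => ?_) hN
  obtain ⟨ρ, hρ, hρ1⟩ := hleft _ hx
  refine ⟨fun j => e.symm (ρ j), e.symm.contDiff.contDiffAt.comp _ hρ, ?_⟩
  filter_upwards [(e.continuous.tendsto x).eventually hρ1] with y hy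
  rw [Function.comp_apply, hy, e.symm_apply_apply]

end Immersion

end RetLag

end

/-! ### The weak class as the injective image of an open set of potentials -/

theorem corollary4p2 (l : ℕ) (hl : 1 ≤ l) (S' : ℝ → RetLag.Cot → RetLag.Cot)
    (hS' : ∀ a : ℝ, 1 / 4 < a →
      RetLag.IsSymplecticGerm (S' a) ∧ RetLag.IsGeneratingFamily (RetLag.Fa a) (S' a)) :
    RetLag.IsImmersedManifoldIn (RetLag.weakCausticClass l S') (RetLag.symplecticJets l) := by
  have h := RetLag.genJet_image_potentialClass hl hS'
  rw [← h]
  refine RetLag.isImmersedManifoldIn_image (V := RetLag.potentialJets (l + 1))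
    (RetLag.isOpen_potentialClass hl hS')
    (fun θ hθ => (RetLag.smoothNear_genJet hθ.1).contDiffAt) (fun θ hθ s hs e => ?_)
    (fun θ hθ => ?_) ?_
  · obtain ⟨-, -, -, hs'⟩ := RetLag.exists_leftInverse_genJet hl hs.1
    exact hs' θ hθ.1 e
  · obtain ⟨ρ, hρ, hρ1, -⟩ := RetLag.exists_leftInverse_genJet hl hθ.1
    exact ⟨ρ, hρ.contDiffAt, hρ1⟩
  rw [h]
  intro j hj
  obtain ⟨a, -, T, ⟨R, -, -, hT, -⟩, rfl⟩ := RetLag.mem_weakCausticClass.1 hj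
  exact ⟨T, hT, rfl⟩
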